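/- Let $(M,g)$ be a complete Riemannian manifold of dimension $n\ge 1$ (smooth, connected, with complete Riemannian distance), $\Omega\subset M$ a bounded open set with smooth boundary $\partial\Omega$ (near each boundary point $\Omega$ is one side of a smooth hypersurface) and outward unit normal $\nu$, and $u:M\to\mathbb R$ a smooth function that is harmonic in $\Omega$, $\Delta u=0$. Let $\nabla$ be the Levi-Civita connection, write $\nabla_k\nabla_i\nabla_j u$ for the components of $\nabla^3u=\nabla(\nabla^2u)$, with $k$ the index of the last derivative, let $\Delta\nabla u$ be the vector field $(\Delta\nabla u)^j=\nabla^i\nabla_i\nabla^j u$, let $Rm=(R_{ijkl})$ be the Riemann tensor with the sign for which $R_{1221}>0$ on round spheres and $Rc_{il}=R_{il}=g^{jk}R_{ijkl}$ the Ricci tensor; norms of tensors are those induced by $g$ (full contractions), and indices are raised with $g$. Put $$\mathcal B=\int_{\partial\Omega}\Big(\nabla\nabla\nabla u(\nabla\nabla u,\nu)-\nabla\nabla u(\Delta\nabla u,\nu)\Big)\,dA_g,\qquad \nabla\nabla\nabla u(\nabla\nabla u,\nu)=\nabla^p\nabla^i u\;\nabla_p\nabla_i\nabla_l u\;\nu^l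 .$$ (1) The following identity holds: $$\begin{aligned}\int_\Omega|\nabla^3u|^2\,dV_g=&\int_\Omega\Big(2Rc(\nabla u,\Delta\nabla u)-Rc^2(\nabla u,\nabla u)-R_{pr}\,\nabla^r\nabla^i u\,\nabla^p\nabla_i u\Big)dV_g\\&+\int_\Omega\Big(R_{pmjr}\,\nabla^m\nabla^p\nabla^j u\,\nabla^r u-R_{pljr}\,\nabla^l\nabla^r u\,\nabla^p\nabla^j u\Big)dV_g+\mathcal B,\end{aligned}$$ where $Rc^2(\nabla u,\nabla u)=g^{ij}R_{ik}R_{jl}\nabla^ku\nabla^lu$. (2) For every $\eta>0$ there is a constant $C>0$ depending only on $\eta$ (not on $n,M,g,\Omega,u,p$) such that, for every $p>1$, with $K=\big(\int_\Omega(|Rm|^3+|Rc|^3)\,dV_g\big)^{1/3}$, $$\begin{aligned}\int_\Omega|\nabla^3u|^2\,dV_g\le\;&C\Big(\int_\Omega\big(|Rm|^{2p}+|Rc|^{2p}\big)dV_g\Big)^{1/p}\Big(\int_\Omega|\nabla u|^{\frac{2p}{p-1}}dV_g\Big)^{\frac{p-1}{p}}+C\max\Big(2K,\;K^2\,\|\nabla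 u\|_{L^6(\Omega)}^2\Big)\\&+C\,K\,\max\Big(1,\int_{\partial\Omega}|\nabla^2u|^2|\nabla u|\,dA_g\Big)+(1+\eta)\,\mathcal B .\end{aligned}$$ -/

import Mathlib

open Bundle
open scoped Manifold ContDiff Bundle ENNReal

noncomputable section

namespace HarmonicEstimates

/-- The model space `ℝⁿ` with its Euclidean norm. -/
abbrev Coord (n : ℕ) : Type := EuclideanSpace ℝ (Fin n)

/-! ### Tensor calculus in coordinates

`G : Coord n → Matrix (Fin n) (Fin n) ℝ` is the matrix field `g_ij` of a metric in coordinates and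
`f : Coord n → ℝ` is a function in coordinates.  All tensors below are given by their covariant
components, unless "raised" is mentioned. -/

section Coordinates

variable {n : ℕ}

/-- The partial derivative `∂_i f (y)`. -/
def pd (f : Coord n → ℝ) (i : Fin n) (y : Coord n) : ℝ :=
  fderiv ℝ f y (EuclideanSpace.single i 1)

/-- The Christoffel symbol `Γ^k_ij` of the Levi-Civita connection. -/
def christoffel (G : Coord n → Matrix (Fin n) (Fin n) ℝ) (k i j : Fin n) (y : Coord n) : ℝ :=
  (1 / 2) * ∑ l, (G y)⁻¹ k l *
    (pd (fun z => G z j l) i y + pd (fun z => G z i l) j y - pd (fun z => G z i j) l y)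

/-- The component `∇_i ∇_j f = ∂_i ∂_j f - Γ^k_ij ∂_k f` of the Hessian. -/
def coordHess (G : Coord n → Matrix (Fin n) (Fin n) ℝ) (f : Coord n → ℝ) (i j : Fin n)
    (y : Coord n) : ℝ :=
  pd (pd f j) i y - ∑ k, christoffel G k i j y * pd f k y

/-- The component `∇_k ∇_i ∇_j f` of the covariant derivative of the Hessian (the index `k` belongs
to the last derivative that is taken). -/
def coordThird (G : Coord n → Matrix (Fin n) (Fin n) ℝ) (f : Coord n → ℝ) (k i j : Fin n)
    (y : Coord n) : ℝ :=
  pd (coordHess G f i j) k y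
    - ∑ l, (christoffel G l k i y * coordHess G f l j y
        + christoffel G l k j y * coordHess G f i l y)

/-- The component `R_ijk^l` of the curvature:
`∇_i ∇_j ∂_k - ∇_j ∇_i ∂_k = R_ijk^l ∂_l`. -/
def coordRiemMixed (G : Coord n → Matrix (Fin n) (Fin n) ℝ) (i j k l : Fin n) (y : Coord n) : ℝ :=
  pd (christoffel G l j k) i y - pd (christoffel G l i k) j y
    + ∑ m, (christoffel G m j k y * christoffel G l i m y
        - christoffel G m i k y * christoffel G l j m y)

/-- The component `R_ijkl` of the Riemann curvature tensor, with the sign for which `R_1221` is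
positive on round spheres. -/
def coordRiem (G : Coord n → Matrix (Fin n) (Fin n) ℝ) (i j k l : Fin n) (y : Coord n) : ℝ :=
  ∑ m, G y l m * coordRiemMixed G i j k m y

/-- The component `R_il = g^jk R_ijkl` of the Ricci tensor. -/
def coordRic (G : Coord n → Matrix (Fin n) (Fin n) ℝ) (i l : Fin n) (y : Coord n) : ℝ :=
  ∑ j, ∑ k, (G y)⁻¹ j k * coordRiem G i j k l y

/-- The squared norm of a covariant `r`-tensor with components `T`, with respect to the metric
whose inverse matrix is `A`: the full contraction `A^{a₁b₁} ⋯ A^{aᵣbᵣ} T_{a₁⋯aᵣ} T_{b₁⋯bᵣ}`. -/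
def tensorNormSq (A : Matrix (Fin n) (Fin n) ℝ) {r : ℕ} (T : (Fin r → Fin n) → ℝ) : ℝ :=
  ∑ a : Fin r → Fin n, ∑ b : Fin r → Fin n, (∏ s, A (a s) (b s)) * T a * T b

end Coordinates

/-! ### Riemannian manifolds

`M` is a manifold modelled on `ℝⁿ` whose tangent spaces carry inner products.  At a point `x`
every tensor is represented by its components in the preferred chart around `x`. -/

section Manifold

variable {n : ℕ} {M : Type*} [TopologicalSpace M] [ChartedSpace (Coord n) M]
  [RiemannianBundle (fun x : M => TangentSpace (𝓡 n) x)]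

/-- The matrix `g_ij = g(∂_i, ∂_j)` of the metric in the chart `c`, as a function on (the target
of) the chart. -/
def chartMetric (c : OpenPartialHomeomorph M (Coord n)) (y : Coord n) :
    Matrix (Fin n) (Fin n) ℝ :=
  Matrix.of fun i j => inner ℝ
    (mfderiv (𝓡 n) (𝓡 n) c.symm y (EuclideanSpace.single i (1 : ℝ) : Coord n))
    (mfderiv (𝓡 n) (𝓡 n) c.symm y (EuclideanSpace.single j (1 : ℝ) : Coord n))

/-- The metric in the preferred chart around `x`. -/
def metricNear (x : M) : Coord n → Matrix (Fin n) (Fin n) ℝ :=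
  chartMetric (chartAt (Coord n) x)

/-- The inverse metric `g^ij` at `x`. -/
def gInv (x : M) : Matrix (Fin n) (Fin n) ℝ :=
  (metricNear (n := n) x (chartAt (Coord n) x x))⁻¹

/-- The function `u` in the preferred chart around `x`. -/
def funNear (n : ℕ) [ChartedSpace (Coord n) M] (u : M → ℝ) (x : M) : Coord n → ℝ :=
  fun y => u ((chartAt (Coord n) x).symm y)

/-- `∇_i u` at `x`. -/
def du (u : M → ℝ) (x : M) (i : Fin n) : ℝ :=
  pd (funNear n u x) i (chartAt (Coord n) x x)

/-- `∇_i ∇_j u` at `x`. -/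
def hess (u : M → ℝ) (x : M) (i j : Fin n) : ℝ :=
  coordHess (metricNear x) (funNear n u x) i j (chartAt (Coord n) x x)

/-- `∇_k ∇_i ∇_j u` at `x`. -/
def third (u : M → ℝ) (x : M) (k i j : Fin n) : ℝ :=
  coordThird (metricNear x) (funNear n u x) k i j (chartAt (Coord n) x x)

/-- The curvature tensor `R_ijkl` at `x`. -/
def riem (x : M) (i j k l : Fin n) : ℝ :=
  coordRiem (metricNear x) i j k l (chartAt (Coord n) x x)

/-- The Ricci tensor `R_ij` at `x`. -/
def ric (x : M) (i j : Fin n) : ℝ :=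
  coordRic (metricNear x) i j (chartAt (Coord n) x x)

/-- The Laplacian `Δ u = g^ij ∇_i ∇_j u`. -/
def laplacian (n : ℕ) [ChartedSpace (Coord n) M]
    [RiemannianBundle (fun x : M => TangentSpace (𝓡 n) x)] (u : M → ℝ) (x : M) : ℝ :=
  ∑ i : Fin n, ∑ j, gInv x i j * hess u x i j

/-! Raised components. -/

/-- The gradient `∇^i u`. -/
def gradUp (u : M → ℝ) (x : M) (i : Fin n) : ℝ := ∑ j, gInv x i j * du u x j

/-- The Hessian with its first index raised, `∇^i ∇_j u`. -/
def hessMixed (u : M → ℝ) (x : M) (i j : Fin n) : ℝ := ∑ k, gInv x i k * hess u x k j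

/-- The Hessian with both indices raised, `∇^i ∇^j u`. -/
def hessUp (u : M → ℝ) (x : M) (i j : Fin n) : ℝ :=
  ∑ k, ∑ l, gInv x i k * gInv x j l * hess u x k l

/-- The third derivative with all indices raised, `∇^k ∇^i ∇^j u`. -/
def thirdUp (u : M → ℝ) (x : M) (k i j : Fin n) : ℝ :=
  ∑ a, ∑ b, ∑ c, gInv x k a * gInv x i b * gInv x j c * third u x a b c

/-- The rough Laplacian of the gradient, `(Δ ∇u)^j = g^ki g^jl ∇_k ∇_i ∇_l u`. -/
def lapGradUp (u : M → ℝ) (x : M) (j : Fin n) : ℝ :=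
  ∑ l, ∑ k, ∑ i, gInv x j l * gInv x k i * third u x k i l

/-! Norms. -/

variable (n)

/-- `|∇u|` -/
def normGrad (u : M → ℝ) (x : M) : ℝ :=
  √(tensorNormSq (n := n) (gInv x) (r := 1) fun a => du u x (a 0))

/-- `|∇²u|` -/
def normHess (u : M → ℝ) (x : M) : ℝ :=
  √(tensorNormSq (n := n) (gInv x) (r := 2) fun a => hess u x (a 0) (a 1))

/-- `|∇³u|` -/
def normThird (u : M → ℝ) (x : M) : ℝ :=
  √(tensorNormSq (n := n) (gInv x) (r := 3) fun a => third u x (a 0) (a 1) (a 2))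

/-- `|Rm|` -/
def normRiem (x : M) : ℝ :=
  √(tensorNormSq (n := n) (gInv x) (r := 4) fun a => riem x (a 0) (a 1) (a 2) (a 3))

/-- `|Rc|` -/
def normRic (x : M) : ℝ :=
  √(tensorNormSq (n := n) (gInv x) (r := 2) fun a => ric x (a 0) (a 1))

/-! The contractions of the integral identity. -/

/-- `Rc(∇u, Δ∇u)` -/
def ricGradLapGrad (u : M → ℝ) (x : M) : ℝ :=
  ∑ i : Fin n, ∑ j, ric x i j * gradUp u x i * lapGradUp u x j

/-- `Rc²(∇u, ∇u) = g^ij (R_ik ∇^k u) (R_jl ∇^l u)` -/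
def ricSqGradGrad (u : M → ℝ) (x : M) : ℝ :=
  ∑ i : Fin n, ∑ j, gInv x i j * (∑ k, ric x i k * gradUp u x k) * (∑ l, ric x j l * gradUp u x l)

/-- `Rc * ∇∇u * ∇∇u = g^ij R_pr (∇^r ∇_j u) (∇^p ∇_i u)` -/
def ricHessHess (u : M → ℝ) (x : M) : ℝ :=
  ∑ p : Fin n, ∑ r, ∑ i, ∑ j, ric x p r * gInv x i j * hessMixed u x r j * hessMixed u x p i

/-- `Rm * ∇∇∇u * ∇u = R_pmjr (∇^m ∇^p ∇^j u) ∇^r u` -/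
def riemThirdGrad (u : M → ℝ) (x : M) : ℝ :=
  ∑ p : Fin n, ∑ m, ∑ j, ∑ r, riem x p m j r * thirdUp u x m p j * gradUp u x r

/-- `Rm * ∇∇u * ∇∇u = R_pljr (∇^l ∇^r u) (∇^p ∇^j u)` -/
def riemHessHess (u : M → ℝ) (x : M) : ℝ :=
  ∑ p : Fin n, ∑ l, ∑ j, ∑ r, riem x p l j r * hessUp u x l r * hessUp u x p j

/-- `∇∇∇u(∇∇u, ν) = (∇^p ∇^i u) (∇_p ∇_i ∇_l u) ν^l` at `x`, for a tangent vector `ν` at `x`. -/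
def thirdHessNormal (u : M → ℝ) (x : M) (ν : Fin n → ℝ) : ℝ :=
  ∑ p : Fin n, ∑ i, ∑ l, hessUp u x p i * third u x p i l * ν l

/-- `∇∇u(Δ∇u, ν)` at `x`, for a tangent vector `ν` at `x`. -/
def hessLapGradNormal (u : M → ℝ) (x : M) (ν : Fin n → ℝ) : ℝ :=
  ∑ i : Fin n, ∑ j, hess u x i j * lapGradUp u x i * ν j

variable {n}

/-- The Riemannian measure `√(det g) dy` of the domain of a chart. -/
def chartVolume [MeasurableSpace M] (c : OpenPartialHomeomorph M (Coord n)) :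
    MeasureTheory.Measure M :=
  (((MeasureTheory.volume : MeasureTheory.Measure (Coord n)).restrict c.target).withDensity
    fun y => ENNReal.ofReal √((chartMetric c y).det)).map c.symm

variable (n) (M) in
/-- The Riemannian volume measure `dV_g`.  The measures `chartVolume` agree on the overlaps of
charts, and `dV_g` is the measure that they are the restrictions of, that is, their supremum. -/
def riemannianVolume [MeasurableSpace M] : MeasureTheory.Measure M :=
  ⨆ x : M, chartVolume (chartAt (Coord n) x)

end Manifold

/-! ### Domains with smooth boundary -/

section Boundary

variable {m : ℕ} {M : Type*} [TopologicalSpace M] [ChartedSpace (Coord (m + 1)) M]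

/-- A smooth chart `c` in whose domain `Ω` is the half-space `{y₀ < 0}` (and hence the boundary of
`Ω` is the hyperplane `{y₀ = 0}`). -/
def IsBoundaryChart (Ω : Set M) (c : OpenPartialHomeomorph M (Coord (m + 1))) : Prop :=
  c ∈ IsManifold.maximalAtlas (𝓡 (m + 1)) ∞ M ∧ ∀ x ∈ c.source, (x ∈ Ω ↔ c x 0 < 0)

variable (m) in
/-- The boundary of `Ω` is smooth: near each of its points, `Ω` is one side of a smooth
hypersurface. -/
def HasSmoothBoundary (Ω : Set M) : Prop :=
  ∀ x ∈ frontier Ω, ∃ c : OpenPartialHomeomorph M (Coord (m + 1)),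
    IsBoundaryChart Ω c ∧ x ∈ c.source

/-- The point `(0, z)` of the hyperplane `{y₀ = 0}` of `ℝ^(m+1)`. -/
def hyperplanePoint (z : Fin m → ℝ) : Coord (m + 1) :=
  WithLp.toLp 2 (Fin.cons 0 z : Fin (m + 1) → ℝ)

variable [RiemannianBundle (fun x : M => TangentSpace (𝓡 (m + 1)) x)]

open Classical in
/-- The outward pointing unit normal `ν` at a boundary point `x` of `Ω`, in components with respect
to the preferred chart around `x`: the normalized gradient `∇ρ / |∇ρ|`, where `ρ = y₀` is the
defining function of `Ω = {ρ < 0}` of a boundary chart at `x` (the vector does not depend on this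
chart). -/
def outwardNormal (Ω : Set M) (x : M) : Fin (m + 1) → ℝ :=
  if h : ∃ c : OpenPartialHomeomorph M (Coord (m + 1)), IsBoundaryChart Ω c ∧ x ∈ c.source then
    fun i => gradUp (fun z => h.choose z 0) x i / normGrad (m + 1) (fun z => h.choose z 0) x
  else 0

/-- The Riemannian area measure of the part `{y₀ = 0}` of the boundary in a boundary chart.  Its
density is `√(det h)`, where `h = (g_ij)_{i, j ≥ 1}` is the induced metric. -/
def chartArea [MeasurableSpace M] (c : OpenPartialHomeomorph M (Coord (m + 1))) :
    MeasureTheory.Measure M :=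
  (((MeasureTheory.volume : MeasureTheory.Measure (Fin m → ℝ)).restrict
    {z | hyperplanePoint z ∈ c.target}).withDensity
    fun z => ENNReal.ofReal √((chartMetric c (hyperplanePoint z)).submatrix
      Fin.succ Fin.succ).det).map fun z => c.symm (hyperplanePoint z)

variable (m) in
/-- The Riemannian area measure `dA_g` of the boundary of `Ω`: the measure whose restrictions to
the domains of the boundary charts are the measures `chartArea`, that is, their supremum. -/
def boundaryArea [MeasurableSpace M] (Ω : Set M) : MeasureTheory.Measure M :=
  ⨆ c : {c : OpenPartialHomeomorph M (Coord (m + 1)) // IsBoundaryChart Ω c}, chartArea c.1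

end Boundary

end HarmonicEstimates

end

open HarmonicEstimates

/-!
The integral identity comes from a pointwise Bochner-type identity, and the integral inequality
from the identity, a second pointwise computation and Hölder's inequality.

**Pointwise identities.** For a function `u` with `Δu = 0` in the open set `Ω`, commuting the
derivatives in the divergences of the covector fields `X = ∇^p∇^i u ∇_p∇_i∇_l u` and
`Y = ∇∇u(Δ∇u, ·)` gives
`|∇³u|² = div X - div Y + (curvature terms)`.
The term `∇²u · ∇Δ∇u`, which contains four derivatives, occurs in both divergences and cancels, so
no derivative of the curvature is left (`IsNormalAt.coordDiv_thirdHess`,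
`IsNormalAt.coordDiv_hessLapGrad`). For a harmonic function `Δ∇u = Rc(∇u)`, which turns `|Δ∇u|²`
into `2 Rc(∇u, Δ∇u) - Rc²(∇u, ∇u)`.

Such a computation is easy at a point where the Christoffel symbols vanish. All tensors are given
by coordinate formulas, so this requires that the formulas are invariant under changes of
coordinates. `IsIsometricMap` is a change of coordinates between two coordinate metrics; the
Koszul formula gives the transformation law of the Christoffel symbols
(`IsIsometricMap.fderiv_chris`), hence of `∇²u` and `∇³u`, and the curvature is recovered from the
commutator of third derivatives of the coordinate functions (`IsIsometricMap.riemMixed_eq`). All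
contractions are evaluated in orthonormal frames, which makes them invariant
(`IsIsometricMap.jetRel`, `JetRel`). The same invariance serves for the quadratic change to normal
coordinates (`exists_normal`) and for the transitions between charts of the manifold
(`jetRel_chartJet`).

**Integration.** The volume and the boundary area are suprema of measures that are given in
charts. By the change of variables formula, each of them restricts to the expected measure in
every chart (`riemannianVolume_restrict`, `boundaryArea_restrict`). In a boundary chart the area
density times `α(ν)` is the component `√(det g) g^0j α_j` of a vector density
(`CovectorField.sqrt_det_mul_flux`), so that a partition of unity reduces the divergence theorem
(`CovectorField.setIntegral_div_eq`) to the one in a Euclidean half-space. The closure of `Ω` is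
compact, since complete Riemannian manifolds are proper (`properSpace_of_complete`, by the
Hopf–Rinow argument for length spaces); so all integrands are integrable.

**The inequality.** The identity bounds `∫|∇³u|²` by `𝓑`, the terms `∫ |Rc|²|∇u|²`,
`∫ |Rm||∇u||∇³u|`, and `∫ (|Rm| + |Rc|)|∇²u|² ≤ 2 K (∫|∇²u|³)^{2/3}`. The divergence of
`|∇²u| ∇∇u(∇u, ·)` bounds `∫|∇²u|³` by its boundary integral plus
`∫ |∇³u||∇²u||∇u| + ∫ |Rc||∇u|²|∇²u|`;
as `|∇²u|` need not be differentiable, it is replaced by `(|∇²u|² + ε²)^{1/2}`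
(`hessSq_le_coordDiv`, `setIntegral_normHess_cube_le`). Hölder's inequality makes this a cubic
inequality for the `L³` norm of `∇²u`, and `∫|∇³u|²` is absorbed into the left side with a weight
for which exactly the factor `1 + η` remains in front of `𝓑` (`integral_sq_le_of_interpolation`).
-/

open scoped Matrix

set_option linter.unusedSectionVars false

noncomputable section

namespace HarmonicEstimates

/-! ### Multilinear maps given by components -/

section Components

variable {n : ℕ} {F : Type*} [NormedAddCommGroup F] [NormedSpace ℝ F]

/-- The standard basis vector `e_i` of `ℝⁿ`. -/
abbrev stdVec (i : Fin n) : Coord n := EuclideanSpace.single i (1 : ℝ)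

/-- The linear map on `ℝⁿ` with prescribed values `T i` on the standard basis. Iterating it turns
the components of a tensor into a multilinear map. -/
def ev (T : Fin n → F) : Coord n →L[ℝ] F :=
  ∑ i, (EuclideanSpace.proj (𝕜 := ℝ) i : Coord n →L[ℝ] ℝ).smulRight (T i)

/-- The bilinear map with components `T i j`. -/
def ev2 (T : Fin n → Fin n → F) : Coord n →L[ℝ] Coord n →L[ℝ] F := ev fun i => ev (T i)

/-- The trilinear form with components `T i j k`. -/
def ev3 (T : Fin n → Fin n → Fin n → ℝ) (u v w : Coord n) : ℝ := ev (fun i => ev2 (T i) v w) u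

/-- The quadrilinear form with components `T i j k l`. -/
def ev4 (T : Fin n → Fin n → Fin n → Fin n → ℝ) (u v w z : Coord n) : ℝ :=
  ev (fun i => ev3 (T i) v w z) u

lemma ev_apply (T : Fin n → F) (v : Coord n) : ev T v = ∑ i, v i • T i := by
  simp [ev]

@[simp] lemma ev_single (T : Fin n → F) (i : Fin n) : ev T (stdVec i) = T i := by
  simp [ev_apply]

lemma ev2_single (T : Fin n → Fin n → F) (i j : Fin n) :
    ev2 T (stdVec i) (stdVec j) = T i j := by
  simp [ev2]

lemma ev3_single (T : Fin n → Fin n → Fin n → ℝ) (i j k : Fin n) :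
    ev3 T (stdVec i) (stdVec j) (stdVec k) = T i j k := by
  simp [ev3, ev2]

lemma ev4_single (T : Fin n → Fin n → Fin n → Fin n → ℝ) (i j k l : Fin n) :
    ev4 T (stdVec i) (stdVec j) (stdVec k) (stdVec l) = T i j k l := by
  simp [ev4, ev3, ev2]

lemma sum_smul_stdVec (v : Coord n) : ∑ i, v i • stdVec i = v := by
  ext j
  simp [Pi.single_apply]

lemma ext_stdVec {A B : Coord n →L[ℝ] F} (h : ∀ i, A (stdVec i) = B (stdVec i)) : A = B := by
  ext v
  rw [← sum_smul_stdVec v, map_sum, map_sum]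
  simp only [map_smul, h]

lemma ev_eq (A : Coord n →L[ℝ] F) : ev (fun i => A (stdVec i)) = A := ext_stdVec fun i => by simp

lemma ev2_apply (T : Fin n → Fin n → ℝ) (u v : Coord n) :
    ev2 T u v = ∑ i, ∑ j, u i * v j * T i j := by
  simp [ev2, ev_apply, Finset.mul_sum, mul_assoc]

lemma differentiableAt_ev {G : Type*} [NormedAddCommGroup G] [NormedSpace ℝ G] {T : Fin n → G → F}
    {y : G} (h : ∀ i, DifferentiableAt ℝ (T i) y) :
    DifferentiableAt ℝ (fun y => ev fun i => T i y) y := by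
  unfold ev
  have : ∀ i, DifferentiableAt ℝ (fun y => (EuclideanSpace.proj (𝕜 := ℝ) i :
      Coord n →L[ℝ] ℝ).smulRight (T i y)) y := fun i =>
    ((ContinuousLinearMap.smulRightL ℝ (Coord n) F
      (EuclideanSpace.proj (𝕜 := ℝ) i : Coord n →L[ℝ] ℝ)).differentiableAt).comp y (h i)
  fun_prop

/-- The derivative of a multilinear map with variable components is taken componentwise. -/
lemma fderiv_ev {T : Fin n → Coord n → F} {y : Coord n}
    (h : ∀ i, DifferentiableAt ℝ (T i) y) (w : Coord n) :
    fderiv ℝ (fun z => ev fun i => T i z) y w = ev fun i => fderiv ℝ (T i) y w := by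
  ext v
  have hd := differentiableAt_ev h
  have h1 : fderiv ℝ (fun z => ev (fun i => T i z) v) y w
      = fderiv ℝ (fun z => ev fun i => T i z) y w v := by
    rw [fderiv_clm_apply hd (differentiableAt_const v)]
    simp
  rw [← h1]
  simp only [ev_apply]
  rw [fderiv_fun_sum (A := fun i z => v i • T i z) (fun i _ => (h i).const_smul _)]
  simp only [sum_apply]
  refine Finset.sum_congr rfl fun i _ => ?_
  rw [fderiv_fun_const_smul (h i)]
  simp

lemma fderiv_ev2 {T : Fin n → Fin n → Coord n → F} {y : Coord n}
    (h : ∀ i j, DifferentiableAt ℝ (T i j) y) (w : Coord n) :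
    fderiv ℝ (fun z => ev2 fun i j => T i j z) y w = ev2 fun i j => fderiv ℝ (T i j) y w := by
  unfold ev2
  rw [fderiv_ev (T := fun i z => ev fun j => T i j z) (fun i => differentiableAt_ev (h i)) w]
  simp only [fderiv_ev (h _)]

lemma differentiableAt_ev2 {T : Fin n → Fin n → Coord n → F} {y : Coord n}
    (h : ∀ i j, DifferentiableAt ℝ (T i j) y) :
    DifferentiableAt ℝ (fun z => ev2 fun i j => T i j z) y :=
  differentiableAt_ev (T := fun i z => ev fun j => T i j z) fun i => differentiableAt_ev (h i)

end Components

/-! ### Partial derivatives -/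

section PartialDerivatives

variable {n : ℕ} {V : Set (Coord n)} {y : Coord n}

lemma ev_pd (f : Coord n → ℝ) (y : Coord n) : (ev fun i => pd f i y) = fderiv ℝ f y :=
  ev_eq (fderiv ℝ f y)

lemma pd_congr_of_eqOn {f g : Coord n → ℝ} (hV : IsOpen V) (h : Set.EqOn f g V) (hy : y ∈ V)
    (i : Fin n) : pd f i y = pd g i y := by
  unfold pd
  rw [(h.eventuallyEq_of_mem (hV.mem_nhds hy)).fderiv_eq]

lemma contDiffOn_pd {f : Coord n → ℝ} (hV : IsOpen V) (h : ContDiffOn ℝ ∞ f V) (i : Fin n) :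
    ContDiffOn ℝ ∞ (pd f i) V := by
  have h1 : ContDiffOn ℝ ∞ (fderiv ℝ f) V := h.fderiv_of_isOpen hV (by simp)
  exact h1.clm_apply contDiffOn_const

lemma ContDiffOn.diffAt {F : Type*} [NormedAddCommGroup F] [NormedSpace ℝ F] {f : Coord n → F}
    (h : ContDiffOn ℝ ∞ f V) (hV : IsOpen V) (hy : y ∈ V) : DifferentiableAt ℝ f y :=
  (h.contDiffAt (hV.mem_nhds hy)).differentiableAt (by simp)

lemma pd_comm {f : Coord n → ℝ} (hV : IsOpen V) (h : ContDiffOn ℝ ∞ f V) (hy : y ∈ V)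
    (i j : Fin n) : pd (pd f i) j y = pd (pd f j) i y := by
  have h1 : ContDiffOn ℝ ∞ (fderiv ℝ f) V := h.fderiv_of_isOpen hV (by simp)
  have hs : IsSymmSndFDerivAt ℝ f y :=
    (h.contDiffAt (hV.mem_nhds hy)).isSymmSndFDerivAt (by simpa using ENat.LEInfty.out)
  have key : ∀ i j, pd (pd f i) j y = fderiv ℝ (fderiv ℝ f) y (stdVec j) (stdVec i) := by
    intro i j
    unfold pd
    rw [fderiv_clm_apply (h1.diffAt hV hy) (differentiableAt_const _)]
    simp
  rw [key, key, hs.eq]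

lemma pd_mul {f g : Coord n → ℝ} (hf : DifferentiableAt ℝ f y) (hg : DifferentiableAt ℝ g y)
    (i : Fin n) : pd (fun z => f z * g z) i y = pd f i y * g y + f y * pd g i y := by
  unfold pd
  rw [fderiv_fun_mul hf hg]
  simp; ring

lemma pd_add {f g : Coord n → ℝ} (hf : DifferentiableAt ℝ f y) (hg : DifferentiableAt ℝ g y)
    (i : Fin n) : pd (fun z => f z + g z) i y = pd f i y + pd g i y := by
  unfold pd
  rw [fderiv_fun_add hf hg]
  simp

lemma pd_sub {f g : Coord n → ℝ} (hf : DifferentiableAt ℝ f y) (hg : DifferentiableAt ℝ g y)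
    (i : Fin n) : pd (fun z => f z - g z) i y = pd f i y - pd g i y := by
  unfold pd
  rw [fderiv_fun_sub hf hg]
  simp

lemma pd_const_mul {f : Coord n → ℝ} (c : ℝ) (hf : DifferentiableAt ℝ f y)
    (i : Fin n) : pd (fun z => c * f z) i y = c * pd f i y := by
  unfold pd
  rw [fderiv_const_mul hf]
  simp

@[simp] lemma pd_const (c : ℝ) (i : Fin n) : pd (fun _ => c) i y = 0 := by
  simp [pd]

lemma pd_sum {ι : Type*} {s : Finset ι} {f : ι → Coord n → ℝ}
    (hf : ∀ a ∈ s, DifferentiableAt ℝ (f a) y) (i : Fin n) :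
    pd (fun z => ∑ a ∈ s, f a z) i y = ∑ a ∈ s, pd (f a) i y := by
  unfold pd
  rw [fderiv_fun_sum hf]
  simp 

end PartialDerivatives

/-! ### Metrics and Christoffel symbols in coordinates -/

section Metric

variable {n : ℕ}

/-- `G` is a smooth Riemannian metric on the open set `V` of `ℝⁿ`. -/
structure IsMetricOn (G : Coord n → Matrix (Fin n) (Fin n) ℝ) (V : Set (Coord n)) : Prop where
  isOpen : IsOpen V
  smooth : ∀ i j, ContDiffOn ℝ ∞ (fun y => G y i j) V
  posDef : ∀ y ∈ V, (G y).PosDef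

/-- `φ` is a smooth local isometry from `(V, G)` to `(V', G')`. -/
structure IsIsometricMap (φ : Coord n → Coord n) (G : Coord n → Matrix (Fin n) (Fin n) ℝ)
    (V : Set (Coord n)) (G' : Coord n → Matrix (Fin n) (Fin n) ℝ) (V' : Set (Coord n)) :
    Prop where
  smooth : ContDiffOn ℝ ∞ φ V
  mapsTo : Set.MapsTo φ V V'
  surj : ∀ y ∈ V, Function.Surjective (fderiv ℝ φ y)
  metric : ∀ y ∈ V, ∀ u v, ev2 (fun i j => G y i j) u v
    = ev2 (fun i j => G' (φ y) i j) (fderiv ℝ φ y u) (fderiv ℝ φ y v)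

variable {G G' : Coord n → Matrix (Fin n) (Fin n) ℝ} {V V' : Set (Coord n)} {y : Coord n}

namespace IsMetricOn

lemma symm (h : IsMetricOn G V) (hy : y ∈ V) (i j : Fin n) : G y i j = G y j i := by
  have := (h.posDef y hy).isHermitian.apply j i
  simpa using this

lemma isUnit_det (h : IsMetricOn G V) (hy : y ∈ V) : IsUnit (G y).det :=
  (h.posDef y hy).det_pos.ne'.isUnit

lemma inv_symm (h : IsMetricOn G V) (hy : y ∈ V) (i j : Fin n) : (G y)⁻¹ i j = (G y)⁻¹ j i := by
  have := (h.posDef y hy).inv.isHermitian.apply j i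
  simpa using this

lemma smooth_det (h : IsMetricOn G V) : ContDiffOn ℝ ∞ (fun y => (G y).det) V := by
  simp only [Matrix.det_apply]
  refine ContDiffOn.sum fun σ _ => ?_
  exact (contDiffOn_prod fun i _ => h.smooth _ _).const_smul _

lemma smooth_inv (h : IsMetricOn G V) (i j : Fin n) :
    ContDiffOn ℝ ∞ (fun y => (G y)⁻¹ i j) V := by
  have h1 : ContDiffOn ℝ ∞ (fun y => (G y).det⁻¹ * (G y).adjugate i j) V := by
    refine (h.smooth_det.inv fun y hy => (h.posDef y hy).det_pos.ne').mul ?_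
    simp only [Matrix.adjugate_apply, Matrix.det_apply]
    refine ContDiffOn.sum fun σ _ => ContDiffOn.const_smul _ (contDiffOn_prod fun k _ => ?_)
    simp only [Matrix.updateRow_apply]
    split_ifs
    · exact contDiffOn_const
    · exact h.smooth _ _
  refine h1.congr fun y hy => ?_
  rw [Matrix.inv_def]
  simp [Ring.inverse_eq_inv']

lemma smooth_christoffel (h : IsMetricOn G V) (k i j : Fin n) :
    ContDiffOn ℝ ∞ (christoffel G k i j) V := by
  unfold christoffel
  refine contDiffOn_const.mul (ContDiffOn.sum fun l _ => (h.smooth_inv _ _).mul ?_)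
  exact ((contDiffOn_pd h.isOpen (h.smooth _ _) _).add
    (contDiffOn_pd h.isOpen (h.smooth _ _) _)).sub (contDiffOn_pd h.isOpen (h.smooth _ _) _)

lemma pd_symm (h : IsMetricOn G V) (hy : y ∈ V) (i j k : Fin n) :
    pd (fun z => G z i j) k y = pd (fun z => G z j i) k y :=
  pd_congr_of_eqOn h.isOpen (fun _ hz => h.symm hz i j) hy k

lemma christoffel_symm (h : IsMetricOn G V) (hy : y ∈ V) (k i j : Fin n) :
    christoffel G k i j y = christoffel G k j i y := by
  unfold christoffel
  congr 1
  refine Finset.sum_congr rfl fun l _ => ?_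
  rw [h.pd_symm hy j l i, h.pd_symm hy i l j, h.pd_symm hy i j l, h.pd_symm hy l j i,
    h.pd_symm hy l i j]
  ring

/-- Lowering the upper index of the Christoffel symbols. -/
lemma lower_christoffel (h : IsMetricOn G V) (hy : y ∈ V) (m i j : Fin n) :
    ∑ k, G y m k * christoffel G k i j y = (1 / 2) *
      (pd (fun z => G z j m) i y + pd (fun z => G z i m) j y - pd (fun z => G z i j) m y) := by
  set q : Fin n → ℝ := fun l =>
    pd (fun z => G z j l) i y + pd (fun z => G z i l) j y - pd (fun z => G z i j) l y with hq
  have h1 : ∀ k, christoffel G k i j y = (1 / 2) * ((G y)⁻¹ *ᵥ q) k := fun k => rfl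
  have h2 : ∑ k, G y m k * christoffel G k i j y = (1 / 2) * (G y *ᵥ ((G y)⁻¹ *ᵥ q)) m := by
    simp only [h1]
    rw [Matrix.mulVec, dotProduct, Finset.mul_sum]
    exact Finset.sum_congr rfl fun k _ => by ring
  rw [h2, Matrix.mulVec_mulVec, Matrix.mul_nonsing_inv _ (h.isUnit_det hy), Matrix.one_mulVec]

/-- The Levi-Civita connection is metric. -/
lemma pd_eq (h : IsMetricOn G V) (hy : y ∈ V) (i j k : Fin n) :
    pd (fun z => G z i j) k y
      = ∑ l, G y j l * christoffel G l k i y + ∑ l, G y i l * christoffel G l k j y := by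
  rw [h.lower_christoffel hy, h.lower_christoffel hy, h.pd_symm hy j i k, h.pd_symm hy k j i,
    h.pd_symm hy k i j]
  ring

end IsMetricOn

/-- The Christoffel symbols as a bilinear map with values in `ℝⁿ`. -/
def chris (G : Coord n → Matrix (Fin n) (Fin n) ℝ) (y : Coord n) :
    Coord n →L[ℝ] Coord n →L[ℝ] Coord n :=
  ev2 fun i j => WithLp.toLp 2 fun k => christoffel G k i j y

lemma chris_single (i j k : Fin n) :
    chris G y (stdVec i) (stdVec j) k = christoffel G k i j y := by
  rw [chris, ev2_single]

/-- The Koszul formula. -/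
lemma IsMetricOn.koszul (h : IsMetricOn G V) (hy : y ∈ V) (u v w : Coord n) :
    ev2 (fun i j => G y i j) (chris G y u v) w = (1 / 2) *
      (fderiv ℝ (fun z => ev2 fun i j => G z i j) y u v w
        + fderiv ℝ (fun z => ev2 fun i j => G z i j) y v u w
        - fderiv ℝ (fun z => ev2 fun i j => G z i j) y w u v) := by
  have hd : ∀ i j, DifferentiableAt ℝ (fun z => G z i j) y := fun i j =>
    (h.smooth i j).diffAt h.isOpen hy
  have hD : ∀ a b c, fderiv ℝ (fun z => ev2 fun i j => G z i j) y a b c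
      = ∑ i, ∑ j, ∑ k, a i * b j * c k * pd (fun z => G z j k) i y := by
    intro a b c
    rw [fderiv_ev2 hd, ev2_apply]
    have : ∀ j k, fderiv ℝ (fun z => G z j k) y a = ∑ i, a i * pd (fun z => G z j k) i y := by
      intro j k
      rw [← ev_pd, ev_apply]; rfl
    simp only [this, Finset.mul_sum]
    rw [Finset.sum_comm_cycle]
    refine Finset.sum_congr rfl fun i _ => Finset.sum_congr rfl fun j _ =>
      Finset.sum_congr rfl fun k _ => by ring
  have hL : ev2 (fun i j => G y i j) (chris G y u v) w
      = ∑ i, ∑ j, ∑ m, u i * v j * w m * ∑ k, G y m k * christoffel G k i j y := by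
    have hc : ∀ k, chris G y u v k = ∑ i, ∑ j, u i * v j * christoffel G k i j y := by
      intro k
      simp [chris, ev2, ev_apply, Finset.mul_sum, mul_assoc]
    rw [ev2_apply]
    simp only [hc, Finset.sum_mul, Finset.mul_sum]
    rw [Finset.sum_comm]
    rw [Finset.sum_congr rfl fun m _ => Finset.sum_comm]
    rw [Finset.sum_comm]
    refine Finset.sum_congr rfl fun i _ => ?_
    rw [Finset.sum_congr rfl fun m _ => Finset.sum_comm]
    rw [Finset.sum_comm]
    refine Finset.sum_congr rfl fun j _ => Finset.sum_congr rfl fun m _ =>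
      Finset.sum_congr rfl fun k _ => ?_
    rw [h.symm hy k m]; ring
  rw [hL, hD, hD, hD]
  simp only [h.lower_christoffel hy]
  rw [Finset.sum_comm (f := fun i j => ∑ k, v i * u j * w k * pd (fun z => G z j k) i y)]
  have e3 : (∑ i, ∑ j, ∑ k, w i * u j * v k * pd (fun z => G z j k) i y)
      = ∑ i, ∑ j, ∑ k, u i * v j * w k * pd (fun z => G z i j) k y := by
    rw [Finset.sum_comm_cycle]
    rw [Finset.sum_comm_cycle]
    refine Finset.sum_congr rfl fun i _ => Finset.sum_congr rfl fun j _ =>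
      Finset.sum_congr rfl fun k _ => by ring
  rw [e3]
  simp only [← Finset.sum_add_distrib, ← Finset.sum_sub_distrib, Finset.mul_sum]
  refine Finset.sum_congr rfl fun i _ => Finset.sum_congr rfl fun j _ =>
    Finset.sum_congr rfl fun k _ => by ring

end Metric

/-! ### Covariant derivatives and their naturality under local isometries -/

section Naturality

/-- The derivative of the pull-back of a bilinear form. -/
lemma fderiv_pullback2 {E : Type*} [NormedAddCommGroup E] [NormedSpace ℝ E] {φ : E → E} {y : E}
    {B : E → E →L[ℝ] E →L[ℝ] ℝ}
    (hB : DifferentiableAt ℝ B (φ y)) (hφ : DifferentiableAt ℝ φ y)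
    (hφ' : DifferentiableAt ℝ (fderiv ℝ φ) y) (w u v : E) :
    fderiv ℝ (fun z => B (φ z) (fderiv ℝ φ z u) (fderiv ℝ φ z v)) y w
      = fderiv ℝ B (φ y) (fderiv ℝ φ y w) (fderiv ℝ φ y u) (fderiv ℝ φ y v)
        + B (φ y) (fderiv ℝ (fderiv ℝ φ) y w u) (fderiv ℝ φ y v)
        + B (φ y) (fderiv ℝ φ y u) (fderiv ℝ (fderiv ℝ φ) y w v) := by
  have h1 := HasFDerivAt.comp (g := B) (f := φ) y hB.hasFDerivAt hφ.hasFDerivAt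
  have hu := hφ'.hasFDerivAt.clm_apply (hasFDerivAt_const u y)
  have hv := hφ'.hasFDerivAt.clm_apply (hasFDerivAt_const v y)
  have h2 := ((h1.clm_apply hu).clm_apply hv).fderiv
  simp only [Function.comp_apply] at h2
  rw [h2]
  simp
  ring

/-- The derivative of the pull-back of a linear form. -/
lemma fderiv_pullback1 {E : Type*} [NormedAddCommGroup E] [NormedSpace ℝ E] {φ : E → E} {y : E}
    {B : E → E →L[ℝ] ℝ}
    (hB : DifferentiableAt ℝ B (φ y)) (hφ : DifferentiableAt ℝ φ y)
    (hφ' : DifferentiableAt ℝ (fderiv ℝ φ) y) (w u : E) :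
    fderiv ℝ (fun z => B (φ z) (fderiv ℝ φ z u)) y w
      = fderiv ℝ B (φ y) (fderiv ℝ φ y w) (fderiv ℝ φ y u)
        + B (φ y) (fderiv ℝ (fderiv ℝ φ) y w u) := by
  have h1 := HasFDerivAt.comp (g := B) (f := φ) y hB.hasFDerivAt hφ.hasFDerivAt
  have hu := hφ'.hasFDerivAt.clm_apply (hasFDerivAt_const u y)
  have h2 := (h1.clm_apply hu).fderiv
  simp only [Function.comp_apply] at h2
  rw [h2]
  simp
  ring

variable {n : ℕ} {G G' : Coord n → Matrix (Fin n) (Fin n) ℝ} {V V' : Set (Coord n)} {y : Coord n}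
  {φ : Coord n → Coord n}

/-- The component `∇_i α_j` of the covariant derivative of a `1`-form. -/
def cov1 (G : Coord n → Matrix (Fin n) (Fin n) ℝ) (α : Fin n → Coord n → ℝ) (i j : Fin n)
    (y : Coord n) : ℝ :=
  pd (α j) i y - ∑ k, christoffel G k i j y * α k y

/-- The component `∇_k T_ij` of the covariant derivative of a covariant `2`-tensor. -/
def cov2 (G : Coord n → Matrix (Fin n) (Fin n) ℝ) (T : Fin n → Fin n → Coord n → ℝ)
    (k i j : Fin n) (y : Coord n) : ℝ :=
  pd (T i j) k y
    - ∑ l, (christoffel G l k i y * T l j y + christoffel G l k j y * T i l y)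

/-- The covariant derivative of a `1`-form, evaluated on vectors:
`(∇α)(u, v) = (D_u α)(v) - α(Γ(u, v))`. -/
lemma ev2_cov1 {α : Fin n → Coord n → ℝ} (hα : ∀ j, DifferentiableAt ℝ (α j) y)
    (u v : Coord n) :
    ev2 (fun i j => cov1 G α i j y) u v
      = fderiv ℝ (fun z => ev fun j => α j z) y u v - ev (fun j => α j y) (chris G y u v) := by
  have key : ∀ i, ev (fun j => cov1 G α i j y)
      = fderiv ℝ (fun z => ev fun j => α j z) y (stdVec i)
        - (ev fun j => α j y) ∘L (chris G y (stdVec i)) := by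
    intro i
    refine ext_stdVec fun j => ?_
    rw [ev_single, fderiv_ev hα]
    simp only [sub_apply, ev_single, ContinuousLinearMap.comp_apply]
    rw [ev_apply]
    simp only [chris_single, smul_eq_mul]
    rfl
  rw [ev2, ev_apply]
  simp only [key]
  conv_rhs => rw [← sum_smul_stdVec u]
  simp only [map_sum, map_smul, sum_apply, smul_apply, ← Finset.sum_sub_distrib, ← smul_sub,
    sub_apply, ContinuousLinearMap.comp_apply]

set_option synthInstance.maxHeartbeats 200000 in
/-- The covariant derivative of a `2`-tensor, evaluated on vectors:
`(∇T)(w, u, v) = (D_w T)(u, v) - T(Γ(w, u), v) - T(u, Γ(w, v))`. -/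
lemma ev3_cov2 {T : Fin n → Fin n → Coord n → ℝ} (hT : ∀ i j, DifferentiableAt ℝ (T i j) y)
    (w u v : Coord n) :
    ev3 (fun k i j => cov2 G T k i j y) w u v
      = fderiv ℝ (fun z => ev2 fun i j => T i j z) y w u v
        - ev2 (fun i j => T i j y) (chris G y w u) v
        - ev2 (fun i j => T i j y) u (chris G y w v) := by
  have key : ∀ k, ev2 (fun i j => cov2 G T k i j y)
      = fderiv ℝ (fun z => ev2 fun i j => T i j z) y (stdVec k)
        - (ev2 fun i j => T i j y) ∘L (chris G y (stdVec k))
        - ((ev2 fun i j => T i j y).flip ∘L (chris G y (stdVec k))).flip := by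
    intro k
    refine ext_stdVec fun i => ext_stdVec fun j => ?_
    rw [ev2_single, fderiv_ev2 hT]
    simp only [sub_apply, ev2_single, ContinuousLinearMap.comp_apply,
      ContinuousLinearMap.flip_apply]
    rw [ev2_apply, ev2_apply]
    simp only [chris_single]
    simp [cov2, pd, Finset.sum_add_distrib, sub_sub]
  rw [ev3, ev_apply]
  simp only [key]
  conv_rhs => rw [← sum_smul_stdVec w]
  simp only [map_sum, map_smul, sum_apply, smul_apply, ← Finset.sum_sub_distrib, ← smul_sub,
    sub_apply, ContinuousLinearMap.comp_apply, ContinuousLinearMap.flip_apply]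

lemma IsIsometricMap.fderiv_smooth (hφ : IsIsometricMap φ G V G' V') (hG : IsMetricOn G V) :
    ContDiffOn ℝ ∞ (fderiv ℝ φ) V :=
  hφ.smooth.fderiv_of_isOpen hG.isOpen (by simp)

lemma fderiv_apply_const1 {E : Type*} [NormedAddCommGroup E] [NormedSpace ℝ E] {y : E}
    {A : E → E →L[ℝ] ℝ} (hA : DifferentiableAt ℝ A y) (w u : E) :
    fderiv ℝ (fun z => A z u) y w = fderiv ℝ A y w u := by
  rw [fderiv_clm_apply hA (differentiableAt_const _)]
  simp

lemma fderiv_apply_const2 {E : Type*} [NormedAddCommGroup E] [NormedSpace ℝ E] {y : E}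
    {A : E → E →L[ℝ] E →L[ℝ] ℝ} (hA : DifferentiableAt ℝ A y) (w u v : E) :
    fderiv ℝ (fun z => A z u v) y w = fderiv ℝ A y w u v := by
  have h1 := hA.hasFDerivAt.clm_apply (hasFDerivAt_const u y)
  rw [(h1.clm_apply (hasFDerivAt_const v y)).fderiv]
  simp

lemma IsMetricOn.ev2_symm (h : IsMetricOn G V) (hy : y ∈ V) (u v : Coord n) :
    ev2 (fun i j => G y i j) u v = ev2 (fun i j => G y i j) v u := by
  rw [ev2_apply, ev2_apply, Finset.sum_comm]
  refine Finset.sum_congr rfl fun i _ => Finset.sum_congr rfl fun j _ => ?_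
  rw [h.symm hy i j]; ring

lemma ev2_eq_dotProduct (A : Matrix (Fin n) (Fin n) ℝ) (u v : Coord n) :
    ev2 (fun i j => A i j) u v = u.ofLp ⬝ᵥ (A *ᵥ v.ofLp) := by
  rw [ev2_apply]
  simp only [dotProduct, Matrix.mulVec, Finset.mul_sum]
  exact Finset.sum_congr rfl fun i _ => Finset.sum_congr rfl fun j _ => by ring

lemma IsMetricOn.ev2_pos (h : IsMetricOn G V) (hy : y ∈ V) {u : Coord n} (hu : u ≠ 0) :
    0 < ev2 (fun i j => G y i j) u u := by
  rw [ev2_eq_dotProduct]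
  have := (h.posDef y hy).dotProduct_mulVec_pos (x := u.ofLp) (by simpa using hu)
  simpa using this

/-- Naturality of the Levi-Civita connection: the transformation law of the Christoffel symbols. -/
lemma IsIsometricMap.fderiv_chris (hφ : IsIsometricMap φ G V G' V') (hG : IsMetricOn G V)
    (hG' : IsMetricOn G' V') (hy : y ∈ V) (u v : Coord n) :
    fderiv ℝ φ y (chris G y u v) = fderiv ℝ (fderiv ℝ φ) y u v
      + chris G' (φ y) (fderiv ℝ φ y u) (fderiv ℝ φ y v) := by
  have hy' := hφ.mapsTo hy
  have hd : DifferentiableAt ℝ φ y := hφ.smooth.diffAt hG.isOpen hy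
  have hd2 : DifferentiableAt ℝ (fderiv ℝ φ) y := (hφ.fderiv_smooth hG).diffAt hG.isOpen hy
  have hB : DifferentiableAt ℝ (fun z => ev2 fun i j => G z i j) y :=
    differentiableAt_ev2 fun i j => (hG.smooth i j).diffAt hG.isOpen hy
  have hB' : DifferentiableAt ℝ (fun z => ev2 fun i j => G' z i j) (φ y) :=
    differentiableAt_ev2 fun i j => (hG'.smooth i j).diffAt hG'.isOpen hy'
  have hs : IsSymmSndFDerivAt ℝ φ y :=
    (hφ.smooth.contDiffAt (hG.isOpen.mem_nhds hy)).isSymmSndFDerivAt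
      (by simpa using ENat.LEInfty.out)
  have hder : ∀ a b c, fderiv ℝ (fun z => ev2 fun i j => G z i j) y a b c
      = fderiv ℝ (fun z => ev2 fun i j => G' z i j) (φ y) (fderiv ℝ φ y a) (fderiv ℝ φ y b)
          (fderiv ℝ φ y c)
        + ev2 (fun i j => G' (φ y) i j) (fderiv ℝ (fderiv ℝ φ) y a b) (fderiv ℝ φ y c)
        + ev2 (fun i j => G' (φ y) i j) (fderiv ℝ φ y b) (fderiv ℝ (fderiv ℝ φ) y a c) :=
    fun a b c => by
    rw [← fderiv_apply_const2 hB a b c]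
    have he : (fun z => ev2 (fun i j => G z i j) b c) =ᶠ[nhds y] fun z =>
        ev2 (fun i j => G' (φ z) i j) (fderiv ℝ φ z b) (fderiv ℝ φ z c) := by
      filter_upwards [hG.isOpen.mem_nhds hy] with z hz using hφ.metric z hz b c
    rw [he.fderiv_eq]
    exact fderiv_pullback2 (B := fun z => ev2 fun i j => G' z i j) hB' hd hd2 a b c
  -- by the Koszul formula, the difference `r` of both sides is orthogonal to the range of `Dφ`
  set r := fderiv ℝ φ y (chris G y u v) - (fderiv ℝ (fderiv ℝ φ) y u v
      + chris G' (φ y) (fderiv ℝ φ y u) (fderiv ℝ φ y v)) with hr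
  suffices h0 : ∀ w, ev2 (fun i j => G' (φ y) i j) r (fderiv ℝ φ y w) = 0 by
    obtain ⟨w, hw⟩ := hφ.surj y hy r
    have h1 := h0 w
    rw [hw] at h1
    by_contra hne
    exact (hG'.ev2_pos hy' (sub_ne_zero.mpr hne)).ne' h1
  intro w
  have h1 := hG.koszul hy u v w
  rw [hφ.metric y hy, hder, hder, hder] at h1
  have h2 := hG'.koszul hy' (fderiv ℝ φ y u) (fderiv ℝ φ y v) (fderiv ℝ φ y w)
  rw [hr, map_sub, map_add]
  simp only [sub_apply, add_apply]
  rw [h1, h2, hs.eq v u, hs.eq w u, hs.eq w v,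
    hG'.ev2_symm hy' (fderiv ℝ (fderiv ℝ φ) y u w) (fderiv ℝ φ y v),
    hG'.ev2_symm hy' (fderiv ℝ φ y u) (fderiv ℝ (fderiv ℝ φ) y v w)]
  ring

/-- Naturality of the covariant derivative of `1`-forms. -/
lemma IsIsometricMap.cov1_eq (hφ : IsIsometricMap φ G V G' V') (hG : IsMetricOn G V)
    (hG' : IsMetricOn G' V') (hy : y ∈ V) {α α' : Fin n → Coord n → ℝ}
    (hα : ∀ j, DifferentiableAt ℝ (α j) y) (hα' : ∀ j, DifferentiableAt ℝ (α' j) (φ y))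
    (h : ∀ z ∈ V, ∀ v, ev (fun j => α j z) v = ev (fun j => α' j (φ z)) (fderiv ℝ φ z v))
    (u v : Coord n) :
    ev2 (fun i j => cov1 G α i j y) u v
      = ev2 (fun i j => cov1 G' α' i j (φ y)) (fderiv ℝ φ y u) (fderiv ℝ φ y v) := by
  have hd : DifferentiableAt ℝ φ y := hφ.smooth.diffAt hG.isOpen hy
  have hd2 : DifferentiableAt ℝ (fderiv ℝ φ) y := (hφ.fderiv_smooth hG).diffAt hG.isOpen hy
  have hB : DifferentiableAt ℝ (fun z => ev fun j => α j z) y := differentiableAt_ev hα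
  have hB' : DifferentiableAt ℝ (fun z => ev fun j => α' j z) (φ y) := differentiableAt_ev hα'
  rw [ev2_cov1 hα, ev2_cov1 hα', ← fderiv_apply_const1 hB]
  have he : (fun z => ev (fun j => α j z) v) =ᶠ[nhds y] fun z =>
      ev (fun j => α' j (φ z)) (fderiv ℝ φ z v) := by
    filter_upwards [hG.isOpen.mem_nhds hy] with z hz using h z hz v
  rw [he.fderiv_eq, fderiv_pullback1 (B := fun z => ev fun j => α' j z) hB' hd hd2, h y hy,
    hφ.fderiv_chris hG hG' hy, map_add]
  ring

/-- Naturality of the covariant derivative of `2`-tensors. -/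
lemma IsIsometricMap.cov2_eq (hφ : IsIsometricMap φ G V G' V') (hG : IsMetricOn G V)
    (hG' : IsMetricOn G' V') (hy : y ∈ V) {T T' : Fin n → Fin n → Coord n → ℝ}
    (hT : ∀ i j, DifferentiableAt ℝ (T i j) y) (hT' : ∀ i j, DifferentiableAt ℝ (T' i j) (φ y))
    (h : ∀ z ∈ V, ∀ u v, ev2 (fun i j => T i j z) u v
      = ev2 (fun i j => T' i j (φ z)) (fderiv ℝ φ z u) (fderiv ℝ φ z v))
    (w u v : Coord n) :
    ev3 (fun k i j => cov2 G T k i j y) w u v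
      = ev3 (fun k i j => cov2 G' T' k i j (φ y))
        (fderiv ℝ φ y w) (fderiv ℝ φ y u) (fderiv ℝ φ y v) := by
  have hd : DifferentiableAt ℝ φ y := hφ.smooth.diffAt hG.isOpen hy
  have hd2 : DifferentiableAt ℝ (fderiv ℝ φ) y := (hφ.fderiv_smooth hG).diffAt hG.isOpen hy
  have hB : DifferentiableAt ℝ (fun z => ev2 fun i j => T i j z) y := differentiableAt_ev2 hT
  have hB' : DifferentiableAt ℝ (fun z => ev2 fun i j => T' i j z) (φ y) :=
    differentiableAt_ev2 hT'
  rw [ev3_cov2 hT, ev3_cov2 hT', ← fderiv_apply_const2 hB]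
  have he : (fun z => ev2 (fun i j => T i j z) u v) =ᶠ[nhds y] fun z =>
      ev2 (fun i j => T' i j (φ z)) (fderiv ℝ φ z u) (fderiv ℝ φ z v) := by
    filter_upwards [hG.isOpen.mem_nhds hy] with z hz using h z hz u v
  rw [he.fderiv_eq, fderiv_pullback2 (B := fun z => ev2 fun i j => T' i j z) hB' hd hd2, h y hy,
    h y hy, hφ.fderiv_chris hG hG' hy, hφ.fderiv_chris hG hG' hy, map_add, map_add]
  simp only [add_apply]
  ring

end Naturality

section Jets

variable {n : ℕ} {G G' : Coord n → Matrix (Fin n) (Fin n) ℝ} {V V' : Set (Coord n)} {y : Coord n}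
  {φ : Coord n → Coord n} {f f' : Coord n → ℝ}

lemma IsMetricOn.smooth_cov1 (hG : IsMetricOn G V) {α : Fin n → Coord n → ℝ}
    (hα : ∀ j, ContDiffOn ℝ ∞ (α j) V) (i j : Fin n) : ContDiffOn ℝ ∞ (cov1 G α i j) V :=
  (contDiffOn_pd hG.isOpen (hα j) i).sub
    (ContDiffOn.sum fun k _ => (hG.smooth_christoffel k i j).mul (hα k))

lemma IsMetricOn.smooth_hess (hG : IsMetricOn G V) (hf : ContDiffOn ℝ ∞ f V) (i j : Fin n) :
    ContDiffOn ℝ ∞ (coordHess G f i j) V :=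
  hG.smooth_cov1 (fun j => contDiffOn_pd hG.isOpen hf j) i j

lemma IsMetricOn.smooth_third (hG : IsMetricOn G V) (hf : ContDiffOn ℝ ∞ f V) (k i j : Fin n) :
    ContDiffOn ℝ ∞ (coordThird G f k i j) V :=
  (contDiffOn_pd hG.isOpen (hG.smooth_hess hf i j) k).sub (ContDiffOn.sum fun l _ =>
    ((hG.smooth_christoffel l k i).mul (hG.smooth_hess hf l j)).add
      ((hG.smooth_christoffel l k j).mul (hG.smooth_hess hf i l)))

lemma IsMetricOn.smooth_riemMixed (hG : IsMetricOn G V) (i j k l : Fin n) :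
    ContDiffOn ℝ ∞ (coordRiemMixed G i j k l) V := by
  unfold coordRiemMixed
  refine ((contDiffOn_pd hG.isOpen (hG.smooth_christoffel _ _ _) _).sub
    (contDiffOn_pd hG.isOpen (hG.smooth_christoffel _ _ _) _)).add (ContDiffOn.sum fun m _ => ?_)
  exact ((hG.smooth_christoffel _ _ _).mul (hG.smooth_christoffel _ _ _)).sub
    ((hG.smooth_christoffel _ _ _).mul (hG.smooth_christoffel _ _ _))

lemma IsMetricOn.smooth_riem (hG : IsMetricOn G V) (i j k l : Fin n) :
    ContDiffOn ℝ ∞ (coordRiem G i j k l) V :=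
  ContDiffOn.sum fun _ _ => (hG.smooth _ _).mul (hG.smooth_riemMixed _ _ _ _)

lemma IsMetricOn.smooth_ric (hG : IsMetricOn G V) (i l : Fin n) :
    ContDiffOn ℝ ∞ (coordRic G i l) V :=
  ContDiffOn.sum fun _ _ => ContDiffOn.sum fun _ _ =>
    (hG.smooth_inv _ _).mul (hG.smooth_riem _ _ _ _)

lemma IsMetricOn.hess_symm (hG : IsMetricOn G V) (hf : ContDiffOn ℝ ∞ f V) (hy : y ∈ V)
    (i j : Fin n) : coordHess G f i j y = coordHess G f j i y := by
  unfold coordHess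
  rw [pd_comm hG.isOpen hf hy j i]
  simp only [hG.christoffel_symm hy _ i j]

lemma IsMetricOn.third_symm (hG : IsMetricOn G V) (hf : ContDiffOn ℝ ∞ f V) (hy : y ∈ V)
    (k i j : Fin n) : coordThird G f k i j y = coordThird G f k j i y := by
  unfold coordThird
  rw [pd_congr_of_eqOn hG.isOpen (fun z hz => hG.hess_symm hf hz i j) hy]
  congr 1
  refine Finset.sum_congr rfl fun l _ => ?_
  rw [hG.hess_symm hf hy l j, hG.hess_symm hf hy i l]; ring

/-- The Ricci identity: the commutator of two covariant derivatives of `df`. -/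
lemma IsMetricOn.ricci_identity (hG : IsMetricOn G V) (hf : ContDiffOn ℝ ∞ f V) (hy : y ∈ V)
    (k i j : Fin n) : coordThird G f k i j y - coordThird G f i k j y
      = - ∑ l, coordRiemMixed G k i j l y * pd f l y := by
  have hpf : ∀ l, ContDiffOn ℝ ∞ (pd f l) V := contDiffOn_pd hG.isOpen hf
  have hd : ∀ {g : Coord n → ℝ}, ContDiffOn ℝ ∞ g V → DifferentiableAt ℝ g y :=
    fun h => h.diffAt hG.isOpen hy
  have h1 : ∀ a b c, pd (coordHess G f a b) c y = pd (pd (pd f b) a) c y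
      - ∑ l, (pd (christoffel G l a b) c y * pd f l y
        + christoffel G l a b y * pd (pd f l) c y) := by
    intro a b c
    unfold coordHess
    rw [pd_sub (hd (contDiffOn_pd hG.isOpen (hpf b) a))
      (hd (ContDiffOn.sum fun l _ => (hG.smooth_christoffel l a b).mul (hpf l)))]
    rw [pd_sum fun l _ => hd ((hG.smooth_christoffel l a b).mul (hpf l))]
    congr 1
    exact Finset.sum_congr rfl fun l _ =>
      pd_mul (hd (hG.smooth_christoffel l a b)) (hd (hpf l)) c
  unfold coordThird
  rw [h1, h1, pd_comm hG.isOpen (hpf j) hy i k]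
  have h2 : ∀ a b, coordHess G f a b y
      = pd (pd f b) a y - ∑ m, christoffel G m a b y * pd f m y := fun a b => rfl
  have h3 : ∀ l, christoffel G l k i y = christoffel G l i k y := fun l =>
    hG.christoffel_symm hy l k i
  have h4 : ∑ l, coordRiemMixed G k i j l y * pd f l y
      = ∑ l, (pd (christoffel G l i j) k y - pd (christoffel G l k j) i y) * pd f l y
        + ∑ l, (christoffel G l i j y * ∑ m, christoffel G m k l y * pd f m y
          - christoffel G l k j y * ∑ m, christoffel G m i l y * pd f m y) := by
    unfold coordRiemMixed
    simp only [add_mul, Finset.sum_add_distrib, Finset.sum_mul, Finset.mul_sum]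
    congr 1
    rw [Finset.sum_comm]
    refine Finset.sum_congr rfl fun l _ => ?_
    rw [← Finset.sum_sub_distrib]
    exact Finset.sum_congr rfl fun m _ => by ring
  rw [h4]
  simp only [h2 i _, h2 k _, h3]
  simp only [Finset.sum_add_distrib, Finset.sum_sub_distrib, mul_sub, sub_mul]
  ring

end Jets

/-! ### Contractions in orthonormal frames -/

section Frames

variable {n : ℕ}

/-- The pointwise data from which all integrands are built, in components: the inverse metric,
`∇u`, `∇²u`, `∇³u`, the Riemann tensor and the Ricci tensor. -/
abbrev Jet (n : ℕ) : Type :=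
  (Fin n → Fin n → ℝ) × (Fin n → ℝ) × (Fin n → Fin n → ℝ) × (Fin n → Fin n → Fin n → ℝ) ×
    (Fin n → Fin n → Fin n → Fin n → ℝ) × (Fin n → Fin n → ℝ)

namespace Jet

/-- The inverse metric `g^ij`. -/
abbrev A (J : Jet n) : Fin n → Fin n → ℝ := J.1
/-- The differential `∇_i u`. -/
abbrev D (J : Jet n) : Fin n → ℝ := J.2.1
/-- The Hessian `∇_i ∇_j u`. -/
abbrev H (J : Jet n) : Fin n → Fin n → ℝ := J.2.2.1
/-- The third derivative `∇_k ∇_i ∇_j u`. -/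
abbrev T (J : Jet n) : Fin n → Fin n → Fin n → ℝ := J.2.2.2.1
/-- The Riemann tensor `R_ijkl`. -/
abbrev R (J : Jet n) : Fin n → Fin n → Fin n → Fin n → ℝ := J.2.2.2.2.1
/-- The Ricci tensor `R_ij`. -/
abbrev Rc (J : Jet n) : Fin n → Fin n → ℝ := J.2.2.2.2.2

/-- The gradient `∇^i u`. -/
def gradUp (J : Jet n) (i : Fin n) : ℝ := ∑ j, J.A i j * J.D j
/-- `∇^i ∇_j u` -/
def hessMixed (J : Jet n) (i j : Fin n) : ℝ := ∑ k, J.A i k * J.H k j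
/-- `∇^i ∇^j u` -/
def hessUp (J : Jet n) (i j : Fin n) : ℝ := ∑ k, ∑ l, J.A i k * J.A j l * J.H k l
/-- `∇^k ∇^i ∇^j u` -/
def thirdUp (J : Jet n) (k i j : Fin n) : ℝ :=
  ∑ a, ∑ b, ∑ c, J.A k a * J.A i b * J.A j c * J.T a b c
/-- The rough Laplacian `(Δ∇u)^j`. -/
def lapGradUp (J : Jet n) (j : Fin n) : ℝ := ∑ l, ∑ k, ∑ i, J.A j l * J.A k i * J.T k i l
/-- The Laplacian `Δu`. -/
def lap (J : Jet n) : ℝ := ∑ i, ∑ j, J.A i j * J.H i j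
/-- `|∇u|²` -/
def gradSq (J : Jet n) : ℝ := tensorNormSq (Matrix.of J.A) (r := 1) fun a => J.D (a 0)
/-- `|∇²u|²` -/
def hessSq (J : Jet n) : ℝ := tensorNormSq (Matrix.of J.A) (r := 2) fun a => J.H (a 0) (a 1)
/-- `|∇³u|²` -/
def thirdSq (J : Jet n) : ℝ :=
  tensorNormSq (Matrix.of J.A) (r := 3) fun a => J.T (a 0) (a 1) (a 2)
/-- `|Rm|²` -/
def riemSq (J : Jet n) : ℝ :=
  tensorNormSq (Matrix.of J.A) (r := 4) fun a => J.R (a 0) (a 1) (a 2) (a 3)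
/-- `|Rc|²` -/
def ricSq (J : Jet n) : ℝ := tensorNormSq (Matrix.of J.A) (r := 2) fun a => J.Rc (a 0) (a 1)
/-- `Rc(∇u, Δ∇u)` -/
def ricGradLapGrad (J : Jet n) : ℝ := ∑ i, ∑ j, J.Rc i j * J.gradUp i * J.lapGradUp j
/-- `Rc²(∇u, ∇u)` -/
def ricSqGradGrad (J : Jet n) : ℝ :=
  ∑ i, ∑ j, J.A i j * (∑ k, J.Rc i k * J.gradUp k) * (∑ l, J.Rc j l * J.gradUp l)
/-- `R_pr ∇^r ∇^i u ∇^p ∇_i u` -/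
def ricHessHess (J : Jet n) : ℝ :=
  ∑ p, ∑ r, ∑ i, ∑ j, J.Rc p r * J.A i j * J.hessMixed r j * J.hessMixed p i
/-- `R_pmjr ∇^m ∇^p ∇^j u ∇^r u` -/
def riemThirdGrad (J : Jet n) : ℝ :=
  ∑ p, ∑ m, ∑ j, ∑ r, J.R p m j r * J.thirdUp m p j * J.gradUp r
/-- `R_pljr ∇^l ∇^r u ∇^p ∇^j u` -/
def riemHessHess (J : Jet n) : ℝ :=
  ∑ p, ∑ l, ∑ j, ∑ r, J.R p l j r * J.hessUp l r * J.hessUp p j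
/-- The covector `∇^p ∇^i u ∇_p ∇_i ∇_l u`. -/
def thirdHess (J : Jet n) (l : Fin n) : ℝ := ∑ p, ∑ i, J.hessUp p i * J.T p i l
/-- The covector `∇_i ∇_j u (Δ∇u)^i`. -/
def hessLapGrad (J : Jet n) (j : Fin n) : ℝ := ∑ i, J.H i j * J.lapGradUp i
/-- The covector `∇_i ∇_j u ∇^i u`. -/
def hessGrad (J : Jet n) (j : Fin n) : ℝ := ∑ i, J.H i j * J.gradUp i

end Jet

/-- The vectors `b a` are a `g`-orthonormal frame, expressed through the inverse metric `A`. -/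
def IsFrame (A : Fin n → Fin n → ℝ) (b : Fin n → Coord n) : Prop :=
  ∀ i j, A i j = ∑ a, b a i * b a j

lemma ev_apply' (T : Fin n → ℝ) (v : Coord n) : ev T v = ∑ i, v i * T i := by
  simp [ev_apply]

lemma ev3_apply (T : Fin n → Fin n → Fin n → ℝ) (u v w : Coord n) :
    ev3 T u v w = ∑ i, ∑ j, ∑ k, u i * v j * w k * T i j k := by
  simp [ev3, ev_apply', ev2_apply, Finset.mul_sum, mul_assoc]

lemma ev4_apply (T : Fin n → Fin n → Fin n → Fin n → ℝ) (u v w z : Coord n) :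
    ev4 T u v w z = ∑ i, ∑ j, ∑ k, ∑ l, u i * v j * w k * z l * T i j k l := by
  simp [ev4, ev_apply', ev3_apply, Finset.mul_sum, mul_assoc]

lemma sum_pi_succ {r : ℕ} {ι : Type*} [Fintype ι] (F : (Fin (r + 1) → ι) → ℝ) :
    ∑ a, F a = ∑ i, ∑ a : Fin r → ι, F (Fin.cons i a) := by
  rw [← (Fin.consEquiv fun _ : Fin (r + 1) => ι).sum_comp, Fintype.sum_prod_type]
  rfl

lemma sum_pi_three {ι : Type*} [Fintype ι] (F : (Fin 3 → ι) → ℝ) :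
    ∑ a, F a = ∑ i, ∑ j, ∑ k, F ![i, j, k] := by
  simp only [sum_pi_succ, Finset.univ_unique, Finset.sum_singleton]
  rfl

lemma sum_pi_four {ι : Type*} [Fintype ι] (F : (Fin 4 → ι) → ℝ) :
    ∑ a, F a = ∑ i, ∑ j, ∑ k, ∑ l, F ![i, j, k, l] := by
  simp only [sum_pi_succ, Finset.univ_unique, Finset.sum_singleton]
  rfl

lemma sum_mul_sum_swap {ι κ : Type*} [Fintype ι] [Fintype κ] (x : ι → ℝ) (z : κ → ℝ)
    (X : ι → κ → ℝ) : ∑ i, x i * ∑ c, z c * X i c = ∑ c, z c * ∑ i, x i * X i c := by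
  simp only [Finset.mul_sum]
  rw [Finset.sum_comm]
  exact Finset.sum_congr rfl fun _ _ => Finset.sum_congr rfl fun _ _ => by ring

lemma sum_comm_four_four {ι : Type*} [Fintype ι] (F : ι → ι → ι → ι → ι → ι → ι → ι → ℝ) :
    ∑ p, ∑ m, ∑ j, ∑ r, ∑ a, ∑ b, ∑ c, ∑ d, F p m j r a b c d
      = ∑ a, ∑ b, ∑ c, ∑ d, ∑ p, ∑ m, ∑ j, ∑ r, F p m j r a b c d := by
  have h : ∀ f : ι → ι → ι → ι → ℝ, ∑ a, ∑ b, ∑ c, ∑ d, f a b c d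
      = ∑ x : ι × ι × ι × ι, f x.1 x.2.1 x.2.2.1 x.2.2.2 := by
    intro f
    simp only [Fintype.sum_prod_type]
  simp only [h]
  rw [Finset.sum_comm]

lemma ev2_nested (T : Fin n → Fin n → ℝ) (u v : Coord n) :
    ev2 T u v = ∑ i, u i * ∑ j, v j * T i j := by
  simp [ev2, ev_apply]

lemma ev3_nested (T : Fin n → Fin n → Fin n → ℝ) (u v w : Coord n) :
    ev3 T u v w = ∑ i, u i * ∑ j, v j * ∑ k, w k * T i j k := by
  simp [ev3, ev_apply', ev2_nested]

/-- In an orthonormal frame the squared norm of a tensor is the sum of the squares of its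
components. -/
lemma tensorNormSq_frame {A : Fin n → Fin n → ℝ} {b : Fin n → Coord n} (hb : IsFrame A b) {r : ℕ}
    (T : (Fin r → Fin n) → ℝ) :
    tensorNormSq (Matrix.of A) T
      = ∑ c : Fin r → Fin n, (∑ i : Fin r → Fin n, (∏ s, b (c s) (i s)) * T i) ^ 2 := by
  unfold tensorNormSq
  have h1 : ∀ i j : Fin r → Fin n, ∏ s, Matrix.of A (i s) (j s)
      = ∑ c : Fin r → Fin n, (∏ s, b (c s) (i s)) * ∏ s, b (c s) (j s) := by
    intro i j
    simp only [Matrix.of_apply, hb _ _, ← Finset.prod_mul_distrib]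
    rw [Finset.prod_univ_sum]
    simp
  simp only [h1, Finset.sum_mul, sq, Finset.mul_sum]
  rw [Finset.sum_comm_cycle]
  refine Finset.sum_congr rfl fun c _ => ?_
  rw [Finset.sum_comm]
  refine Finset.sum_congr rfl fun i _ => Finset.sum_congr rfl fun j _ => ?_
  ring

section

variable {J : Jet n} {b : Fin n → Coord n} (hb : IsFrame J.A b)
include hb

lemma Jet.gradSq_frame : J.gradSq = ∑ a, ev J.D (b a) ^ 2 := by
  rw [Jet.gradSq, tensorNormSq_frame hb]
  simp [sum_pi_succ, ev_apply']

lemma Jet.hessSq_frame : J.hessSq = ∑ a, ∑ c, ev2 J.H (b a) (b c) ^ 2 := by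
  rw [Jet.hessSq, tensorNormSq_frame hb]
  simp [sum_pi_succ, ev2_apply, Fin.prod_univ_succ, mul_assoc]

lemma Jet.ricSq_frame : J.ricSq = ∑ a, ∑ c, ev2 J.Rc (b a) (b c) ^ 2 := by
  rw [Jet.ricSq, tensorNormSq_frame hb]
  simp [sum_pi_succ, ev2_apply, Fin.prod_univ_succ, mul_assoc]

lemma Jet.thirdSq_frame : J.thirdSq = ∑ a, ∑ c, ∑ e, ev3 J.T (b a) (b c) (b e) ^ 2 := by
  rw [Jet.thirdSq, tensorNormSq_frame hb]
  simp [sum_pi_three, ev3_apply, Fin.prod_univ_succ, mul_assoc]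

lemma Jet.riemSq_frame :
    J.riemSq = ∑ a, ∑ c, ∑ e, ∑ f, ev4 J.R (b a) (b c) (b e) (b f) ^ 2 := by
  rw [Jet.riemSq, tensorNormSq_frame hb]
  simp [sum_pi_four, ev4_apply, Fin.prod_univ_succ, mul_assoc]

/-- A trace with respect to the metric is the sum over an orthonormal frame. The other `_frame`
lemmas express all contractions in the same way. -/
lemma contract_frame (S : Fin n → Fin n → ℝ) :
    ∑ i, ∑ j, J.A i j * S i j = ∑ a, ev2 S (b a) (b a) := by
  simp only [hb _ _, ev2_apply, Finset.sum_mul]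
  rw [Finset.sum_comm_cycle]

lemma Jet.lap_frame : J.lap = ∑ a, ev2 J.H (b a) (b a) := contract_frame hb J.H

lemma Jet.gradUp_frame : WithLp.toLp 2 J.gradUp = ∑ a, ev J.D (b a) • b a := by
  ext i
  simp only [Jet.gradUp, hb i _, ev_apply', Finset.sum_mul, WithLp.ofLp_sum, Finset.sum_apply,
    WithLp.ofLp_smul, Pi.smul_apply, smul_eq_mul]
  rw [Finset.sum_comm]
  exact Finset.sum_congr rfl fun a _ => Finset.sum_congr rfl fun j _ => by ring

lemma Jet.lapGradUp_frame :
    WithLp.toLp 2 J.lapGradUp = ∑ a, (∑ c, ev3 J.T (b c) (b c) (b a)) • b a := by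
  ext i
  have h1 : ∀ l, ∑ k, ∑ m, J.A k m * J.T k m l = ∑ c, ev2 (fun k m => J.T k m l) (b c) (b c) :=
    fun l => contract_frame hb _
  have h2 : J.lapGradUp i = ∑ l, J.A i l * ∑ k, ∑ m, J.A k m * J.T k m l := by
    simp only [Jet.lapGradUp, Finset.mul_sum, mul_assoc]
  have h3 : ∀ c a, ev3 J.T (b c) (b c) (b a)
      = ∑ l, b a l * ev2 (fun k m => J.T k m l) (b c) (b c) := by
    intro c a
    simp only [ev3_apply, ev2_apply, Finset.mul_sum]
    rw [Finset.sum_comm_cycle]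
    exact Finset.sum_congr rfl fun _ _ => Finset.sum_congr rfl fun _ _ =>
      Finset.sum_congr rfl fun _ _ => by ring
  simp only [WithLp.ofLp_sum, Finset.sum_apply, WithLp.ofLp_smul, Pi.smul_apply, smul_eq_mul,
    h3, h2, h1, hb i _, Finset.sum_mul, Finset.mul_sum]
  rw [Finset.sum_comm_cycle]
  refine Finset.sum_congr rfl fun a _ => ?_
  rw [Finset.sum_comm]
  exact Finset.sum_congr rfl fun _ _ => Finset.sum_congr rfl fun _ _ => by ring

lemma Jet.ricGradLapGrad_frame : J.ricGradLapGrad = ∑ a, ∑ c,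
    ev2 J.Rc (b a) (b c) * ev J.D (b a) * ∑ e, ev3 J.T (b e) (b e) (b c) := by
  have : J.ricGradLapGrad = ev2 J.Rc (WithLp.toLp 2 J.gradUp) (WithLp.toLp 2 J.lapGradUp) := by
    rw [ev2_apply]
    exact Finset.sum_congr rfl fun _ _ => Finset.sum_congr rfl fun _ _ => by simp; ring
  rw [this, Jet.gradUp_frame hb, Jet.lapGradUp_frame hb]
  simp only [map_sum, map_smul, sum_apply, smul_apply, smul_eq_mul, Finset.mul_sum, Finset.sum_mul]
  rw [Finset.sum_comm]
  refine Finset.sum_congr rfl fun _ _ => Finset.sum_congr rfl fun _ _ =>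
    Finset.sum_congr rfl fun _ _ => by ring

lemma Jet.ricSqGradGrad_frame : J.ricSqGradGrad
    = ∑ a, (∑ c, ev2 J.Rc (b a) (b c) * ev J.D (b c)) ^ 2 := by
  have h1 : ∀ i, ∑ k, J.Rc i k * J.gradUp k = ∑ c, ev J.D (b c) * ev (J.Rc i) (b c) := by
    intro i
    have : ∑ k, J.Rc i k * J.gradUp k = ev (J.Rc i) (WithLp.toLp 2 J.gradUp) := by
      rw [ev_apply']
      exact Finset.sum_congr rfl fun _ _ => by simp; ring
    rw [this, Jet.gradUp_frame hb]
    simp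
  have h2 : J.ricSqGradGrad = ∑ i, ∑ j, J.A i j *
      ((∑ c, ev J.D (b c) * ev (J.Rc i) (b c)) * (∑ c, ev J.D (b c) * ev (J.Rc j) (b c))) := by
    simp only [Jet.ricSqGradGrad, h1, mul_assoc]
  rw [h2, contract_frame hb]
  refine Finset.sum_congr rfl fun a _ => ?_
  have h3 : ∀ c, ev2 J.Rc (b a) (b c) = ∑ i, b a i * ev (J.Rc i) (b c) := by
    intro c
    simp [ev2, ev_apply]
  have h4 : ∑ c, ev2 J.Rc (b a) (b c) * ev J.D (b c)
      = ∑ i, b a i * ∑ c, ev J.D (b c) * ev (J.Rc i) (b c) := by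
    simp only [h3, Finset.mul_sum, Finset.sum_mul]
    rw [Finset.sum_comm]
    exact Finset.sum_congr rfl fun _ _ => Finset.sum_congr rfl fun _ _ => by ring
  rw [h4, ev2_apply, sq, Finset.sum_mul_sum]
  exact Finset.sum_congr rfl fun _ _ => Finset.sum_congr rfl fun _ _ => by ring

lemma up_frame (i : Fin n) (α : Fin n → ℝ) :
    ∑ k, J.A i k * α k = ∑ a, b a i * ∑ k, b a k * α k := by
  simp only [hb i _, Finset.sum_mul, Finset.mul_sum]
  rw [Finset.sum_comm]
  exact Finset.sum_congr rfl fun _ _ => Finset.sum_congr rfl fun _ _ => by ring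

lemma Jet.hessMixed_frame (r : Fin n) (e : Fin n) :
    ∑ j, b e j * J.hessMixed r j = ∑ c, b c r * ev2 J.H (b c) (b e) := by
  simp only [Jet.hessMixed, up_frame hb]
  rw [sum_mul_sum_swap]
  refine Finset.sum_congr rfl fun c _ => ?_
  rw [sum_mul_sum_swap, ev2_nested]

lemma Jet.ricHessHess_frame : J.ricHessHess = ∑ a, ∑ c, ∑ e,
    ev2 J.Rc (b a) (b c) * ev2 J.H (b c) (b e) * ev2 J.H (b a) (b e) := by
  have h1 : ∀ p r, ∑ i, ∑ j, J.Rc p r * J.A i j * J.hessMixed r j * J.hessMixed p i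
      = ∑ e, J.Rc p r * ((∑ c, b c r * ev2 J.H (b c) (b e)) *
        (∑ a, b a p * ev2 J.H (b a) (b e))) := by
    intro p r
    rw [← Finset.mul_sum]
    simp only [← Jet.hessMixed_frame hb]
    have h2 := contract_frame hb (fun i j => J.hessMixed p i * J.hessMixed r j)
    simp only [ev2_apply] at h2
    have h3 : ∀ e, (∑ j, b e j * J.hessMixed r j) * (∑ j, b e j * J.hessMixed p j)
        = ∑ i, ∑ j, b e i * b e j * (J.hessMixed p i * J.hessMixed r j) := by
      intro e
      rw [mul_comm, Finset.sum_mul_sum]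
      exact Finset.sum_congr rfl fun _ _ => Finset.sum_congr rfl fun _ _ => by ring
    simp only [h3]
    rw [← h2]
    simp only [Finset.mul_sum]
    exact Finset.sum_congr rfl fun _ _ => Finset.sum_congr rfl fun _ _ => by ring
  have h4 : J.ricHessHess = ∑ e, ev2 J.Rc (∑ a, ev2 J.H (b a) (b e) • b a)
      (∑ c, ev2 J.H (b c) (b e) • b c) := by
    unfold Jet.ricHessHess
    simp only [h1]
    simp only [ev2_apply J.Rc, WithLp.ofLp_sum, Finset.sum_apply, WithLp.ofLp_smul, Pi.smul_apply,
      smul_eq_mul]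
    simp only [mul_comm (ev2 J.H _ _)]
    rw [Finset.sum_comm_cycle]
    refine Finset.sum_congr rfl fun e _ => Finset.sum_congr rfl fun p _ =>
      Finset.sum_congr rfl fun r _ => ?_
    ring
  rw [h4]
  simp only [map_sum, map_smul, sum_apply, smul_apply, smul_eq_mul, Finset.mul_sum]
  rw [Finset.sum_comm_cycle, Finset.sum_comm_cycle]
  rw [Finset.sum_comm]
  refine Finset.sum_congr rfl fun _ _ => Finset.sum_congr rfl fun _ _ =>
    Finset.sum_congr rfl fun _ _ => by ring

lemma Jet.hessUp_frame (i j : Fin n) :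
    J.hessUp i j = ∑ a, ∑ c, b a i * b c j * ev2 J.H (b a) (b c) := by
  have h1 : J.hessUp i j = ∑ k, J.A i k * ∑ l, J.A j l * J.H k l := by
    simp only [Jet.hessUp, Finset.mul_sum, mul_assoc]
  have h2 : ∀ a, ∑ c, b a i * b c j * ev2 J.H (b a) (b c)
      = b a i * ∑ c, b c j * ev2 J.H (b a) (b c) := by
    intro a
    simp only [Finset.mul_sum, mul_assoc]
  simp only [h1, up_frame hb, h2]
  refine Finset.sum_congr rfl fun a _ => ?_
  rw [sum_mul_sum_swap]
  simp only [ev2_nested]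

lemma Jet.thirdUp_frame (k i j : Fin n) : J.thirdUp k i j
    = ∑ a, ∑ c, ∑ e, b a k * b c i * b e j * ev3 J.T (b a) (b c) (b e) := by
  have h1 : J.thirdUp k i j = ∑ a, J.A k a * ∑ c, J.A i c * ∑ e, J.A j e * J.T a c e := by
    simp only [Jet.thirdUp, Finset.mul_sum, mul_assoc]
  have h2 : ∀ a, ∑ c, ∑ e, b a k * b c i * b e j * ev3 J.T (b a) (b c) (b e)
      = b a k * ∑ c, b c i * ∑ e, b e j * ev3 J.T (b a) (b c) (b e) := by
    intro a
    simp only [Finset.mul_sum, mul_assoc]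
  simp only [h1, up_frame hb, h2]
  refine Finset.sum_congr rfl fun a _ => ?_
  rw [sum_mul_sum_swap]
  congr 1
  refine Finset.sum_congr rfl fun c _ => ?_
  have h3 : ∀ x, ∑ m, b c m * ∑ e, b e j * ∑ l, b e l * J.T x m l
      = ∑ e, b e j * ∑ m, b c m * ∑ l, b e l * J.T x m l := fun x => sum_mul_sum_swap _ _ _
  simp only [h3]
  rw [sum_mul_sum_swap]
  simp only [ev3_nested]

lemma Jet.gradUp_frame' (i : Fin n) : J.gradUp i = ∑ a, b a i * ev J.D (b a) := by
  simp only [Jet.gradUp, up_frame hb, ev_apply']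

lemma Jet.riemThirdGrad_frame : J.riemThirdGrad = ∑ r, ∑ m, ∑ p, ∑ j,
    ev4 J.R (b p) (b m) (b j) (b r) * ev3 J.T (b m) (b p) (b j) * ev J.D (b r) := by
  simp only [Jet.riemThirdGrad, Jet.thirdUp_frame hb, Jet.gradUp_frame' hb]
  simp only [Finset.mul_sum]
  simp only [Finset.sum_mul]
  rw [sum_comm_four_four]
  refine Finset.sum_congr rfl fun r _ => Finset.sum_congr rfl fun m _ =>
    Finset.sum_congr rfl fun p _ => Finset.sum_congr rfl fun j _ => ?_
  simp only [ev4_apply, Finset.sum_mul]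
  refine Finset.sum_congr rfl fun _ _ => Finset.sum_congr rfl fun _ _ =>
    Finset.sum_congr rfl fun _ _ => Finset.sum_congr rfl fun _ _ => by ring

lemma Jet.riemHessHess_frame : J.riemHessHess = ∑ p, ∑ j, ∑ l, ∑ r,
    ev4 J.R (b p) (b l) (b j) (b r) * ev2 J.H (b l) (b r) * ev2 J.H (b p) (b j) := by
  simp only [Jet.riemHessHess, Jet.hessUp_frame hb]
  simp only [Finset.mul_sum]
  simp only [Finset.sum_mul]
  rw [sum_comm_four_four]
  refine Finset.sum_congr rfl fun r _ => Finset.sum_congr rfl fun m _ =>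
    Finset.sum_congr rfl fun p _ => Finset.sum_congr rfl fun j _ => ?_
  simp only [ev4_apply, Finset.sum_mul]
  refine Finset.sum_congr rfl fun _ _ => Finset.sum_congr rfl fun _ _ =>
    Finset.sum_congr rfl fun _ _ => Finset.sum_congr rfl fun _ _ => by ring

lemma Jet.thirdHess_frame (v : Coord n) : ev J.thirdHess v
    = ∑ a, ∑ c, ev2 J.H (b a) (b c) * ev3 J.T (b a) (b c) v := by
  have h1 : ∀ l, J.thirdHess l
      = ∑ a, ∑ c, ev2 J.H (b a) (b c) * ev2 (fun p i => J.T p i l) (b a) (b c) := by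
    intro l
    simp only [Jet.thirdHess, Jet.hessUp_frame hb, Finset.sum_mul, ev2_apply (fun p i => J.T p i l),
      Finset.mul_sum]
    rw [Finset.sum_comm_cycle, Finset.sum_congr rfl fun a _ => Finset.sum_comm_cycle]
    exact Finset.sum_congr rfl fun _ _ => Finset.sum_congr rfl fun _ _ =>
      Finset.sum_congr rfl fun _ _ => Finset.sum_congr rfl fun _ _ => by ring
  have h2 : ∀ a c, ev3 J.T (b a) (b c) v
      = ∑ l, v l * ev2 (fun p i => J.T p i l) (b a) (b c) := by
    intro a c
    simp only [ev3_apply, ev2_apply, Finset.mul_sum]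
    rw [Finset.sum_comm_cycle]
    exact Finset.sum_congr rfl fun _ _ => Finset.sum_congr rfl fun _ _ =>
      Finset.sum_congr rfl fun _ _ => by ring
  simp only [ev_apply', h1, h2, Finset.mul_sum]
  rw [← Finset.sum_comm_cycle]
  exact Finset.sum_congr rfl fun _ _ => Finset.sum_congr rfl fun _ _ =>
      Finset.sum_congr rfl fun _ _ => by ring

lemma Jet.hessLapGrad_frame (v : Coord n) : ev J.hessLapGrad v
    = ∑ a, ev2 J.H (b a) v * ∑ c, ev3 J.T (b c) (b c) (b a) := by
  have : ev J.hessLapGrad v = ev2 J.H (WithLp.toLp 2 J.lapGradUp) v := by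
    simp only [ev_apply', Jet.hessLapGrad, ev2_apply, Finset.mul_sum]
    rw [Finset.sum_comm]
    exact Finset.sum_congr rfl fun _ _ => Finset.sum_congr rfl fun _ _ => by ring
  rw [this, Jet.lapGradUp_frame hb]
  simp only [map_sum, map_smul, sum_apply, smul_apply, smul_eq_mul, mul_comm]

lemma Jet.hessGrad_frame (v : Coord n) : ev J.hessGrad v
    = ∑ a, ev2 J.H (b a) v * ev J.D (b a) := by
  have : ev J.hessGrad v = ev2 J.H (WithLp.toLp 2 J.gradUp) v := by
    simp only [ev_apply', Jet.hessGrad, ev2_apply, Finset.mul_sum]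
    rw [Finset.sum_comm]
    exact Finset.sum_congr rfl fun _ _ => Finset.sum_congr rfl fun _ _ => by ring
  rw [this, Jet.gradUp_frame hb]
  simp only [map_sum, map_smul, sum_apply, smul_apply, smul_eq_mul, mul_comm]

end
end Frames

/-! ### Chart independence of the contractions -/

section JetInvariance

variable {n : ℕ}

/-- The jets `J` and `J'` represent the same tensors, in coordinates that are related by a
coordinate change with differential `L`. -/
structure JetRel (J J' : Jet n) (L : Coord n → Coord n) : Prop where
  exists_frame : ∃ b, IsFrame J.A b
  frame : ∀ b, IsFrame J.A b → IsFrame J'.A fun a => L (b a)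
  D : ∀ v, ev J.D v = ev J'.D (L v)
  H : ∀ u v, ev2 J.H u v = ev2 J'.H (L u) (L v)
  T : ∀ u v w, ev3 J.T u v w = ev3 J'.T (L u) (L v) (L w)
  R : ∀ u v w z, ev4 J.R u v w z = ev4 J'.R (L u) (L v) (L w) (L z)
  Rc : ∀ u v, ev2 J.Rc u v = ev2 J'.Rc (L u) (L v)

namespace JetRel

variable {J J' : Jet n} {L : Coord n → Coord n} (h : JetRel J J' L)
include h

lemma gradSq : J.gradSq = J'.gradSq := by
  obtain ⟨b, hb⟩ := h.exists_frame
  rw [Jet.gradSq_frame hb, Jet.gradSq_frame (h.frame b hb)]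
  simp only [h.D]

lemma hessSq : J.hessSq = J'.hessSq := by
  obtain ⟨b, hb⟩ := h.exists_frame
  rw [Jet.hessSq_frame hb, Jet.hessSq_frame (h.frame b hb)]
  simp only [h.H]

lemma thirdSq : J.thirdSq = J'.thirdSq := by
  obtain ⟨b, hb⟩ := h.exists_frame
  rw [Jet.thirdSq_frame hb, Jet.thirdSq_frame (h.frame b hb)]
  simp only [h.T]

lemma riemSq : J.riemSq = J'.riemSq := by
  obtain ⟨b, hb⟩ := h.exists_frame
  rw [Jet.riemSq_frame hb, Jet.riemSq_frame (h.frame b hb)]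
  simp only [h.R]

lemma ricSq : J.ricSq = J'.ricSq := by
  obtain ⟨b, hb⟩ := h.exists_frame
  rw [Jet.ricSq_frame hb, Jet.ricSq_frame (h.frame b hb)]
  simp only [h.Rc]

lemma lap : J.lap = J'.lap := by
  obtain ⟨b, hb⟩ := h.exists_frame
  rw [Jet.lap_frame hb, Jet.lap_frame (h.frame b hb)]
  simp only [h.H]

lemma ricGradLapGrad : J.ricGradLapGrad = J'.ricGradLapGrad := by
  obtain ⟨b, hb⟩ := h.exists_frame
  rw [Jet.ricGradLapGrad_frame hb, Jet.ricGradLapGrad_frame (h.frame b hb)]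
  simp only [h.Rc, h.D, h.T]

lemma ricSqGradGrad : J.ricSqGradGrad = J'.ricSqGradGrad := by
  obtain ⟨b, hb⟩ := h.exists_frame
  rw [Jet.ricSqGradGrad_frame hb, Jet.ricSqGradGrad_frame (h.frame b hb)]
  simp only [h.Rc, h.D]

lemma ricHessHess : J.ricHessHess = J'.ricHessHess := by
  obtain ⟨b, hb⟩ := h.exists_frame
  rw [Jet.ricHessHess_frame hb, Jet.ricHessHess_frame (h.frame b hb)]
  simp only [h.Rc, h.H]

lemma riemThirdGrad : J.riemThirdGrad = J'.riemThirdGrad := by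
  obtain ⟨b, hb⟩ := h.exists_frame
  rw [Jet.riemThirdGrad_frame hb, Jet.riemThirdGrad_frame (h.frame b hb)]
  simp only [h.R, h.T, h.D]

lemma riemHessHess : J.riemHessHess = J'.riemHessHess := by
  obtain ⟨b, hb⟩ := h.exists_frame
  rw [Jet.riemHessHess_frame hb, Jet.riemHessHess_frame (h.frame b hb)]
  simp only [h.R, h.H]

lemma thirdHess (v : Coord n) : ev J.thirdHess v = ev J'.thirdHess (L v) := by
  obtain ⟨b, hb⟩ := h.exists_frame
  rw [Jet.thirdHess_frame hb, Jet.thirdHess_frame (h.frame b hb)]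
  simp only [h.T, h.H]

lemma hessLapGrad (v : Coord n) : ev J.hessLapGrad v = ev J'.hessLapGrad (L v) := by
  obtain ⟨b, hb⟩ := h.exists_frame
  rw [Jet.hessLapGrad_frame hb, Jet.hessLapGrad_frame (h.frame b hb)]
  simp only [h.T, h.H]

lemma hessGrad (v : Coord n) : ev J.hessGrad v = ev J'.hessGrad (L v) := by
  obtain ⟨b, hb⟩ := h.exists_frame
  rw [Jet.hessGrad_frame hb, Jet.hessGrad_frame (h.frame b hb)]
  simp only [h.D, h.H]

end JetRel

end JetInvariance

section CoordJet

variable {n : ℕ} {G G' : Coord n → Matrix (Fin n) (Fin n) ℝ} {V V' : Set (Coord n)} {y : Coord n}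
  {φ : Coord n → Coord n} {f f' : Coord n → ℝ}

/-- The jet of the function `f` and the metric `G` at the point `y`. -/
def coordJet (G : Coord n → Matrix (Fin n) (Fin n) ℝ) (f : Coord n → ℝ) (y : Coord n) : Jet n :=
  (fun i j => (G y)⁻¹ i j, fun i => pd f i y, fun i j => coordHess G f i j y,
    fun k i j => coordThird G f k i j y, fun i j k l => coordRiem G i j k l y,
    fun i j => coordRic G i j y)

open scoped MatrixOrder in
/-- A factorization `g⁻¹ = Bᵀ B` of the inverse metric gives an orthonormal frame. -/
lemma exists_isFrame (hG : IsMetricOn G V) (hy : y ∈ V) :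
    ∃ b, IsFrame (fun i j => (G y)⁻¹ i j) b := by
  obtain ⟨B, hB⟩ := CStarAlgebra.nonneg_iff_eq_star_mul_self.mp
    (Matrix.nonneg_iff_posSemidef.mpr (hG.posDef y hy).inv.posSemidef)
  refine ⟨fun a => WithLp.toLp 2 fun i => B a i, fun i j => ?_⟩
  rw [hB]
  beta_reduce
  rw [Matrix.mul_apply]
  simp [Matrix.star_apply]

/-- A family of vectors is a frame for the inverse of a positive definite matrix if and only if it
is orthonormal. -/
lemma isFrame_iff (hG : IsMetricOn G V) (hy : y ∈ V) (b : Fin n → Coord n) :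
    IsFrame (fun i j => (G y)⁻¹ i j) b ↔
      ∀ a c, ev2 (fun i j => G y i j) (b a) (b c) = if a = c then 1 else 0 := by
  set B : Matrix (Fin n) (Fin n) ℝ := Matrix.of fun a i => b a i with hB
  have h1 : (∀ i j, (G y)⁻¹ i j = ∑ a, b a i * b a j) ↔ (G y)⁻¹ = Bᵀ * B := by
    constructor
    · intro h; ext i j; rw [h, Matrix.mul_apply]; rfl
    · intro h i j; rw [h, Matrix.mul_apply]; rfl
  have h2 : (∀ a c, ev2 (fun i j => G y i j) (b a) (b c) = if a = c then 1 else 0)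
      ↔ B * (G y * Bᵀ) = 1 := by
    have : ∀ a c, ev2 (fun i j => G y i j) (b a) (b c) = (B * (G y * Bᵀ)) a c := by
      intro a c
      rw [ev2_nested]
      simp only [Matrix.mul_apply, Matrix.transpose_apply, hB, Matrix.of_apply, mul_comm (G y _ _)]
    constructor
    · intro h; ext a c; rw [← this, h, Matrix.one_apply]
    · intro h a c; rw [this, h, Matrix.one_apply]
  rw [IsFrame, h1, h2]
  have hu := hG.isUnit_det hy
  constructor
  · intro h
    have h3 : G y * Bᵀ * B = 1 := by rw [Matrix.mul_assoc, ← h, Matrix.mul_nonsing_inv _ hu]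
    exact mul_eq_one_comm.mp h3
  · intro h
    have h3 : G y * (Bᵀ * B) = 1 := by
      rw [← Matrix.mul_assoc]
      exact mul_eq_one_comm.mp h
    exact Matrix.inv_eq_right_inv h3

lemma sum_mul_sum_rot {ι : Type*} [Fintype ι] (x w z : ι → ℝ) (X : ι → ι → ι → ℝ) :
    ∑ i, x i * ∑ j, w j * ∑ c, z c * X i j c = ∑ c, z c * ∑ i, x i * ∑ j, w j * X i j c := by
  have : ∀ i, ∑ j, w j * ∑ c, z c * X i j c = ∑ c, z c * ∑ j, w j * X i j c := fun i =>
    sum_mul_sum_swap _ _ _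
  simp only [this]
  rw [sum_mul_sum_swap]

/-- The Riemann tensor is the curvature operator with its last index lowered, evaluated on
vectors. -/
lemma coordRiem_eval (u v w z : Coord n) : ev4 (fun i j k l => coordRiem G i j k l y) u v w z
    = ev2 (fun i j => G y i j) z
      (WithLp.toLp 2 fun m => ev3 (fun i j k => coordRiemMixed G i j k m y) u v w) := by
  have h1 : ∀ i j k, ∑ l, z l * ∑ m, G y l m * coordRiemMixed G i j k m y
      = ∑ m, (∑ l, z l * G y l m) * coordRiemMixed G i j k m y := by
    intro i j k
    simp only [Finset.mul_sum, Finset.sum_mul]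
    rw [Finset.sum_comm]
    exact Finset.sum_congr rfl fun _ _ => Finset.sum_congr rfl fun _ _ => by ring
  have h2 : ev4 (fun i j k l => coordRiem G i j k l y) u v w z
      = ∑ i, u i * ∑ j, v j * ∑ k, w k * ∑ l, z l * ∑ m, G y l m * coordRiemMixed G i j k m y := by
    simp only [ev4, ev_apply', ev3_nested]; rfl
  have h3 : ev2 (fun i j => G y i j) z
      (WithLp.toLp 2 fun m => ev3 (fun i j k => coordRiemMixed G i j k m y) u v w)
      = ∑ m, (∑ l, z l * G y l m) * ev3 (fun i j k => coordRiemMixed G i j k m y) u v w := by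
    rw [ev2_apply, Finset.sum_comm]
    refine Finset.sum_congr rfl fun m _ => ?_
    rw [Finset.sum_mul]
    exact Finset.sum_congr rfl fun _ _ => by ring
  rw [h2, h3]
  simp only [h1, ev3_nested]
  have h4 : ∀ i, ∑ j, v j * ∑ k, w k * ∑ m, (∑ l, z l * G y l m) * coordRiemMixed G i j k m y
      = ∑ m, (∑ l, z l * G y l m) * ∑ j, v j * ∑ k, w k * coordRiemMixed G i j k m y :=
    fun i => sum_mul_sum_rot _ _ _ _
  simp only [h4]
  rw [sum_mul_sum_swap]

/-- The Ricci identity, evaluated on vectors. -/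
lemma IsMetricOn.ricci_eval (hG : IsMetricOn G V) (hf : ContDiffOn ℝ ∞ f V) (hy : y ∈ V)
    (u v w : Coord n) :
    ev3 (fun k i j => coordThird G f k i j y) u v w
        - ev3 (fun k i j => coordThird G f k i j y) v u w
      = - fderiv ℝ f y
        (WithLp.toLp 2 fun m => ev3 (fun i j k => coordRiemMixed G i j k m y) u v w) := by
  have h1 : ev3 (fun k i j => coordThird G f k i j y) v u w
      = ∑ i, ∑ j, ∑ k, u i * v j * w k * coordThird G f j i k y := by
    rw [ev3_apply, Finset.sum_comm]
    exact Finset.sum_congr rfl fun _ _ => Finset.sum_congr rfl fun _ _ =>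
      Finset.sum_congr rfl fun _ _ => by ring
  rw [h1, ev3_apply, ← ev_pd, ev_apply']
  simp only [← Finset.sum_sub_distrib, ← mul_sub, hG.ricci_identity hf hy, ev3_apply,
    Finset.sum_mul, mul_neg, Finset.sum_neg_distrib, Finset.mul_sum]
  congr 1
  have : ∀ F : Fin n → Fin n → Fin n → Fin n → ℝ,
      ∑ i, ∑ j, ∑ k, ∑ l, F i j k l = ∑ l, ∑ i, ∑ j, ∑ k, F i j k l := by
    intro F
    have h : ∀ i, ∑ j, ∑ k, ∑ l, F i j k l = ∑ l, ∑ j, ∑ k, F i j k l := fun i =>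
      Finset.sum_comm_cycle
    simp only [h]
    rw [Finset.sum_comm]
  rw [this]
  exact Finset.sum_congr rfl fun _ _ => Finset.sum_congr rfl fun _ _ =>
    Finset.sum_congr rfl fun _ _ => Finset.sum_congr rfl fun _ _ => by ring

lemma IsIsometricMap.pd_eq (hφ : IsIsometricMap φ G V G' V') (hG : IsMetricOn G V)
    (hG' : IsMetricOn G' V') (hf' : ContDiffOn ℝ ∞ f' V')
    (hff : ∀ z ∈ V, f z = f' (φ z)) (z : Coord n) (hz : z ∈ V) (v : Coord n) :
    ev (fun i => pd f i z) v = ev (fun i => pd f' i (φ z)) (fderiv ℝ φ z v) := by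
  rw [ev_pd, ev_pd]
  have : f =ᶠ[nhds z] fun x => f' (φ x) := by
    filter_upwards [hG.isOpen.mem_nhds hz] with x hx using hff x hx
  rw [this.fderiv_eq]
  have h2 := fderiv_comp (g := f') (f := φ) z (hf'.diffAt hG'.isOpen (hφ.mapsTo hz))
    (hφ.smooth.diffAt hG.isOpen hz)
  exact congrArg (fun A => A v) h2

/-- Naturality of the Hessian. -/
lemma IsIsometricMap.hess_eq (hφ : IsIsometricMap φ G V G' V') (hG : IsMetricOn G V)
    (hG' : IsMetricOn G' V') (hf : ContDiffOn ℝ ∞ f V) (hf' : ContDiffOn ℝ ∞ f' V')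
    (hff : ∀ z ∈ V, f z = f' (φ z)) (z : Coord n) (hz : z ∈ V) (u v : Coord n) :
    ev2 (fun i j => coordHess G f i j z) u v
      = ev2 (fun i j => coordHess G' f' i j (φ z)) (fderiv ℝ φ z u) (fderiv ℝ φ z v) :=
  hφ.cov1_eq hG hG' hz (fun j => (contDiffOn_pd hG.isOpen hf j).diffAt hG.isOpen hz)
    (fun j => (contDiffOn_pd hG'.isOpen hf' j).diffAt hG'.isOpen (hφ.mapsTo hz))
    (hφ.pd_eq hG hG' hf' hff) u v

/-- Naturality of the third covariant derivative of a function. -/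
lemma IsIsometricMap.third_eq (hφ : IsIsometricMap φ G V G' V') (hG : IsMetricOn G V)
    (hG' : IsMetricOn G' V') (hf : ContDiffOn ℝ ∞ f V) (hf' : ContDiffOn ℝ ∞ f' V')
    (hff : ∀ z ∈ V, f z = f' (φ z)) (z : Coord n) (hz : z ∈ V) (u v w : Coord n) :
    ev3 (fun k i j => coordThird G f k i j z) u v w
      = ev3 (fun k i j => coordThird G' f' k i j (φ z))
        (fderiv ℝ φ z u) (fderiv ℝ φ z v) (fderiv ℝ φ z w) :=
  hφ.cov2_eq hG hG' hz (fun i j => (hG.smooth_hess hf i j).diffAt hG.isOpen hz)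
    (fun i j => (hG'.smooth_hess hf' i j).diffAt hG'.isOpen (hφ.mapsTo hz))
    (hφ.hess_eq hG hG' hf hf' hff) u v w

/-- Naturality of the curvature operator. It follows from the naturality of `∇³f` and the Ricci
identity, applied to the pull-backs of the coordinate functions. -/
lemma IsIsometricMap.riemMixed_eq (hφ : IsIsometricMap φ G V G' V') (hG : IsMetricOn G V)
    (hG' : IsMetricOn G' V') (hy : y ∈ V) (u v w : Coord n) :
    fderiv ℝ φ y (WithLp.toLp 2 fun m => ev3 (fun i j k => coordRiemMixed G i j k m y) u v w)
      = WithLp.toLp 2 fun m => ev3 (fun i j k => coordRiemMixed G' i j k m (φ y))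
          (fderiv ℝ φ y u) (fderiv ℝ φ y v) (fderiv ℝ φ y w) := by
  ext c
  set f : Coord n → ℝ := fun z => φ z c with hf0
  set f' : Coord n → ℝ := fun z => z c with hf0'
  have hf : ContDiffOn ℝ ∞ f V :=
    (EuclideanSpace.proj (𝕜 := ℝ) c : Coord n →L[ℝ] ℝ).contDiff.comp_contDiffOn hφ.smooth
  have hf' : ContDiffOn ℝ ∞ f' V' :=
    (EuclideanSpace.proj (𝕜 := ℝ) c : Coord n →L[ℝ] ℝ).contDiff.contDiffOn
  have h3 := hφ.third_eq hG hG' hf hf' (fun _ _ => rfl)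
  have e1 := hG.ricci_eval hf hy u v w
  have e2 := hG'.ricci_eval hf' (hφ.mapsTo hy) (fderiv ℝ φ y u) (fderiv ℝ φ y v) (fderiv ℝ φ y w)
  rw [h3 y hy, h3 y hy, e2] at e1
  have e3 := neg_injective e1
  have h4 : ∀ x, fderiv ℝ f' (φ y) x = x c := fun x => by
    rw [hf0', show (fun z : Coord n => z c)
      = ⇑(EuclideanSpace.proj (𝕜 := ℝ) c : Coord n →L[ℝ] ℝ) from rfl, ContinuousLinearMap.fderiv]
    rfl
  have h5 : ∀ x, fderiv ℝ f y x = (fderiv ℝ φ y x) c := fun x => by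
    have h := ((EuclideanSpace.proj (𝕜 := ℝ) c : Coord n →L[ℝ] ℝ).hasFDerivAt.comp y
      (hφ.smooth.diffAt hG.isOpen hy).hasFDerivAt).fderiv
    exact congrArg (fun A => A x) h
  rw [h4, h5] at e3
  exact e3.symm

/-- The jets of a function in two coordinate systems represent the same tensors. -/
lemma IsIsometricMap.jetRel (hφ : IsIsometricMap φ G V G' V') (hG : IsMetricOn G V)
    (hG' : IsMetricOn G' V') (hf : ContDiffOn ℝ ∞ f V) (hf' : ContDiffOn ℝ ∞ f' V')
    (hff : ∀ z ∈ V, f z = f' (φ z)) (hy : y ∈ V) :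
    JetRel (coordJet G f y) (coordJet G' f' (φ y)) (fderiv ℝ φ y) := by
  have hfr : ∀ b, IsFrame (coordJet G f y).A b →
      IsFrame (coordJet G' f' (φ y)).A fun a => fderiv ℝ φ y (b a) := by
    intro b hb
    refine (isFrame_iff hG' (hφ.mapsTo hy) _).mpr fun a c => ?_
    rw [← hφ.metric y hy]
    exact (isFrame_iff hG hy b).mp hb a c
  have hR : ∀ u v w z, ev4 (coordJet G f y).R u v w z = ev4 (coordJet G' f' (φ y)).R
      (fderiv ℝ φ y u) (fderiv ℝ φ y v) (fderiv ℝ φ y w) (fderiv ℝ φ y z) := by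
    intro u v w z
    have h1 := coordRiem_eval (G := G) (y := y) u v w z
    have h2 := coordRiem_eval (G := G') (y := φ y) (fderiv ℝ φ y u) (fderiv ℝ φ y v)
      (fderiv ℝ φ y w) (fderiv ℝ φ y z)
    rw [hφ.metric y hy, hφ.riemMixed_eq hG hG' hy, ← h2] at h1
    exact h1
  -- in a frame the Ricci tensor is a trace of the Riemann tensor, which makes it natural
  have hRc : ∀ {G : Coord n → Matrix (Fin n) (Fin n) ℝ} {f : Coord n → ℝ} {y : Coord n}
      {b : Fin n → Coord n}, IsFrame (coordJet G f y).A b → ∀ u v,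
      ev2 (coordJet G f y).Rc u v = ∑ c, ev4 (coordJet G f y).R u (b c) (b c) v := by
    intro G f y b hb u v
    have h1 : ∀ i l, (coordJet G f y).Rc i l
        = ∑ c, ∑ j, b c j * ∑ k, b c k * (coordJet G f y).R i j k l := by
      intro i l
      have := contract_frame hb fun j k => (coordJet G f y).R i j k l
      simp only [ev2_nested] at this
      exact this
    have h2 : ∀ c, ev4 (coordJet G f y).R u (b c) (b c) v
      = ∑ i, u i * ∑ l, v l * ∑ j, b c j * ∑ k, b c k * (coordJet G f y).R i j k l := by
      intro c
      simp only [ev4, ev_apply', ev3_nested]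
      exact Finset.sum_congr rfl fun i _ => congrArg _ (sum_mul_sum_rot _ _ _ _)
    rw [ev2_nested]
    simp only [h1, h2]
    rw [Finset.sum_comm]
    refine Finset.sum_congr rfl fun i _ => ?_
    rw [← Finset.mul_sum, Finset.sum_comm]
    simp only [Finset.mul_sum]
  refine ⟨exists_isFrame hG hy, hfr, hφ.pd_eq hG hG' hf' hff y hy,
    hφ.hess_eq hG hG' hf hf' hff y hy, hφ.third_eq hG hG' hf hf' hff y hy, hR, ?_⟩
  · intro u v
    obtain ⟨b, hb⟩ := exists_isFrame hG hy
    rw [hRc (G := G) (f := f) hb, hRc (hfr b hb)]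
    simp only [hR]

end CoordJet

/-! ### Normal coordinates -/

section Normal

variable {n : ℕ} {G G' : Coord n → Matrix (Fin n) (Fin n) ℝ} {V V' : Set (Coord n)} {y : Coord n}
  {φ : Coord n → Coord n} {f f' : Coord n → ℝ}

/-- The coordinates are normal at `y` to first order. -/
structure IsNormalAt (G : Coord n → Matrix (Fin n) (Fin n) ℝ) (y : Coord n) : Prop where
  one : G y = 1
  christoffel_eq : ∀ k i j, christoffel G k i j y = 0

/-- The pull-back of a metric by a smooth map with surjective differential is a metric. -/
lemma isIsometricMap_pullback (hG : IsMetricOn G V) (hφ : ContDiff ℝ ∞ φ) {W : Set (Coord n)}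
    (hW : IsOpen W) (hm : Set.MapsTo φ W V) (hs : ∀ z ∈ W, Function.Surjective (fderiv ℝ φ z)) :
    IsMetricOn (fun z => Matrix.of fun i j => ev2 (fun a c => G (φ z) a c)
      (fderiv ℝ φ z (stdVec i)) (fderiv ℝ φ z (stdVec j))) W ∧
    IsIsometricMap φ (fun z => Matrix.of fun i j => ev2 (fun a c => G (φ z) a c)
      (fderiv ℝ φ z (stdVec i)) (fderiv ℝ φ z (stdVec j))) W G V := by
  have hmet : ∀ z ∈ W, ∀ u v, ev2 (fun i j => ev2 (fun a c => G (φ z) a c)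
      (fderiv ℝ φ z (stdVec i)) (fderiv ℝ φ z (stdVec j))) u v
      = ev2 (fun a c => G (φ z) a c) (fderiv ℝ φ z u) (fderiv ℝ φ z v) := by
    intro z hz u v
    conv_rhs => rw [← sum_smul_stdVec u, ← sum_smul_stdVec v]
    rw [ev2_apply]
    simp only [map_sum, map_smul, sum_apply, smul_apply, smul_eq_mul, Finset.mul_sum, mul_assoc]
    rw [Finset.sum_comm]
    exact Finset.sum_congr rfl fun i _ => Finset.sum_congr rfl fun j _ => by ring
  have hsm : ContDiff ℝ ∞ (fderiv ℝ φ) := hφ.fderiv_right (by simp)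
  refine ⟨⟨hW, fun i j => ?_, fun z hz => ?_⟩, hφ.contDiffOn, hm, hs, hmet⟩
  · simp only [Matrix.of_apply, ev2_apply]
    have hc : ∀ a i, ContDiffOn ℝ ∞ (fun z => (fderiv ℝ φ z (stdVec i)) a) W := fun a i =>
      ((EuclideanSpace.proj (𝕜 := ℝ) a : Coord n →L[ℝ] ℝ).contDiff.comp
        (hsm.clm_apply contDiff_const)).contDiffOn
    refine ContDiffOn.sum fun a _ => ContDiffOn.sum fun c _ => ((hc a i).mul (hc c j)).mul ?_
    exact (hG.smooth a c).comp hφ.contDiffOn hm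
  · refine Matrix.PosDef.of_dotProduct_mulVec_pos ?_ fun x hx => ?_
    · ext i j
      simp only [Matrix.conjTranspose_apply, Matrix.of_apply, star_trivial]
      exact hG.ev2_symm (hm hz) _ _
    · have hinj : Function.Injective (fderiv ℝ φ z) :=
        (LinearMap.injective_iff_surjective (f := (fderiv ℝ φ z : Coord n →ₗ[ℝ] Coord n))).mpr
          (hs z hz)
      have h1 := ev2_eq_dotProduct (Matrix.of fun i j => ev2 (fun a c => G (φ z) a c)
        (fderiv ℝ φ z (stdVec i)) (fderiv ℝ φ z (stdVec j))) (WithLp.toLp 2 x) (WithLp.toLp 2 x)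
      have h2 := hmet z hz (WithLp.toLp 2 x) (WithLp.toLp 2 x)
      have h3 : fderiv ℝ φ z (WithLp.toLp 2 x) ≠ 0 := by
        intro h0
        have : (WithLp.toLp 2 x : Coord n) = 0 := hinj (by rw [h0, map_zero])
        exact hx (by simpa using this)
      have h4 := hG.ev2_pos (hm hz) h3
      rw [← h2] at h4
      simp only [star_trivial]
      exact lt_of_lt_of_eq h4 h1

/-- Around every point there are coordinates that are normal at the origin, given by the quadratic
map `z ↦ y + P z - Γ(P z, P z) / 2` where `P` maps the standard basis to an orthonormal frame. -/
lemma exists_normal (hG : IsMetricOn G V) (hy : y ∈ V) :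
    ∃ (φ : Coord n → Coord n) (G' : Coord n → Matrix (Fin n) (Fin n) ℝ) (W : Set (Coord n)),
      IsMetricOn G' W ∧ IsIsometricMap φ G' W G V ∧ (0 : Coord n) ∈ W ∧ φ 0 = y ∧
        IsNormalAt G' 0 := by
  obtain ⟨b, hb⟩ := exists_isFrame hG hy
  have hb' := (isFrame_iff hG hy b).mp hb
  set P : Coord n →L[ℝ] Coord n := ev b with hP
  have hPmet : ∀ u v, ev2 (fun i j => G y i j) (P u) (P v) = ∑ i, u i * v i := by
    intro u v
    simp only [hP, ev_apply, map_sum, map_smul, sum_apply, smul_apply, smul_eq_mul, hb']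
    simp [mul_comm]
  have hPinj : Function.Injective P := by
    rw [injective_iff_map_eq_zero]
    intro u hu
    have := hPmet u u
    rw [hu] at this
    simp only [map_zero] at this
    have h0 := (Finset.sum_eq_zero_iff_of_nonneg fun i _ => mul_self_nonneg (u i)).mp this.symm
    ext i
    exact mul_self_eq_zero.mp (h0 i (Finset.mem_univ i))
  have hPsurj : Function.Surjective P :=
    (LinearMap.injective_iff_surjective (f := (P : Coord n →ₗ[ℝ] Coord n))).mp hPinj
  set B : Coord n →L[ℝ] Coord n →L[ℝ] Coord n :=
    ev2 fun i j => chris G y (P (stdVec i)) (P (stdVec j)) with hB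
  have hBapp : ∀ u v, B u v = chris G y (P u) (P v) := by
    intro u v
    conv_rhs => rw [← sum_smul_stdVec u, ← sum_smul_stdVec v]
    simp only [hB, ev2, ev_apply, map_sum, map_smul, sum_apply, smul_apply, Finset.smul_sum]
    rw [Finset.sum_comm]
    exact Finset.sum_congr rfl fun i _ => Finset.sum_congr rfl fun j _ => smul_comm _ _ _
  have hBsymm : ∀ u v, B u v = B v u := by
    intro u v
    rw [hBapp, hBapp]
    ext k
    simp only [chris, ev2, ev_apply, sum_apply, smul_apply, WithLp.ofLp_sum, Finset.sum_apply,
      WithLp.ofLp_smul, Pi.smul_apply, smul_eq_mul, Finset.mul_sum]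
    rw [Finset.sum_comm]
    refine Finset.sum_congr rfl fun i _ => Finset.sum_congr rfl fun j _ => ?_
    rw [hG.christoffel_symm hy k j i]; ring
  -- the second derivative of `φ` is chosen to cancel the Christoffel symbols at the origin
  set φ : Coord n → Coord n := fun z => y + P z - (1 / 2 : ℝ) • B z z with hφ
  have hφs : ContDiff ℝ ∞ φ :=
    (contDiff_const.add P.contDiff).sub
      ((B.contDiff.clm_apply contDiff_id).const_smul (1 / 2 : ℝ))
  have hder : ∀ z, HasFDerivAt φ (P - B z) z := by
    intro z
    have h1 := (B.hasFDerivAt (x := z)).clm_apply (hasFDerivAt_id z)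
    have h2 := ((P.hasFDerivAt (x := z)).const_add y).sub (h1.const_smul (1 / 2 : ℝ))
    refine HasFDerivAt.congr_fderiv (f := φ) h2 ?_
    ext1 v
    simp only [sub_apply, smul_apply, add_apply, ContinuousLinearMap.comp_apply,
      ContinuousLinearMap.flip_apply, ContinuousLinearMap.id_apply, id]
    rw [hBsymm v z]
    module
  have hder1 : fderiv ℝ φ = fun z => P - B z := funext fun z => (hder z).fderiv
  have hder2 : ∀ z u v, fderiv ℝ (fderiv ℝ φ) z u v = - B u v := by
    intro z u v
    rw [hder1, fderiv_const_sub, ContinuousLinearMap.fderiv]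
    rfl
  have hφ0 : φ 0 = y := by simp [hφ]
  have hD0 : fderiv ℝ φ 0 = P := by rw [hder1]; simp
  set W : Set (Coord n) := φ ⁻¹' V ∩ {z | IsUnit (fderiv ℝ φ z)} with hW
  have hWo : IsOpen W := by
    refine (hG.isOpen.preimage hφs.continuous).inter ?_
    exact Units.isOpen.preimage (hφs.fderiv_right (m := ∞) (by simp)).continuous
  have hs : ∀ z ∈ W, Function.Surjective (fderiv ℝ φ z) := by
    intro z hz v
    obtain ⟨A, hA⟩ := hz.2
    refine ⟨(↑A⁻¹ : Coord n →L[ℝ] Coord n) v, ?_⟩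
    rw [← hA]
    exact congrArg (fun C : Coord n →L[ℝ] Coord n => C v) A.mul_inv
  have h0W : (0 : Coord n) ∈ W := by
    refine ⟨by simpa [hφ0] using hy, ?_⟩
    rw [Set.mem_ofPred_eq, hD0]
    exact ⟨(ContinuousLinearEquiv.toUnit
      (LinearEquiv.ofBijective (P : Coord n →ₗ[ℝ] Coord n) ⟨hPinj, hPsurj⟩).toContinuousLinearEquiv),
      by ext v; rfl⟩
  obtain ⟨h1, h2⟩ := isIsometricMap_pullback hG hφs hWo (fun z hz => hz.1) hs
  refine ⟨φ, _, W, h1, h2, h0W, hφ0, ?_, ?_⟩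
  · ext i j
    simp only [Matrix.of_apply, hφ0, hD0, hPmet, Matrix.one_apply]
    simp [eq_comm]
  · intro k i j
    have h3 := h2.fderiv_chris h1 hG h0W (stdVec i) (stdVec j)
    rw [hder2, hφ0, hD0, hBapp, neg_add_cancel] at h3
    have h4 := hPinj (h3.trans (map_zero P).symm)
    rw [← chris_single, h4]
    rfl

/-- The divergence `g^ij ∇_i α_j` of a `1`-form. -/
def coordDiv (G : Coord n → Matrix (Fin n) (Fin n) ℝ) (α : Fin n → Coord n → ℝ) (y : Coord n) : ℝ :=
  ∑ i, ∑ j, (G y)⁻¹ i j * cov1 G α i j y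

/-- Naturality of the divergence. -/
lemma IsIsometricMap.coordDiv_eq (hφ : IsIsometricMap φ G V G' V') (hG : IsMetricOn G V)
    (hG' : IsMetricOn G' V') (hy : y ∈ V) {α α' : Fin n → Coord n → ℝ}
    (hα : ∀ j, DifferentiableAt ℝ (α j) y) (hα' : ∀ j, DifferentiableAt ℝ (α' j) (φ y))
    (h : ∀ z ∈ V, ∀ v, ev (fun j => α j z) v = ev (fun j => α' j (φ z)) (fderiv ℝ φ z v)) :
    coordDiv G α y = coordDiv G' α' (φ y) := by
  obtain ⟨b, hb⟩ := exists_isFrame hG hy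
  have hb' : IsFrame (fun i j => (G' (φ y))⁻¹ i j) fun a => fderiv ℝ φ y (b a) := by
    refine (isFrame_iff hG' (hφ.mapsTo hy) _).mpr fun a c => ?_
    rw [← hφ.metric y hy]
    exact (isFrame_iff hG hy b).mp hb a c
  have e1 := contract_frame (J := coordJet G (fun _ => 0) y) hb fun i j => cov1 G α i j y
  have e2 := contract_frame (J := coordJet G' (fun _ => 0) (φ y)) hb'
    fun i j => cov1 G' α' i j (φ y)
  refine e1.trans (Eq.trans ?_ e2.symm)
  simp only [hφ.cov1_eq hG hG' hy hα hα' h]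

end Normal

/-! ### Smoothness of the integrands -/

namespace Jet

variable {n : ℕ}

lemma contDiff_gradUp (i : Fin n) : ContDiff ℝ ∞ fun J : Jet n => J.gradUp i := by
  unfold gradUp; fun_prop

lemma contDiff_hessMixed (i j : Fin n) : ContDiff ℝ ∞ fun J : Jet n => J.hessMixed i j := by
  unfold hessMixed; fun_prop

lemma contDiff_hessUp (i j : Fin n) : ContDiff ℝ ∞ fun J : Jet n => J.hessUp i j := by
  unfold hessUp; fun_prop

lemma contDiff_thirdUp (k i j : Fin n) : ContDiff ℝ ∞ fun J : Jet n => J.thirdUp k i j := by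
  unfold thirdUp; fun_prop

lemma contDiff_lapGradUp (i : Fin n) : ContDiff ℝ ∞ fun J : Jet n => J.lapGradUp i := by
  unfold lapGradUp; fun_prop

lemma contDiff_tensorNormSq {E : Type*} [NormedAddCommGroup E] [NormedSpace ℝ E]
    {A : E → Fin n → Fin n → ℝ} {r : ℕ} {T : E → (Fin r → Fin n) → ℝ}
    (hA : ∀ i j, ContDiff ℝ ∞ fun x => A x i j) (hT : ∀ a, ContDiff ℝ ∞ fun x => T x a) :
    ContDiff ℝ ∞ fun x => tensorNormSq (Matrix.of (A x)) (T x) := by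
  unfold tensorNormSq
  refine ContDiff.sum fun a _ => ContDiff.sum fun b _ => ContDiff.mul (ContDiff.mul ?_ (hT a)) (hT b)
  exact contDiff_prod fun s _ => hA _ _

lemma contDiff_gradSq : ContDiff ℝ ∞ fun J : Jet n => J.gradSq :=
  contDiff_tensorNormSq (by fun_prop) (by fun_prop)

lemma contDiff_hessSq : ContDiff ℝ ∞ fun J : Jet n => J.hessSq :=
  contDiff_tensorNormSq (by fun_prop) (by fun_prop)

lemma contDiff_thirdSq : ContDiff ℝ ∞ fun J : Jet n => J.thirdSq :=
  contDiff_tensorNormSq (by fun_prop) (by fun_prop)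

lemma contDiff_riemSq : ContDiff ℝ ∞ fun J : Jet n => J.riemSq :=
  contDiff_tensorNormSq (by fun_prop) (by fun_prop)

lemma contDiff_ricSq : ContDiff ℝ ∞ fun J : Jet n => J.ricSq :=
  contDiff_tensorNormSq (by fun_prop) (by fun_prop)

lemma contDiff_ricGradLapGrad : ContDiff ℝ ∞ fun J : Jet n => J.ricGradLapGrad := by
  have := contDiff_gradUp (n := n)
  have := contDiff_lapGradUp (n := n)
  unfold ricGradLapGrad; fun_prop

lemma contDiff_ricSqGradGrad : ContDiff ℝ ∞ fun J : Jet n => J.ricSqGradGrad := by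
  have := contDiff_gradUp (n := n)
  unfold ricSqGradGrad; fun_prop

lemma contDiff_ricHessHess : ContDiff ℝ ∞ fun J : Jet n => J.ricHessHess := by
  have := contDiff_hessMixed (n := n)
  unfold ricHessHess; fun_prop

lemma contDiff_riemThirdGrad : ContDiff ℝ ∞ fun J : Jet n => J.riemThirdGrad := by
  have := contDiff_gradUp (n := n)
  have := contDiff_thirdUp (n := n)
  unfold riemThirdGrad; fun_prop

lemma contDiff_riemHessHess : ContDiff ℝ ∞ fun J : Jet n => J.riemHessHess := by
  have := contDiff_hessUp (n := n)
  unfold riemHessHess; fun_prop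

lemma contDiff_thirdHess (l : Fin n) : ContDiff ℝ ∞ fun J : Jet n => J.thirdHess l := by
  have := contDiff_hessUp (n := n)
  unfold thirdHess; fun_prop

lemma contDiff_hessLapGrad (l : Fin n) : ContDiff ℝ ∞ fun J : Jet n => J.hessLapGrad l := by
  have := contDiff_lapGradUp (n := n)
  unfold hessLapGrad; fun_prop

lemma contDiff_hessGrad (l : Fin n) : ContDiff ℝ ∞ fun J : Jet n => J.hessGrad l := by
  have := contDiff_gradUp (n := n)
  unfold hessGrad; fun_prop

end Jet

section

variable {n : ℕ} {G : Coord n → Matrix (Fin n) (Fin n) ℝ} {V : Set (Coord n)} {y : Coord n}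
  {f : Coord n → ℝ}

lemma contDiffOn_coordJet (hG : IsMetricOn G V) (hf : ContDiffOn ℝ ∞ f V) :
    ContDiffOn ℝ ∞ (coordJet G f) V := by
  refine ContDiffOn.prodMk ?_ (ContDiffOn.prodMk ?_ (ContDiffOn.prodMk ?_ (ContDiffOn.prodMk ?_
    (ContDiffOn.prodMk ?_ ?_))))
  · exact contDiffOn_pi.mpr fun i => contDiffOn_pi.mpr fun j => hG.smooth_inv i j
  · exact contDiffOn_pi.mpr fun i => contDiffOn_pd hG.isOpen hf i
  · exact contDiffOn_pi.mpr fun i => contDiffOn_pi.mpr fun j => hG.smooth_hess hf i j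
  · exact contDiffOn_pi.mpr fun i => contDiffOn_pi.mpr fun j => contDiffOn_pi.mpr fun k =>
      hG.smooth_third hf i j k
  · exact contDiffOn_pi.mpr fun i => contDiffOn_pi.mpr fun j => contDiffOn_pi.mpr fun k =>
      contDiffOn_pi.mpr fun l => hG.smooth_riem i j k l
  · exact contDiffOn_pi.mpr fun i => contDiffOn_pi.mpr fun j => hG.smooth_ric i j

lemma ContDiff.comp_jet {F : Jet n → ℝ} (hF : ContDiff ℝ ∞ F) (hG : IsMetricOn G V)
    (hf : ContDiffOn ℝ ∞ f V) : ContDiffOn ℝ ∞ (fun z => F (coordJet G f z)) V :=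
  hF.comp_contDiffOn (contDiffOn_coordJet hG hf)

end

/-! ### The pointwise identities at the origin of normal coordinates -/

section

variable {n : ℕ} {G : Coord n → Matrix (Fin n) (Fin n) ℝ} {V : Set (Coord n)} {y : Coord n}
  {f : Coord n → ℝ}

lemma coordRiemMixed_antisymm (i j k l : Fin n) :
    coordRiemMixed G i j k l y = - coordRiemMixed G j i k l y := by
  unfold coordRiemMixed
  rw [neg_add, neg_sub, ← Finset.sum_neg_distrib]
  simp only [neg_sub]

namespace IsNormalAt

lemma inv_eq (hN : IsNormalAt G y) (i j : Fin n) : (G y)⁻¹ i j = if i = j then 1 else 0 := by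
  rw [hN.one, inv_one, Matrix.one_apply]

lemma isFrame (hN : IsNormalAt G y) : IsFrame (coordJet G f y).A stdVec := by
  intro i j
  change (G y)⁻¹ i j = _
  rw [hN.inv_eq]
  simp

lemma pd_metric (hN : IsNormalAt G y) (hG : IsMetricOn G V) (hy : y ∈ V) (i j k : Fin n) :
    pd (fun z => G z i j) k y = 0 := by
  simp [hG.pd_eq hy, hN.christoffel_eq]

lemma pd_inv (hN : IsNormalAt G y) (hG : IsMetricOn G V) (hy : y ∈ V) (i j k : Fin n) :
    pd (fun z => (G z)⁻¹ i j) k y = 0 := by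
  have h1 : pd (fun z => ∑ m, (G z)⁻¹ i m * G z m j) k y
      = pd (fun _ => if i = j then 1 else 0) k y := by
    refine pd_congr_of_eqOn hG.isOpen (fun z hz => ?_) hy k
    have := Matrix.nonsing_inv_mul (G z) (hG.isUnit_det hz)
    simpa [Matrix.mul_apply, Matrix.one_apply] using congrFun (congrFun this i) j
  have hd : ∀ a b, DifferentiableAt ℝ (fun z => (G z)⁻¹ a b) y := fun a b =>
    (hG.smooth_inv a b).diffAt hG.isOpen hy
  have hd' : ∀ a b, DifferentiableAt ℝ (fun z => G z a b) y := fun a b =>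
    (hG.smooth a b).diffAt hG.isOpen hy
  rw [pd_sum (fun m _ => (hd i m).fun_mul (hd' m j)), pd_const] at h1
  simp only [pd_mul (hd i _) (hd' _ j), hN.pd_metric hG hy, hN.one, Matrix.one_apply] at h1
  simpa using h1

lemma pd_up (hN : IsNormalAt G y) (hG : IsMetricOn G V) (hy : y ∈ V) {β : Fin n → Coord n → ℝ}
    (hβ : ∀ j, ContDiffOn ℝ ∞ (β j) V) (i k : Fin n) :
    pd (fun z => ∑ j, (G z)⁻¹ i j * β j z) k y = pd (β i) k y := by
  have hd : ∀ a b, DifferentiableAt ℝ (fun z => (G z)⁻¹ a b) y := fun a b =>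
    (hG.smooth_inv a b).diffAt hG.isOpen hy
  have hβ' := fun j => (hβ j).diffAt hG.isOpen hy
  rw [pd_sum (fun m _ => (hd i m).fun_mul (hβ' m))]
  simp only [pd_mul (hd i _) (hβ' _), hN.pd_inv hG hy, hN.inv_eq]
  simp

lemma smooth_up (hG : IsMetricOn G V) {β : Fin n → Coord n → ℝ}
    (hβ : ∀ j, ContDiffOn ℝ ∞ (β j) V) (i : Fin n) :
    ContDiffOn ℝ ∞ (fun z => ∑ j, (G z)⁻¹ i j * β j z) V :=
  ContDiffOn.sum fun j _ => (hG.smooth_inv i j).mul (hβ j)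

lemma pd_trace (hN : IsNormalAt G y) (hG : IsMetricOn G V) (hy : y ∈ V)
    {β : Fin n → Fin n → Coord n → ℝ} (hβ : ∀ i j, ContDiffOn ℝ ∞ (β i j) V) (k : Fin n) :
    pd (fun z => ∑ i, ∑ j, (G z)⁻¹ i j * β i j z) k y = ∑ i, pd (β i i) k y := by
  rw [pd_sum (fun i _ => (smooth_up hG (hβ i) i).diffAt hG.isOpen hy)]
  exact Finset.sum_congr rfl fun i _ => hN.pd_up hG hy (hβ i) i k

lemma coordDiv_eq (hN : IsNormalAt G y) (α : Fin n → Coord n → ℝ) :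
    coordDiv G α y = ∑ l, pd (α l) l y := by
  simp [coordDiv, hN.inv_eq, cov1, hN.christoffel_eq]

lemma hess_eq (hN : IsNormalAt G y) (i j : Fin n) : coordHess G f i j y = pd (pd f j) i y := by
  simp [coordHess, hN.christoffel_eq]

lemma third_eq (hN : IsNormalAt G y) (k i j : Fin n) :
    coordThird G f k i j y = pd (coordHess G f i j) k y := by
  simp [coordThird, hN.christoffel_eq]

lemma riemMixed_eq (hN : IsNormalAt G y) (i j k l : Fin n) : coordRiemMixed G i j k l y
    = pd (christoffel G l j k) i y - pd (christoffel G l i k) j y := by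
  simp [coordRiemMixed, hN.christoffel_eq]

lemma riem_eq (hN : IsNormalAt G y) (i j k l : Fin n) :
    coordRiem G i j k l y = coordRiemMixed G i j k l y := by
  simp [coordRiem, hN.one, Matrix.one_apply]

lemma ric_eq (hN : IsNormalAt G y) (i l : Fin n) :
    coordRic G i l y = ∑ j, coordRiemMixed G i j j l y := by
  simp [coordRic, hN.inv_eq, hN.riem_eq]

lemma pd_christoffel (hN : IsNormalAt G y) (hG : IsMetricOn G V) (hy : y ∈ V) (k i j l : Fin n) :
    pd (christoffel G k i j) l y = (1 / 2) * (pd (pd (fun z => G z j k) i) l y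
      + pd (pd (fun z => G z i k) j) l y - pd (pd (fun z => G z i j) k) l y) := by
  have hs : ∀ a b c, ContDiffOn ℝ ∞ (pd (fun z => G z a b) c) V := fun a b c =>
    contDiffOn_pd hG.isOpen (hG.smooth a b) c
  have hd : ∀ a b c, DifferentiableAt ℝ (pd (fun z => G z a b) c) y := fun a b c =>
    (hs a b c).diffAt hG.isOpen hy
  have hs' : ∀ m, ContDiffOn ℝ ∞ (fun z => pd (fun z => G z j m) i z + pd (fun z => G z i m) j z
      - pd (fun z => G z i j) m z) V := fun m => ((hs _ _ _).add (hs _ _ _)).sub (hs _ _ _)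
  unfold christoffel
  rw [pd_const_mul _ ((smooth_up hG hs' k).diffAt hG.isOpen hy), hN.pd_up hG hy hs',
    pd_sub ((hd _ _ _).fun_add (hd _ _ _)) (hd _ _ _), pd_add (hd _ _ _) (hd _ _ _)]

lemma ric_symm (hN : IsNormalAt G y) (hG : IsMetricOn G V) (hy : y ∈ V) (i l : Fin n) :
    coordRic G i l y = coordRic G l i y := by
  have hc : ∀ a b c d, pd (pd (fun z => G z a b) c) d y = pd (pd (fun z => G z a b) d) c y :=
    fun a b c d => pd_comm hG.isOpen (hG.smooth a b) hy c d
  have hsym : ∀ a b c d, pd (pd (fun z => G z a b) c) d y = pd (pd (fun z => G z b a) c) d y :=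
    fun a b c d => pd_congr_of_eqOn hG.isOpen (fun z hz => hG.pd_symm hz a b c) hy d
  rw [hN.ric_eq, hN.ric_eq]
  refine Finset.sum_congr rfl fun j _ => ?_
  simp only [hN.riemMixed_eq, hN.pd_christoffel hG hy]
  linarith [hc j l j i, hc j j l i, hsym i l j j, hsym i j l j, hsym l j i j, hc j i j l]

lemma pd_gradUp (hN : IsNormalAt G y) (hG : IsMetricOn G V) (hf : ContDiffOn ℝ ∞ f V) (hy : y ∈ V)
    (i k : Fin n) : pd (fun z => (coordJet G f z).gradUp i) k y = coordHess G f k i y := by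
  rw [hN.hess_eq]
  exact hN.pd_up hG hy (contDiffOn_pd hG.isOpen hf) i k

lemma pd_hessUp (hN : IsNormalAt G y) (hG : IsMetricOn G V) (hf : ContDiffOn ℝ ∞ f V) (hy : y ∈ V)
    (i j k : Fin n) : pd (fun z => (coordJet G f z).hessUp i j) k y = coordThird G f k i j y := by
  have h : ∀ z, (coordJet G f z).hessUp i j
      = ∑ a, (G z)⁻¹ i a * ∑ b, (G z)⁻¹ j b * coordHess G f a b z := by
    intro z
    simp only [Jet.hessUp, Finset.mul_sum, mul_assoc]
    rfl
  simp only [h]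
  rw [hN.pd_up hG hy fun a => smooth_up hG (hG.smooth_hess hf a) j,
    hN.pd_up hG hy (hG.smooth_hess hf i), hN.third_eq]

lemma pd_lapGradUp (hN : IsNormalAt G y) (hG : IsMetricOn G V) (hf : ContDiffOn ℝ ∞ f V)
    (hy : y ∈ V) (j m : Fin n) : pd (fun z => (coordJet G f z).lapGradUp j) m y
      = ∑ k, pd (coordThird G f k k j) m y := by
  have h : ∀ z, (coordJet G f z).lapGradUp j
      = ∑ l, (G z)⁻¹ j l * ∑ k, ∑ i, (G z)⁻¹ k i * coordThird G f k i l z := by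
    intro z
    simp only [Jet.lapGradUp, Finset.mul_sum, mul_assoc]
    rfl
  simp only [h]
  rw [hN.pd_up hG hy fun l => ContDiffOn.sum fun k _ => smooth_up hG (fun i =>
    hG.smooth_third hf k i l) k, hN.pd_trace hG hy fun k i => hG.smooth_third hf k i j]

lemma hessUp_eq (hN : IsNormalAt G y) (i j : Fin n) :
    (coordJet G f y).hessUp i j = coordHess G f i j y := by
  change ∑ k, ∑ l, (G y)⁻¹ i k * (G y)⁻¹ j l * coordHess G f k l y = _
  simp [hN.inv_eq]

lemma gradUp_eq (hN : IsNormalAt G y) (i : Fin n) :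
    (coordJet G f y).gradUp i = pd f i y := by
  change ∑ k, (G y)⁻¹ i k * pd f k y = _
  simp [hN.inv_eq]

lemma lapGradUp_eq (hN : IsNormalAt G y) (i : Fin n) :
    (coordJet G f y).lapGradUp i = ∑ k, coordThird G f k k i y := by
  change ∑ l, ∑ k, ∑ j, (G y)⁻¹ i l * (G y)⁻¹ k j * coordThird G f k j l y = _
  simp [hN.inv_eq]

/-- `∇_i u` commuted with the Laplacian: the Bochner formula for the gradient. -/
lemma lapGrad_bochner (hN : IsNormalAt G y) (hG : IsMetricOn G V) (hf : ContDiffOn ℝ ∞ f V)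
    (hy : y ∈ V) (i : Fin n) : ∑ k, coordThird G f k k i y
      = pd (fun z => (coordJet G f z).lap) i y + ∑ r, coordRic G i r y * pd f r y := by
  have h1 : pd (fun z => (coordJet G f z).lap) i y = ∑ k, coordThird G f i k k y := by
    simp only [hN.third_eq]
    exact hN.pd_trace hG hy (fun a b => hG.smooth_hess hf a b) i
  have h2 : ∑ r, coordRic G i r y * pd f r y = ∑ k, ∑ r, coordRiemMixed G i k k r y * pd f r y := by
    simp only [hN.ric_eq, Finset.sum_mul]
    exact Finset.sum_comm
  rw [h1, h2, ← Finset.sum_add_distrib]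
  refine Finset.sum_congr rfl fun k _ => ?_
  have h3 := hG.ricci_identity hf hy k i k
  rw [hG.third_symm hf hy k k i]
  simp only [coordRiemMixed_antisymm i k, neg_mul, Finset.sum_neg_distrib]
  linarith

/-- The commutator of two covariant derivatives of the Hessian. -/
lemma third_commutator (hN : IsNormalAt G y) (hG : IsMetricOn G V) (hf : ContDiffOn ℝ ∞ f V)
    (hy : y ∈ V) (p i l : Fin n) :
    pd (coordThird G f p l i) l y = pd (coordThird G f l l i) p y
      - ∑ r, (coordRiemMixed G l p l r y * coordHess G f r i y
          + coordRiemMixed G l p i r y * coordHess G f l r y) := by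
  have hΓ : ∀ a b c, DifferentiableAt ℝ (christoffel G a b c) y := fun a b c =>
    (hG.smooth_christoffel a b c).diffAt hG.isOpen hy
  have hH : ∀ a b, DifferentiableAt ℝ (coordHess G f a b) y := fun a b =>
    (hG.smooth_hess hf a b).diffAt hG.isOpen hy
  have hH' : ∀ a b c, DifferentiableAt ℝ (pd (coordHess G f a b) c) y := fun a b c =>
    (contDiffOn_pd hG.isOpen (hG.smooth_hess hf a b) c).diffAt hG.isOpen hy
  have key : ∀ a b c d, pd (coordThird G f a b c) d y = pd (pd (coordHess G f b c) a) d y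
      - ∑ r, (pd (christoffel G r a b) d y * coordHess G f r c y
          + pd (christoffel G r a c) d y * coordHess G f b r y) := by
    intro a b c d
    have hs : ∀ r, DifferentiableAt ℝ (fun z => christoffel G r a b z * coordHess G f r c z
        + christoffel G r a c z * coordHess G f b r z) y := fun r =>
      ((hΓ _ _ _).mul (hH _ _)).add ((hΓ _ _ _).mul (hH _ _))
    unfold coordThird
    rw [pd_sub (hH' b c a) (DifferentiableAt.fun_sum fun r _ => hs r), pd_sum fun r _ => hs r]
    congr 1
    refine Finset.sum_congr rfl fun r _ => ?_
    rw [pd_add ((hΓ _ _ _).fun_mul (hH _ _)) ((hΓ _ _ _).fun_mul (hH _ _)),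
      pd_mul (hΓ _ _ _) (hH _ _), pd_mul (hΓ _ _ _) (hH _ _)]
    simp [hN.christoffel_eq]
  rw [key, key, pd_comm hG.isOpen (hG.smooth_hess hf l i) hy p l, sub_sub, ← Finset.sum_add_distrib]
  congr 1
  refine Finset.sum_congr rfl fun r _ => ?_
  rw [hN.riemMixed_eq, hN.riemMixed_eq]
  ring

lemma pd_thirdHess (hN : IsNormalAt G y) (hG : IsMetricOn G V) (hf : ContDiffOn ℝ ∞ f V)
    (hy : y ∈ V) (l : Fin n) : pd (fun z => (coordJet G f z).thirdHess l) l y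
      = ∑ p, ∑ i, (coordThird G f l p i y * coordThird G f p i l y
          + coordHess G f p i y * pd (coordThird G f p i l) l y) := by
  have h1 : ∀ p i, DifferentiableAt ℝ (fun z => (coordJet G f z).hessUp p i) y := fun p i =>
    (ContDiff.comp_jet (Jet.contDiff_hessUp p i) hG hf).diffAt hG.isOpen hy
  have h2 : ∀ p i, DifferentiableAt ℝ (coordThird G f p i l) y := fun p i =>
    (hG.smooth_third hf p i l).diffAt hG.isOpen hy
  change pd (fun z => ∑ p, ∑ i, (coordJet G f z).hessUp p i * coordThird G f p i l z) l y = _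
  rw [pd_sum fun p _ => DifferentiableAt.fun_sum fun i _ => (h1 p i).fun_mul (h2 p i)]
  refine Finset.sum_congr rfl fun p _ => ?_
  rw [pd_sum fun i _ => (h1 p i).fun_mul (h2 p i)]
  refine Finset.sum_congr rfl fun i _ => ?_
  rw [pd_mul (h1 p i) (h2 p i), hN.pd_hessUp hG hf hy, hN.hessUp_eq]

lemma pd_hessLapGrad (hN : IsNormalAt G y) (hG : IsMetricOn G V) (hf : ContDiffOn ℝ ∞ f V)
    (hy : y ∈ V) (l : Fin n) : pd (fun z => (coordJet G f z).hessLapGrad l) l y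
      = ∑ i, (coordThird G f l i l y * ∑ k, coordThird G f k k i y
          + coordHess G f i l y * ∑ k, pd (coordThird G f k k i) l y) := by
  have h1 : ∀ i, DifferentiableAt ℝ (fun z => (coordJet G f z).lapGradUp i) y := fun i =>
    (ContDiff.comp_jet (Jet.contDiff_lapGradUp i) hG hf).diffAt hG.isOpen hy
  have h2 : ∀ i, DifferentiableAt ℝ (coordHess G f i l) y := fun i =>
    (hG.smooth_hess hf i l).diffAt hG.isOpen hy
  change pd (fun z => ∑ i, coordHess G f i l z * (coordJet G f z).lapGradUp i) l y = _
  rw [pd_sum fun i _ => (h2 i).fun_mul (h1 i)]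
  refine Finset.sum_congr rfl fun i _ => ?_
  rw [pd_mul (h2 i) (h1 i), hN.pd_lapGradUp hG hf hy, hN.lapGradUp_eq, hN.third_eq]

lemma pd_hessGrad (hN : IsNormalAt G y) (hG : IsMetricOn G V) (hf : ContDiffOn ℝ ∞ f V)
    (hy : y ∈ V) (l k : Fin n) : pd (fun z => (coordJet G f z).hessGrad l) k y
      = ∑ i, (coordThird G f k i l y * pd f i y + coordHess G f i l y * coordHess G f k i y) := by
  have h1 : ∀ i, DifferentiableAt ℝ (fun z => (coordJet G f z).gradUp i) y := fun i =>
    (ContDiff.comp_jet (Jet.contDiff_gradUp i) hG hf).diffAt hG.isOpen hy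
  have h2 : ∀ i, DifferentiableAt ℝ (coordHess G f i l) y := fun i =>
    (hG.smooth_hess hf i l).diffAt hG.isOpen hy
  change pd (fun z => ∑ i, coordHess G f i l z * (coordJet G f z).gradUp i) k y = _
  rw [pd_sum fun i _ => (h2 i).fun_mul (h1 i)]
  refine Finset.sum_congr rfl fun i _ => ?_
  rw [pd_mul (h2 i) (h1 i), hN.pd_gradUp hG hf hy, hN.gradUp_eq, hN.third_eq]

lemma pd_hessSq (hN : IsNormalAt G y) (hG : IsMetricOn G V) (hf : ContDiffOn ℝ ∞ f V)
    (hy : y ∈ V) (k : Fin n) : pd (fun z => (coordJet G f z).hessSq) k y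
      = ∑ p, ∑ i, 2 * coordHess G f p i y * coordThird G f k p i y := by
  have h1 : ∀ p i, DifferentiableAt ℝ (fun z => (coordJet G f z).hessUp p i) y := fun p i =>
    (ContDiff.comp_jet (Jet.contDiff_hessUp p i) hG hf).diffAt hG.isOpen hy
  have h2 : ∀ p i, DifferentiableAt ℝ (coordHess G f p i) y := fun p i =>
    (hG.smooth_hess hf p i).diffAt hG.isOpen hy
  have h3 : ∀ z, (coordJet G f z).hessSq
      = ∑ p, ∑ i, (coordJet G f z).hessUp p i * coordHess G f p i z := by
    intro z
    simp only [Jet.hessSq, tensorNormSq, sum_pi_succ, Finset.univ_unique, Finset.sum_singleton,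
      Jet.hessUp, Finset.sum_mul]
    refine Finset.sum_congr rfl fun p _ => Finset.sum_congr rfl fun i _ =>
      Finset.sum_congr rfl fun a _ => Finset.sum_congr rfl fun b _ => ?_
    simp only [Fin.prod_univ_two, Matrix.of_apply]
    change (coordJet G f z).A p a * (coordJet G f z).A i b * coordHess G f p i z
      * coordHess G f a b z = _ * coordHess G f a b z * coordHess G f p i z
    ring
  simp only [h3]
  rw [pd_sum fun p _ => DifferentiableAt.fun_sum fun i _ => (h1 p i).fun_mul (h2 p i)]
  refine Finset.sum_congr rfl fun p _ => ?_
  rw [pd_sum fun i _ => (h1 p i).fun_mul (h2 p i)]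
  refine Finset.sum_congr rfl fun i _ => ?_
  rw [pd_mul (h1 p i) (h2 p i), hN.pd_hessUp hG hf hy, hN.hessUp_eq, hN.third_eq]
  ring

end IsNormalAt

end

/-! ### Pointwise inequalities -/

section CauchySchwarz

variable {n : ℕ}

lemma sq_sum_two_le (a b : Fin n → Fin n → ℝ) :
    (∑ i, ∑ j, a i j * b i j) ^ 2 ≤ (∑ i, ∑ j, a i j ^ 2) * ∑ i, ∑ j, b i j ^ 2 := by
  simp only [← Fintype.sum_prod_type' (f := fun i j => a i j * b i j),
    ← Fintype.sum_prod_type' (f := fun i j => a i j ^ 2),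
    ← Fintype.sum_prod_type' (f := fun i j => b i j ^ 2)]
  exact Finset.sum_mul_sq_le_sq_mul_sq _ _ _

lemma sq_sum_four_le (a b : Fin n → Fin n → Fin n → Fin n → ℝ) :
    (∑ i, ∑ j, ∑ k, ∑ l, a i j k l * b i j k l) ^ 2
      ≤ (∑ i, ∑ j, ∑ k, ∑ l, a i j k l ^ 2) * ∑ i, ∑ j, ∑ k, ∑ l, b i j k l ^ 2 := by
  have h : ∀ F : Fin n → Fin n → Fin n → Fin n → ℝ, ∑ i, ∑ j, ∑ k, ∑ l, F i j k l
      = ∑ x : Fin n × Fin n × Fin n × Fin n, F x.1 x.2.1 x.2.2.1 x.2.2.2 := by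
    intro F
    simp only [Fintype.sum_prod_type]
  simp only [h]
  exact Finset.sum_mul_sq_le_sq_mul_sq _ _ _

lemma sum_rot_four (F : Fin n → Fin n → Fin n → Fin n → ℝ) :
    ∑ r, ∑ m, ∑ p, ∑ j, F r m p j = ∑ m, ∑ p, ∑ j, ∑ r, F r m p j := by
  rw [Finset.sum_comm]
  refine Finset.sum_congr rfl fun m _ => ?_
  rw [Finset.sum_comm]
  refine Finset.sum_congr rfl fun p _ => ?_
  rw [Finset.sum_comm]

variable {J : Jet n} {b : Fin n → Coord n}

lemma Jet.gradSq_nonneg (hb : IsFrame J.A b) : 0 ≤ J.gradSq := by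
  rw [Jet.gradSq_frame hb]; positivity

lemma Jet.hessSq_nonneg (hb : IsFrame J.A b) : 0 ≤ J.hessSq := by
  rw [Jet.hessSq_frame hb]; positivity

lemma Jet.thirdSq_nonneg (hb : IsFrame J.A b) : 0 ≤ J.thirdSq := by
  rw [Jet.thirdSq_frame hb]; positivity

lemma Jet.riemSq_nonneg (hb : IsFrame J.A b) : 0 ≤ J.riemSq := by
  rw [Jet.riemSq_frame hb]; positivity

lemma Jet.ricSq_nonneg (hb : IsFrame J.A b) : 0 ≤ J.ricSq := by
  rw [Jet.ricSq_frame hb]; positivity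

lemma abs_le_sqrt_mul_three {x a b c : ℝ} (ha : 0 ≤ a) (hb : 0 ≤ b) (h : x ^ 2 ≤ a * b * c) :
    |x| ≤ √a * √b * √c := by
  rw [← Real.sqrt_mul ha, ← Real.sqrt_mul (mul_nonneg ha hb)]
  exact Real.abs_le_sqrt h

lemma Jet.ricSqGradGrad_le (hb : IsFrame J.A b) : J.ricSqGradGrad ≤ J.ricSq * J.gradSq := by
  rw [Jet.ricSqGradGrad_frame hb, Jet.ricSq_frame hb, Jet.gradSq_frame hb, Finset.sum_mul]
  exact Finset.sum_le_sum fun a _ => Finset.sum_mul_sq_le_sq_mul_sq _ _ _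

lemma Jet.abs_riemThirdGrad_le (hb : IsFrame J.A b) :
    |J.riemThirdGrad| ≤ √J.riemSq * √J.thirdSq * √J.gradSq := by
  refine abs_le_sqrt_mul_three (Jet.riemSq_nonneg hb) (Jet.thirdSq_nonneg hb) ?_
  have h1 : J.riemThirdGrad = ∑ r, ∑ m, ∑ p, ∑ j,
      ev4 J.R (b p) (b m) (b j) (b r) * (ev3 J.T (b m) (b p) (b j) * ev J.D (b r)) := by
    rw [Jet.riemThirdGrad_frame hb]
    simp only [mul_assoc]
  have h2 : J.riemSq = ∑ r, ∑ m, ∑ p, ∑ j, ev4 J.R (b p) (b m) (b j) (b r) ^ 2 := by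
    rw [Jet.riemSq_frame hb, sum_rot_four (n := n)
      (fun r m p j => ev4 J.R (b p) (b m) (b j) (b r) ^ 2), Finset.sum_comm]
  have h3 : J.thirdSq * J.gradSq
      = ∑ r, ∑ m, ∑ p, ∑ j, (ev3 J.T (b m) (b p) (b j) * ev J.D (b r)) ^ 2 := by
    rw [Jet.thirdSq_frame hb, Jet.gradSq_frame hb, Finset.mul_sum]
    simp only [Finset.sum_mul, mul_pow]
  rw [mul_assoc, h1, h2, h3]
  exact sq_sum_four_le _ _

lemma Jet.abs_riemHessHess_le (hb : IsFrame J.A b) :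
    |J.riemHessHess| ≤ √J.riemSq * J.hessSq := by
  rw [← Real.mul_self_sqrt (Jet.hessSq_nonneg hb), ← mul_assoc]
  refine abs_le_sqrt_mul_three (Jet.riemSq_nonneg hb) (Jet.hessSq_nonneg hb) ?_
  have h1 : J.riemHessHess = ∑ p, ∑ j, ∑ l, ∑ r,
      ev4 J.R (b p) (b l) (b j) (b r) * (ev2 J.H (b l) (b r) * ev2 J.H (b p) (b j)) := by
    rw [Jet.riemHessHess_frame hb]
    simp only [mul_assoc]
  have h2 : J.riemSq = ∑ p, ∑ j, ∑ l, ∑ r, ev4 J.R (b p) (b l) (b j) (b r) ^ 2 := by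
    rw [Jet.riemSq_frame hb]
    exact Finset.sum_congr rfl fun p _ => Finset.sum_comm
  have h3 : J.hessSq * J.hessSq
      = ∑ p, ∑ j, ∑ l, ∑ r, (ev2 J.H (b l) (b r) * ev2 J.H (b p) (b j)) ^ 2 := by
    rw [Jet.hessSq_frame hb]
    simp only [mul_pow, ← Finset.sum_mul, ← Finset.mul_sum]
  rw [mul_assoc, h1, h2, h3]
  exact sq_sum_four_le _ _

lemma Jet.abs_ricHessHess_le (hb : IsFrame J.A b) :
    |J.ricHessHess| ≤ √J.ricSq * J.hessSq := by
  rw [← Real.mul_self_sqrt (Jet.hessSq_nonneg hb), ← mul_assoc]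
  refine abs_le_sqrt_mul_three (Jet.ricSq_nonneg hb) (Jet.hessSq_nonneg hb) ?_
  have h1 : J.ricHessHess = ∑ a, ∑ e,
      (∑ c, ev2 J.Rc (b a) (b c) * ev2 J.H (b c) (b e)) * ev2 J.H (b a) (b e) := by
    rw [Jet.ricHessHess_frame hb]
    simp only [Finset.sum_mul]
    exact Finset.sum_congr rfl fun p _ => Finset.sum_comm
  rw [h1, Jet.ricSq_frame hb]
  refine (sq_sum_two_le _ _).trans ?_
  rw [← Jet.hessSq_frame hb]
  refine mul_le_mul_of_nonneg_right ?_ (Jet.hessSq_nonneg hb)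
  rw [Jet.hessSq_frame hb, Finset.sum_mul]
  refine Finset.sum_le_sum fun a _ => ?_
  calc ∑ e, (∑ c, ev2 J.Rc (b a) (b c) * ev2 J.H (b c) (b e)) ^ 2
      ≤ ∑ e, (∑ c, ev2 J.Rc (b a) (b c) ^ 2) * ∑ c, ev2 J.H (b c) (b e) ^ 2 :=
        Finset.sum_le_sum fun e _ => Finset.sum_mul_sq_le_sq_mul_sq _ _ _
    _ = _ := by rw [← Finset.mul_sum, Finset.sum_comm]

/-- `(∇∇u(∇u, v))² ≤ |∇²u|² |∇u|²` for a unit vector `v`. -/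
lemma Jet.sum_sq_hessGrad_le (hb : IsFrame J.A b) :
    ∑ c, ev J.hessGrad (b c) ^ 2 ≤ J.hessSq * J.gradSq := by
  simp only [Jet.hessGrad_frame hb]
  rw [Jet.hessSq_frame hb, Jet.gradSq_frame hb, Finset.sum_comm, Finset.sum_mul]
  exact Finset.sum_le_sum fun a _ => Finset.sum_mul_sq_le_sq_mul_sq _ _ _

end CauchySchwarz

section

variable {n : ℕ} {G : Coord n → Matrix (Fin n) (Fin n) ℝ} {V : Set (Coord n)} {y : Coord n}
  {f : Coord n → ℝ}

namespace IsNormalAt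

section
variable (hN : IsNormalAt G y)
include hN

lemma gradSq_eq : (coordJet G f y).gradSq = ∑ i, pd f i y ^ 2 := by
  rw [Jet.gradSq_frame hN.isFrame]
  simp only [ev_single]; rfl

lemma hessSq_eq : (coordJet G f y).hessSq = ∑ i, ∑ j, coordHess G f i j y ^ 2 := by
  rw [Jet.hessSq_frame hN.isFrame]
  simp only [ev2_single]; rfl

lemma thirdSq_eq : (coordJet G f y).thirdSq = ∑ k, ∑ i, ∑ j, coordThird G f k i j y ^ 2 := by
  rw [Jet.thirdSq_frame hN.isFrame]
  simp only [ev3_single]; rfl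

lemma ricGradLapGrad_eq : (coordJet G f y).ricGradLapGrad
    = ∑ a, ∑ c, coordRic G a c y * pd f a y * ∑ e, coordThird G f e e c y := by
  rw [Jet.ricGradLapGrad_frame hN.isFrame]
  simp only [ev2_single, ev_single, ev3_single]; rfl

lemma ricSqGradGrad_eq : (coordJet G f y).ricSqGradGrad
    = ∑ a, (∑ c, coordRic G a c y * pd f c y) ^ 2 := by
  rw [Jet.ricSqGradGrad_frame hN.isFrame]
  simp only [ev2_single, ev_single]; rfl

lemma ricHessHess_eq : (coordJet G f y).ricHessHess
    = ∑ a, ∑ c, ∑ e, coordRic G a c y * coordHess G f c e y * coordHess G f a e y := by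
  rw [Jet.ricHessHess_frame hN.isFrame]
  simp only [ev2_single]; rfl

lemma riemThirdGrad_eq : (coordJet G f y).riemThirdGrad = ∑ r, ∑ m, ∑ p, ∑ j,
    coordRiemMixed G p m j r y * coordThird G f m p j y * pd f r y := by
  rw [Jet.riemThirdGrad_frame hN.isFrame]
  simp only [ev4_single, ev3_single, ev_single, ← hN.riem_eq]; rfl

lemma riemHessHess_eq : (coordJet G f y).riemHessHess = ∑ p, ∑ j, ∑ l, ∑ r,
    coordRiemMixed G p l j r y * coordHess G f l r y * coordHess G f p j y := by
  rw [Jet.riemHessHess_frame hN.isFrame]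
  simp only [ev4_single, ev2_single, ← hN.riem_eq]; rfl

end

/-- The divergence of `∇^p∇^i f ∇_p∇_i∇_l f`. The sum on the right is `∇²f · ∇Δ∇f`; it occurs in
`coordDiv_hessLapGrad` as well. -/
lemma coordDiv_thirdHess (hN : IsNormalAt G y) (hG : IsMetricOn G V) (hf : ContDiffOn ℝ ∞ f V)
    (hy : y ∈ V) :
    coordDiv G (fun l z => (coordJet G f z).thirdHess l) y
      = (coordJet G f y).thirdSq - (coordJet G f y).riemThirdGrad
        + (∑ l, ∑ p, ∑ i, coordHess G f p i y * pd (coordThird G f l l i) p y)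
        + (coordJet G f y).ricHessHess + (coordJet G f y).riemHessHess := by
  rw [hN.coordDiv_eq]
  -- `∇_l∇_p∇_i f ∇_p∇_i∇_l f` differs from `|∇³f|²` by the commutator of the first two derivatives
  have e1 : (∑ l, ∑ p, ∑ i, coordThird G f l p i y * coordThird G f p i l y)
      = (coordJet G f y).thirdSq - (coordJet G f y).riemThirdGrad := by
    rw [hN.thirdSq_eq, hN.riemThirdGrad_eq, sum_rot_four]
    simp only [← Finset.sum_sub_distrib]
    refine Finset.sum_congr rfl fun l _ => Finset.sum_congr rfl fun p _ =>
      Finset.sum_congr rfl fun i _ => ?_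
    have h1 := hG.ricci_identity hf hy l p i
    have h2 : ∑ r, coordRiemMixed G p l i r y * coordThird G f l p i y * pd f r y
        = - (coordThird G f l p i y * ∑ r, coordRiemMixed G l p i r y * pd f r y) := by
      rw [Finset.mul_sum, ← Finset.sum_neg_distrib]
      refine Finset.sum_congr rfl fun r _ => ?_
      rw [coordRiemMixed_antisymm p l]; ring
    rw [h2, hG.third_symm hf hy p i l]
    linear_combination (coordThird G f l p i y) * (-h1)
  -- the two curvature terms of the commutator of `∇_l` and `∇_p` on `∇²f`
  have e2 : (∑ l, ∑ p, ∑ i, ∑ r, - (coordRiemMixed G l p l r y * coordHess G f r i y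
      * coordHess G f p i y)) = (coordJet G f y).ricHessHess := by
    rw [hN.ricHessHess_eq, Finset.sum_comm]
    refine Finset.sum_congr rfl fun p _ => ?_
    rw [Finset.sum_comm_cycle]
    refine Finset.sum_congr rfl fun r _ => ?_
    rw [Finset.sum_comm]
    refine Finset.sum_congr rfl fun i _ => ?_
    rw [hN.ric_eq, Finset.sum_mul, Finset.sum_mul]
    refine Finset.sum_congr rfl fun l _ => ?_
    rw [coordRiemMixed_antisymm l p]; ring
  have e3 : (∑ l, ∑ p, ∑ i, ∑ r, - (coordRiemMixed G l p i r y * coordHess G f l r y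
      * coordHess G f p i y)) = (coordJet G f y).riemHessHess := by
    rw [hN.riemHessHess_eq]
    symm
    rw [Finset.sum_comm_cycle]
    refine Finset.sum_congr rfl fun l _ => Finset.sum_congr rfl fun p _ =>
      Finset.sum_congr rfl fun i _ => Finset.sum_congr rfl fun r _ => ?_
    rw [coordRiemMixed_antisymm p l]; ring
  rw [← e1, ← e2, ← e3]
  simp only [← Finset.sum_add_distrib]
  refine Finset.sum_congr rfl fun l _ => ?_
  rw [hN.pd_thirdHess hG hf hy]
  refine Finset.sum_congr rfl fun p _ => Finset.sum_congr rfl fun i _ => ?_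
  rw [pd_congr_of_eqOn hG.isOpen (fun z hz => hG.third_symm hf hz p i l) hy,
    hN.third_commutator hG hf hy p i l, mul_sub, Finset.mul_sum, sub_eq_add_neg,
    ← Finset.sum_neg_distrib]
  simp only [add_assoc, ← Finset.sum_add_distrib]
  congr 3
  funext r
  ring

/-- The divergence of `∇∇f(Δ∇f, ·)`, which is `|Δ∇f|² + ∇²f · ∇Δ∇f`. -/
lemma coordDiv_hessLapGrad (hN : IsNormalAt G y) (hG : IsMetricOn G V) (hf : ContDiffOn ℝ ∞ f V)
    (hy : y ∈ V) :
    coordDiv G (fun l z => (coordJet G f z).hessLapGrad l) y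
      = (∑ i, (∑ k, coordThird G f k k i y) ^ 2)
        + ∑ l, ∑ p, ∑ i, coordHess G f p i y * pd (coordThird G f l l i) p y := by
  rw [hN.coordDiv_eq]
  simp only [hN.pd_hessLapGrad hG hf hy, Finset.sum_add_distrib]
  congr 1
  · rw [Finset.sum_comm]
    refine Finset.sum_congr rfl fun i _ => ?_
    rw [← Finset.sum_mul, sq]
    congr 1
    exact Finset.sum_congr rfl fun l _ => hG.third_symm hf hy l i l
  · simp only [Finset.mul_sum]
    rw [Finset.sum_comm_cycle]
    refine Finset.sum_congr rfl fun k _ => Finset.sum_congr rfl fun p _ =>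
      Finset.sum_congr rfl fun i _ => ?_
    rw [hG.hess_symm hf hy]

/-- `Δ∇f = Rc(∇f)` for a harmonic function. -/
lemma lapGrad_eq (hN : IsNormalAt G y) (hG : IsMetricOn G V) (hf : ContDiffOn ℝ ∞ f V)
    (hy : y ∈ V) (hlap : ∀ z ∈ V, (coordJet G f z).lap = 0) (i : Fin n) :
    ∑ k, coordThird G f k k i y = ∑ r, coordRic G i r y * pd f r y := by
  rw [hN.lapGrad_bochner hG hf hy, pd_congr_of_eqOn hG.isOpen (g := fun _ => 0) hlap hy, pd_const,
    zero_add]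

lemma ricSqGradGrad_of_harmonic (hN : IsNormalAt G y) (hG : IsMetricOn G V)
    (hf : ContDiffOn ℝ ∞ f V) (hy : y ∈ V) (hlap : ∀ z ∈ V, (coordJet G f z).lap = 0) :
    (coordJet G f y).ricSqGradGrad = ∑ i, (∑ k, coordThird G f k k i y) ^ 2 := by
  rw [hN.ricSqGradGrad_eq]
  simp only [hN.lapGrad_eq hG hf hy hlap]

lemma ricGradLapGrad_of_harmonic (hN : IsNormalAt G y) (hG : IsMetricOn G V)
    (hf : ContDiffOn ℝ ∞ f V) (hy : y ∈ V) (hlap : ∀ z ∈ V, (coordJet G f z).lap = 0) :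
    (coordJet G f y).ricGradLapGrad = ∑ i, (∑ k, coordThird G f k k i y) ^ 2 := by
  rw [hN.ricGradLapGrad_eq, Finset.sum_comm]
  refine Finset.sum_congr rfl fun i _ => ?_
  rw [← Finset.sum_mul, sq]
  congr 1
  rw [hN.lapGrad_eq hG hf hy hlap]
  exact Finset.sum_congr rfl fun r _ => by rw [hN.ric_symm hG hy]

lemma thirdSq_identity (hN : IsNormalAt G y) (hG : IsMetricOn G V) (hf : ContDiffOn ℝ ∞ f V)
    (hy : y ∈ V) (hlap : ∀ z ∈ V, (coordJet G f z).lap = 0) :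
    (coordJet G f y).thirdSq = coordDiv G (fun l z => (coordJet G f z).thirdHess l) y
      - coordDiv G (fun l z => (coordJet G f z).hessLapGrad l) y
      + (2 * (coordJet G f y).ricGradLapGrad - (coordJet G f y).ricSqGradGrad
        - (coordJet G f y).ricHessHess)
      + ((coordJet G f y).riemThirdGrad - (coordJet G f y).riemHessHess) := by
  have h1 := hN.ricGradLapGrad_of_harmonic hG hf hy hlap
  have h2 := hN.ricSqGradGrad_of_harmonic hG hf hy hlap
  rw [hN.coordDiv_thirdHess hG hf hy, hN.coordDiv_hessLapGrad hG hf hy, h1, h2]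
  ring

/-- The estimate behind the interpolation of `∫ |∇²u|³`: the `1`-form
`(|∇²u|² + ε²)^{1/2} ∇∇u(∇u, ·)` has divergence at least `|∇²u|² (|∇²u|² + ε²)^{1/2}`, up to terms
with curvature or `∇³u`. -/
lemma hessSq_le_coordDiv (hN : IsNormalAt G y) (hG : IsMetricOn G V) (hf : ContDiffOn ℝ ∞ f V)
    (hy : y ∈ V) (hlap : ∀ z ∈ V, (coordJet G f z).lap = 0) {ε : ℝ} (hε : 0 < ε) :
    √((coordJet G f y).hessSq + ε ^ 2) * (coordJet G f y).hessSq
      ≤ coordDiv G (fun l z => √((coordJet G f z).hessSq + ε ^ 2) * (coordJet G f z).hessGrad l) y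
        + √(coordJet G f y).thirdSq * √(coordJet G f y).hessSq * √(coordJet G f y).gradSq
        + √((coordJet G f y).hessSq + ε ^ 2)
          * (√(coordJet G f y).ricSq * (coordJet G f y).gradSq) := by
  set J := coordJet G f y with hJ
  have hb : IsFrame J.A stdVec := hN.isFrame
  have hH0 := Jet.hessSq_nonneg hb
  set F := √(J.hessSq + ε ^ 2) with hF
  have hFpos : 0 < F := Real.sqrt_pos.mpr (by positivity)
  have hdq : DifferentiableAt ℝ (fun z => (coordJet G f z).hessSq + ε ^ 2) y :=
    ((ContDiff.comp_jet Jet.contDiff_hessSq hG hf).diffAt hG.isOpen hy).add_const _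
  have hne : (coordJet G f y).hessSq + ε ^ 2 ≠ 0 := by
    rw [← hJ]; positivity
  have hdF : DifferentiableAt ℝ (fun z => √((coordJet G f z).hessSq + ε ^ 2)) y := hdq.sqrt hne
  have hdg : ∀ l, DifferentiableAt ℝ (fun z => (coordJet G f z).hessGrad l) y := fun l =>
    (ContDiff.comp_jet (Jet.contDiff_hessGrad l) hG hf).diffAt hG.isOpen hy
  set q : Fin n → ℝ := fun l => ∑ p, ∑ i, coordHess G f p i y * coordThird G f l p i y with hq
  have hpF : ∀ l, pd (fun z => √((coordJet G f z).hessSq + ε ^ 2)) l y = q l / F := by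
    intro l
    have h1 : pd (fun z => √((coordJet G f z).hessSq + ε ^ 2)) l y
        = 1 / (2 * F) * pd (fun z => (coordJet G f z).hessSq) l y := by
      unfold pd
      rw [fderiv_sqrt hdq hne, fderiv_add_const]
      rfl
    rw [h1, hN.pd_hessSq hG hf hy]
    simp only [mul_assoc, ← Finset.mul_sum]
    field_simp
    rfl
  have hg : ∀ l, J.hessGrad l = ∑ i, coordHess G f i l y * pd f i y := by
    intro l
    exact Finset.sum_congr rfl fun i _ => by rw [hJ, hN.gradUp_eq]; rfl
  -- the divergence, computed by the product rule
  have hdiv : coordDiv G (fun l z => √((coordJet G f z).hessSq + ε ^ 2)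
      * (coordJet G f z).hessGrad l) y = (∑ l, q l * J.hessGrad l) / F
        + F * (∑ i, (∑ r, coordRic G i r y * pd f r y) * pd f i y) + F * J.hessSq := by
    rw [hN.coordDiv_eq]
    have h1 : ∑ l, ∑ i, (coordThird G f l i l y * pd f i y
          + coordHess G f i l y * coordHess G f l i y)
        = (∑ i, (∑ r, coordRic G i r y * pd f r y) * pd f i y) + J.hessSq := by
      simp only [Finset.sum_add_distrib]
      congr 1
      · rw [Finset.sum_comm]
        refine Finset.sum_congr rfl fun i _ => ?_
        rw [← hN.lapGrad_eq hG hf hy hlap, Finset.sum_mul]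
        exact Finset.sum_congr rfl fun l _ => by rw [hG.third_symm hf hy]
      · rw [hJ, hN.hessSq_eq]
        exact Finset.sum_congr rfl fun l _ => Finset.sum_congr rfl fun i _ => by
          rw [hG.hess_symm hf hy i l]; ring
    rw [add_assoc, ← mul_add, ← h1, Finset.sum_div, Finset.mul_sum, ← Finset.sum_add_distrib]
    refine Finset.sum_congr rfl fun l _ => ?_
    rw [pd_mul hdF (hdg l), hpF, hN.pd_hessGrad hG hf hy]
    ring
  -- the two error terms
  have hA : |∑ l, q l * J.hessGrad l| ≤ F * (√J.thirdSq * √J.hessSq * √J.gradSq) := by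
    have h1 : ∑ l, q l ^ 2 ≤ J.hessSq * J.thirdSq := by
      rw [hJ, hN.hessSq_eq, hN.thirdSq_eq, Finset.mul_sum]
      exact Finset.sum_le_sum fun l _ => sq_sum_two_le _ _
    have h2 : ∑ l, J.hessGrad l ^ 2 ≤ J.hessSq * J.gradSq := by
      have := Jet.sum_sq_hessGrad_le hb
      simpa only [ev_single] using this
    have h3 : |∑ l, q l * J.hessGrad l| ≤ √(J.hessSq * J.thirdSq) * √(J.hessSq * J.gradSq) := by
      rw [← Real.sqrt_mul (mul_nonneg hH0 (Jet.thirdSq_nonneg hb))]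
      refine Real.abs_le_sqrt ((Finset.sum_mul_sq_le_sq_mul_sq _ _ _).trans ?_)
      exact mul_le_mul h1 h2 (by positivity) (mul_nonneg hH0 (Jet.thirdSq_nonneg hb))
    have h4 : √J.hessSq ≤ F := Real.sqrt_le_sqrt (by nlinarith)
    rw [Real.sqrt_mul hH0, Real.sqrt_mul hH0] at h3
    calc _ ≤ _ := h3
      _ = √J.hessSq * (√J.thirdSq * √J.hessSq * √J.gradSq) := by ring
      _ ≤ _ := mul_le_mul_of_nonneg_right h4 (by positivity)
  have hB : |∑ i, (∑ r, coordRic G i r y * pd f r y) * pd f i y| ≤ √J.ricSq * J.gradSq := by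
    have h1 := Jet.ricSqGradGrad_le hb
    have h2 : (∑ i, (∑ r, coordRic G i r y * pd f r y) * pd f i y) ^ 2
        ≤ J.ricSq * J.gradSq * J.gradSq := by
      refine (Finset.sum_mul_sq_le_sq_mul_sq _ _ _).trans ?_
      rw [← hN.ricSqGradGrad_eq, ← hN.gradSq_eq]
      exact mul_le_mul_of_nonneg_right h1 (Jet.gradSq_nonneg hb)
    have h3 := abs_le_sqrt_mul_three (Jet.ricSq_nonneg hb) (Jet.gradSq_nonneg hb) h2
    rwa [mul_assoc, Real.mul_self_sqrt (Jet.gradSq_nonneg hb)] at h3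
  rw [hdiv]
  have h5 : -(√J.thirdSq * √J.hessSq * √J.gradSq) ≤ (∑ l, q l * J.hessGrad l) / F := by
    rw [le_div_iff₀ hFpos]
    linarith [(abs_le.mp hA).1]
  have h6 := mul_le_mul_of_nonneg_left (abs_le.mp hB).1 hFpos.le
  linarith

end IsNormalAt

/-- Normal coordinates around a point, together with the transported function. -/
lemma exists_normal_jet (hG : IsMetricOn G V) (hf : ContDiffOn ℝ ∞ f V) (hy : y ∈ V) :
    ∃ (φ : Coord n → Coord n) (G' : Coord n → Matrix (Fin n) (Fin n) ℝ) (W : Set (Coord n)),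
      IsMetricOn G' W ∧ IsIsometricMap φ G' W G V ∧ (0 : Coord n) ∈ W ∧ φ 0 = y ∧
        IsNormalAt G' 0 ∧ ContDiffOn ℝ ∞ (fun z => f (φ z)) W ∧ ∀ z ∈ W,
          JetRel (coordJet G' (fun z => f (φ z)) z) (coordJet G f (φ z)) (fderiv ℝ φ z) := by
  obtain ⟨φ, G', W, h1, h2, h3, h4, h5⟩ := exists_normal hG hy
  have h6 : ContDiffOn ℝ ∞ (fun z => f (φ z)) W := hf.comp h2.smooth h2.mapsTo
  exact ⟨φ, G', W, h1, h2, h3, h4, h5, h6, fun z hz => h2.jetRel h1 hG h6 hf (fun _ _ => rfl) hz⟩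

/-- The pointwise form of the integral identity. -/
theorem thirdSq_identity (hG : IsMetricOn G V) (hf : ContDiffOn ℝ ∞ f V)
    (hy : y ∈ V) (hlap : ∀ z ∈ V, (coordJet G f z).lap = 0) :
    (coordJet G f y).thirdSq = coordDiv G (fun l z => (coordJet G f z).thirdHess l) y
      - coordDiv G (fun l z => (coordJet G f z).hessLapGrad l) y
      + (2 * (coordJet G f y).ricGradLapGrad - (coordJet G f y).ricSqGradGrad
        - (coordJet G f y).ricHessHess)
      + ((coordJet G f y).riemThirdGrad - (coordJet G f y).riemHessHess) := by
  obtain ⟨φ, G', W, hG', hφ, h0, rfl, hN, hf', hrel⟩ := exists_normal_jet hG hf hy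
  have hd1 : coordDiv G' (fun l z => (coordJet G' (fun z => f (φ z)) z).thirdHess l) 0
      = coordDiv G (fun l z => (coordJet G f z).thirdHess l) (φ 0) :=
    hφ.coordDiv_eq hG' hG h0
      (fun j => (ContDiff.comp_jet (Jet.contDiff_thirdHess j) hG' hf').diffAt hG'.isOpen h0)
      (fun j => (ContDiff.comp_jet (Jet.contDiff_thirdHess j) hG hf).diffAt hG.isOpen hy)
      fun z hz v => (hrel z hz).thirdHess v
  have hd2 : coordDiv G' (fun l z => (coordJet G' (fun z => f (φ z)) z).hessLapGrad l) 0
      = coordDiv G (fun l z => (coordJet G f z).hessLapGrad l) (φ 0) :=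
    hφ.coordDiv_eq hG' hG h0
      (fun j => (ContDiff.comp_jet (Jet.contDiff_hessLapGrad j) hG' hf').diffAt hG'.isOpen h0)
      (fun j => (ContDiff.comp_jet (Jet.contDiff_hessLapGrad j) hG hf).diffAt hG.isOpen hy)
      fun z hz v => (hrel z hz).hessLapGrad v
  have h := hN.thirdSq_identity hG' hf' h0 fun z hz => by
    rw [(hrel z hz).lap, hlap _ (hφ.mapsTo hz)]
  have r := hrel 0 h0
  rwa [hd1, hd2, r.thirdSq, r.ricGradLapGrad, r.ricSqGradGrad, r.ricHessHess, r.riemThirdGrad,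
    r.riemHessHess] at h

/-- For a harmonic function the Bochner formula `Δ∇u = Rc(∇u)` identifies two of the terms. -/
lemma ricGradLapGrad_eq_ricSqGradGrad (hG : IsMetricOn G V) (hf : ContDiffOn ℝ ∞ f V)
    (hy : y ∈ V) (hlap : ∀ z ∈ V, (coordJet G f z).lap = 0) :
    (coordJet G f y).ricGradLapGrad = (coordJet G f y).ricSqGradGrad := by
  obtain ⟨φ, G', W, hG', hφ, h0, rfl, hN, hf', hrel⟩ := exists_normal_jet hG hf hy
  have hl : ∀ z ∈ W, (coordJet G' (fun z => f (φ z)) z).lap = 0 := fun z hz => by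
    rw [(hrel z hz).lap, hlap _ (hφ.mapsTo hz)]
  rw [← (hrel 0 h0).ricGradLapGrad, ← (hrel 0 h0).ricSqGradGrad,
    hN.ricGradLapGrad_of_harmonic hG' hf' h0 hl, hN.ricSqGradGrad_of_harmonic hG' hf' h0 hl]

/-- `IsNormalAt.hessSq_le_coordDiv` in arbitrary coordinates. -/
theorem hessSq_le_coordDiv (hG : IsMetricOn G V) (hf : ContDiffOn ℝ ∞ f V)
    (hy : y ∈ V) (hlap : ∀ z ∈ V, (coordJet G f z).lap = 0) {ε : ℝ} (hε : 0 < ε) :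
    √((coordJet G f y).hessSq + ε ^ 2) * (coordJet G f y).hessSq
      ≤ coordDiv G (fun l z => √((coordJet G f z).hessSq + ε ^ 2) * (coordJet G f z).hessGrad l) y
        + √(coordJet G f y).thirdSq * √(coordJet G f y).hessSq * √(coordJet G f y).gradSq
        + √((coordJet G f y).hessSq + ε ^ 2)
          * (√(coordJet G f y).ricSq * (coordJet G f y).gradSq) := by
  obtain ⟨φ, G', W, hG', hφ, h0, rfl, hN, hf', hrel⟩ := exists_normal_jet hG hf hy
  have hdiff : ∀ {G₁ : Coord n → Matrix (Fin n) (Fin n) ℝ} {V₁ : Set (Coord n)}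
      {f₁ : Coord n → ℝ} {y₁ : Coord n}, IsMetricOn G₁ V₁ → ContDiffOn ℝ ∞ f₁ V₁ → y₁ ∈ V₁ →
      ∀ l, DifferentiableAt ℝ (fun z => √((coordJet G₁ f₁ z).hessSq + ε ^ 2)
        * (coordJet G₁ f₁ z).hessGrad l) y₁ := by
    intro G₁ V₁ f₁ y₁ h1 h2 h3 l
    obtain ⟨b, hb⟩ := exists_isFrame h1 h3
    have h4 := Jet.hessSq_nonneg (J := coordJet G₁ f₁ y₁) hb
    exact ((((ContDiff.comp_jet Jet.contDiff_hessSq h1 h2).diffAt h1.isOpen h3).add_const _).sqrt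
      (by positivity)).fun_mul
        ((ContDiff.comp_jet (Jet.contDiff_hessGrad l) h1 h2).diffAt h1.isOpen h3)
  have hd1 := hφ.coordDiv_eq hG' hG h0 (hdiff hG' hf' h0) (hdiff hG hf hy) fun z hz v => by
    have h1 := (hrel z hz).hessGrad v
    have h2 := (hrel z hz).hessSq
    simp only [ev_apply'] at h1 ⊢
    simp only [mul_left_comm _ (√_) _, ← Finset.mul_sum]
    rw [h1, h2]
  have h := hN.hessSq_le_coordDiv hG' hf' h0 (fun z hz => by
    rw [(hrel z hz).lap, hlap _ (hφ.mapsTo hz)]) hε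
  have r := hrel 0 h0
  rwa [hd1, r.thirdSq, r.hessSq, r.gradSq, r.ricSq] at h

end

/-! ### The divergence theorem in coordinates -/

section Density

variable {n : ℕ} {G : Coord n → Matrix (Fin n) (Fin n) ℝ} {V : Set (Coord n)} {y : Coord n}

/-- The derivative of the determinant. -/
lemma pd_det (hd : ∀ i j, DifferentiableAt ℝ (fun z => G z i j) y) (k : Fin n) :
    pd (fun z => (G z).det) k y
      = ∑ i, ∑ j, (G y).adjugate j i * pd (fun z => G z i j) k y := by
  let D : ContinuousMultilinearMap ℝ (fun _ : Fin n => Fin n → ℝ) ℝ :=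
    { toMultilinearMap := (Matrix.detRowAlternating (n := Fin n) (R := ℝ)).toMultilinearMap
      cont := by
        change Continuous fun M : Matrix (Fin n) (Fin n) ℝ => M.det
        exact continuous_id.matrix_det }
  have h1 : HasFDerivAt (fun z => (fun i j => G z i j : Fin n → Fin n → ℝ))
      (ContinuousLinearMap.pi fun i => ContinuousLinearMap.pi fun j =>
        fderiv ℝ (fun z => G z i j) y) y :=
    hasFDerivAt_pi.mpr fun i => hasFDerivAt_pi.mpr fun j => (hd i j).hasFDerivAt
  have h2 := (D.hasFDerivAt (x := fun i j => G y i j)).comp y h1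
  have h3 : (fun z => (G z).det) = D ∘ fun z => (fun i j => G z i j : Fin n → Fin n → ℝ) := rfl
  unfold pd
  rw [h3, h2.fderiv, ContinuousLinearMap.comp_apply, ContinuousMultilinearMap.linearDeriv_apply]
  refine Finset.sum_congr rfl fun i _ => ?_
  have h4 : ∀ v : Fin n → ℝ, D (Function.update (fun i j => G y i j) i v)
      = ∑ j, (G y).adjugate j i * v j := by
    intro v
    change ((G y).updateRow i v).det = _
    rw [← Matrix.cramer_transpose_apply, Matrix.cramer_eq_adjugate_mulVec,
      ← Matrix.adjugate_transpose]
    rfl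
  exact h4 _

variable (hG : IsMetricOn G V) (hy : y ∈ V)
include hG hy

lemma IsMetricOn.pd_eq_matrix (k : Fin n) :
    Matrix.of (fun i j => pd (fun z => G z i j) k y)
      = G y * Matrix.of (fun l i => christoffel G l k i y)
        + (G y * Matrix.of (fun l i => christoffel G l k i y))ᵀ := by
  ext i j
  rw [Matrix.add_apply, Matrix.transpose_apply, Matrix.mul_apply, Matrix.mul_apply, Matrix.of_apply,
    hG.pd_eq hy, add_comm]
  rfl

lemma IsMetricOn.transpose_eq : (G y)ᵀ = G y := by
  ext i j; exact hG.symm hy j i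

lemma IsMetricOn.pd_det (k : Fin n) :
    pd (fun z => (G z).det) k y = 2 * (G y).det * ∑ i, christoffel G i k i y := by
  have hd : ∀ i j, DifferentiableAt ℝ (fun z => G z i j) y := fun i j =>
    (hG.smooth i j).diffAt hG.isOpen hy
  rw [HarmonicEstimates.pd_det hd]
  set Γ := Matrix.of (fun l i => christoffel G l k i y) with hΓ
  have h1 : ∑ i, ∑ j, (G y).adjugate j i * pd (fun z => G z i j) k y
      = ((G y).adjugate * Matrix.of (fun i j => pd (fun z => G z i j) k y)).trace := by
    rw [Finset.sum_comm]
    simp only [Matrix.trace, Matrix.diag, Matrix.mul_apply, Matrix.of_apply]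
  rw [h1, hG.pd_eq_matrix hy, ← hΓ, Matrix.mul_add, Matrix.trace_add, ← Matrix.mul_assoc,
    Matrix.adjugate_mul, Matrix.transpose_mul, hG.transpose_eq hy, Matrix.trace_mul_comm _ (Γᵀ * _),
    Matrix.mul_assoc, Matrix.mul_adjugate]
  simp only [Matrix.smul_mul, Matrix.mul_smul, Matrix.one_mul, Matrix.mul_one, Matrix.trace_smul,
    Matrix.trace_transpose, smul_eq_mul]
  have h2 : Γ.trace = ∑ i, christoffel G i k i y := rfl
  rw [h2]; ring

lemma IsMetricOn.pd_inv (i a k : Fin n) : pd (fun z => (G z)⁻¹ i a) k y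
    = - ∑ m, (G y)⁻¹ i m * christoffel G a k m y - ∑ m, christoffel G i k m y * (G y)⁻¹ m a := by
  have hd : ∀ a b, DifferentiableAt ℝ (fun z => (G z)⁻¹ a b) y := fun a b =>
    (hG.smooth_inv a b).diffAt hG.isOpen hy
  have hd' : ∀ a b, DifferentiableAt ℝ (fun z => G z a b) y := fun a b =>
    (hG.smooth a b).diffAt hG.isOpen hy
  set Γ := Matrix.of (fun l i => christoffel G l k i y) with hΓ
  set P := Matrix.of (fun i j => pd (fun z => (G z)⁻¹ i j) k y) with hP
  have h1 : P * G y + (G y)⁻¹ * Matrix.of (fun i j => pd (fun z => G z i j) k y) = 0 := by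
    ext i j
    have h1 : pd (fun z => ∑ m, (G z)⁻¹ i m * G z m j) k y
        = pd (fun _ => if i = j then 1 else 0) k y := by
      refine pd_congr_of_eqOn hG.isOpen (fun z hz => ?_) hy k
      have := Matrix.nonsing_inv_mul (G z) (hG.isUnit_det hz)
      simpa [Matrix.mul_apply, Matrix.one_apply] using congrFun (congrFun this i) j
    rw [pd_sum (fun m _ => (hd i m).fun_mul (hd' m j)), pd_const] at h1
    simp only [pd_mul (hd i _) (hd' _ j), Finset.sum_add_distrib] at h1
    simpa [hP, Matrix.mul_apply] using h1
  have hu := hG.isUnit_det hy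
  have h2 : P = - ((G y)⁻¹ * Γᵀ) - Γ * (G y)⁻¹ := by
    have h3 : P * G y * (G y)⁻¹ = P := Matrix.mul_nonsing_inv_cancel_right _ _ hu
    rw [← h3, eq_neg_of_add_eq_zero_left h1, hG.pd_eq_matrix hy, ← hΓ, Matrix.mul_add,
      Matrix.nonsing_inv_mul_cancel_left _ _ hu, Matrix.transpose_mul, hG.transpose_eq hy,
      Matrix.neg_mul,
      Matrix.add_mul, ← Matrix.mul_assoc, Matrix.mul_nonsing_inv_cancel_right _ _ hu]
    abel
  have h3 := congrFun (congrFun h2 i) a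
  rw [Matrix.sub_apply, Matrix.neg_apply, Matrix.mul_apply, Matrix.mul_apply] at h3
  exact h3

lemma IsMetricOn.pd_sqrt_det (k : Fin n) :
    pd (fun z => √(G z).det) k y = √(G y).det * ∑ i, christoffel G i k i y := by
  have hpos := (hG.posDef y hy).det_pos
  have h1 : pd (fun z => √(G z).det) k y = 1 / (2 * √(G y).det) * pd (fun z => (G z).det) k y := by
    unfold pd
    rw [fderiv_sqrt (hG.smooth_det.diffAt hG.isOpen hy) hpos.ne']
    rfl
  rw [h1, hG.pd_det hy]
  have h2 := Real.mul_self_sqrt hpos.le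
  have h3 := (Real.sqrt_pos.mpr hpos).ne'
  set s := √(G y).det with hs
  clear_value s
  rw [← h2]
  field_simp

/-- The divergence of a `1`-form as the Euclidean divergence of a vector density. -/
lemma IsMetricOn.sum_pd_density {α : Fin n → Coord n → ℝ} (hα : ∀ j, DifferentiableAt ℝ (α j) y) :
    ∑ l, pd (fun z => √(G z).det * ∑ a, (G z)⁻¹ l a * α a z) l y
      = √(G y).det * coordDiv G α y := by
  have hpos := (hG.posDef y hy).det_pos
  have hd : ∀ a b, DifferentiableAt ℝ (fun z => (G z)⁻¹ a b) y := fun a b =>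
    (hG.smooth_inv a b).diffAt hG.isOpen hy
  have hds : DifferentiableAt ℝ (fun z => √(G z).det) y :=
    (hG.smooth_det.diffAt hG.isOpen hy).sqrt hpos.ne'
  have h1 : ∀ l, pd (fun z => √(G z).det * ∑ a, (G z)⁻¹ l a * α a z) l y
      = √(G y).det * ((∑ i, ∑ a, christoffel G i l i y * (G y)⁻¹ l a * α a y)
        - (∑ a, ∑ m, (G y)⁻¹ l m * christoffel G a l m y * α a y)
        - (∑ a, ∑ m, christoffel G l l m y * (G y)⁻¹ m a * α a y)
        + ∑ a, (G y)⁻¹ l a * pd (α a) l y) := by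
    intro l
    rw [pd_mul hds (DifferentiableAt.fun_sum fun a _ => (hd l a).fun_mul (hα a)), hG.pd_sqrt_det hy,
      pd_sum fun a _ => (hd l a).fun_mul (hα a)]
    simp only [pd_mul (hd l _) (hα _), hG.pd_inv hy, Finset.sum_add_distrib, sub_mul, neg_mul,
      Finset.sum_sub_distrib, Finset.sum_neg_distrib, Finset.sum_mul, Finset.mul_sum, mul_add,
      mul_sub, mul_neg]
    have : ∑ a, ∑ i, √(G y).det * christoffel G i l i y * ((G y)⁻¹ l a * α a y)
        = ∑ i, ∑ a, √(G y).det * (christoffel G i l i y * (G y)⁻¹ l a * α a y) := by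
      rw [Finset.sum_comm]
      exact Finset.sum_congr rfl fun _ _ => Finset.sum_congr rfl fun _ _ => by ring
    rw [this]
    ring
  simp only [h1, ← Finset.mul_sum, Finset.sum_add_distrib, Finset.sum_sub_distrib]
  congr 1
  have h2 : (∑ l, ∑ i, ∑ a, christoffel G i l i y * (G y)⁻¹ l a * α a y)
      = ∑ l, ∑ a, ∑ m, christoffel G l l m y * (G y)⁻¹ m a * α a y := by
    rw [Finset.sum_comm]
    refine Finset.sum_congr rfl fun i _ => ?_
    rw [Finset.sum_comm]
    exact Finset.sum_congr rfl fun a _ => Finset.sum_congr rfl fun l _ => by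
      rw [hG.christoffel_symm hy i l i]
  have h3 : (∑ l, ∑ a, ∑ m, (G y)⁻¹ l m * christoffel G a l m y * α a y)
      = ∑ l, ∑ a, (G y)⁻¹ l a * ∑ k, christoffel G k l a y * α k y := by
    refine Finset.sum_congr rfl fun l _ => ?_
    rw [Finset.sum_comm]
    refine Finset.sum_congr rfl fun a _ => ?_
    rw [Finset.mul_sum]
    exact Finset.sum_congr rfl fun _ _ => by ring
  rw [h2, h3]
  simp only [coordDiv, cov1, mul_sub, Finset.sum_sub_distrib]
  ring

end Density

section HalfSpace

open MeasureTheory Set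

variable {m : ℕ}

/-- The divergence theorem for a compactly supported vector field on the half-space `{y₀ < L}`. -/
theorem integral_divergence_halfSpace {w : Fin (m + 1) → Coord (m + 1) → ℝ}
    (hw : ∀ i, ContDiff ℝ 1 (w i)) (hc : ∀ i, HasCompactSupport (w i)) (L : ℝ) :
    ∫ y in {y : Coord (m + 1) | y 0 < L}, ∑ i, pd (w i) i y
      = ∫ z : Fin m → ℝ, w 0 (WithLp.toLp 2 (Fin.cons L z : Fin (m + 1) → ℝ)) := by
  -- a cube that contains all supports
  obtain ⟨R, hR0, hR⟩ : ∃ R : ℝ, |L| < R ∧ ∀ i, ∀ y ∈ tsupport (w i), ∀ j, |y j| < R := by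
    have hK : IsCompact (⋃ i, tsupport (w i)) := isCompact_iUnion fun i => hc i
    obtain ⟨R₀, hR₀⟩ := hK.isBounded.exists_norm_le
    refine ⟨max |L| R₀ + 1, by linarith [le_max_left |L| R₀], fun i y hy j => ?_⟩
    have h1 := hR₀ y (mem_iUnion.mpr ⟨i, hy⟩)
    have h2 : |y j| ≤ ‖y‖ := PiLp.norm_apply_le y j
    linarith [le_max_right |L| R₀]
  have hz : ∀ i y j, R ≤ |y j| → w i y = 0 := fun i y j h =>
    image_eq_zero_of_notMem_tsupport fun h1 => absurd (hR i y h1 j) (not_lt.mpr h)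
  have hz' : ∀ i y j, R ≤ |y j| → fderiv ℝ (w i) y = 0 := fun i y j h =>
    image_eq_zero_of_notMem_tsupport fun h1 =>
      absurd (hR i y (tsupport_fderiv_subset ℝ h1) j) (not_lt.mpr h)
  have hL := abs_lt.mp hR0
  let e : (Fin (m + 1) → ℝ) →L[ℝ] Coord (m + 1) :=
    ((EuclideanSpace.equiv (Fin (m + 1)) ℝ).symm : (Fin (m + 1) → ℝ) →L[ℝ] Coord (m + 1))
  have he : ∀ x, e x = WithLp.toLp 2 x := fun x => rfl
  set a : Fin (m + 1) → ℝ := fun _ => -R with ha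
  set b : Fin (m + 1) → ℝ := Fin.cons L fun _ => R with hb
  have hb0 : b 0 = L := rfl
  have hbs : ∀ j : Fin m, b j.succ = R := fun j => rfl
  have hle : a ≤ b := by
    intro i
    refine Fin.cases ?_ (fun j => ?_) i
    · exact hL.1.le
    · change -R ≤ R; linarith
  have hcont : Continuous fun x : Fin (m + 1) → ℝ => ∑ i, pd (w i) i (e x) := by
    refine continuous_finsetSum _ fun i _ => ?_
    exact (((hw i).continuous_fderiv (by simp)).comp e.continuous).clm_apply continuous_const
  have key := integral_divergence_of_hasFDerivAt_off_countable' a b hle (fun i x => w i (e x))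
    (fun i x => (fderiv ℝ (w i) (e x)).comp e) ∅ countable_empty
    (fun i => ((hw i).continuous.comp e.continuous).continuousOn)
    (fun x _ i => ((hw i).differentiable (by simp) (e x)).hasFDerivAt.comp x e.hasFDerivAt)
    (hcont.continuousOn.integrableOn_compact isCompact_Icc)
  have hdiv : ∀ x, (∑ i, ((fderiv ℝ (w i) (e x)).comp e) (Pi.single i 1))
      = ∑ i, pd (w i) i (e x) := fun x => rfl
  simp only [hdiv] at key
  have hae : Icc a b =ᵐ[volume] univ.pi fun i => Ioo (a i) (b i) :=
    (Measure.univ_pi_Ioo_ae_eq_Icc (μ := fun _ => volume)).symm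
  have hpre : (WithLp.toLp 2 ⁻¹' {y : Coord (m + 1) | y 0 < L})
      = {x : Fin (m + 1) → ℝ | x 0 < L} := rfl
  have hlhs : ∫ y in {y : Coord (m + 1) | y 0 < L}, ∑ i, pd (w i) i y
      = ∫ x in Icc a b, ∑ i, pd (w i) i (e x) := by
    rw [← (PiLp.volume_preserving_toLp (Fin (m + 1))).setIntegral_preimage_emb
      (MeasurableEquiv.toLp 2 (Fin (m + 1) → ℝ)).measurableEmbedding, hpre,
      setIntegral_congr_set hae]
    refine setIntegral_eq_of_subset_of_forall_sdiff_eq_zero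
      (measurableSet_lt (measurable_pi_apply 0) measurable_const) ?_ ?_
    · intro x hx
      exact (hx 0 (mem_univ 0)).2
    · intro x hx
      obtain ⟨j, hj⟩ : ∃ j, R ≤ |x j| := by
        by_contra! hlt
        refine hx.2 fun i _ => ⟨(abs_lt.mp (hlt i)).1, ?_⟩
        refine Fin.cases ?_ (fun j => ?_) i
        · exact hx.1
        · exact (abs_lt.mp (hlt j.succ)).2
      refine Finset.sum_eq_zero fun i _ => ?_
      unfold pd
      rw [hz' i _ j hj]; rfl
  rw [hlhs, key, Fin.sum_univ_succ]
  have hside : ∀ (i : Fin (m + 1)) (r : ℝ) (S : Set (Fin m → ℝ)), R ≤ |r| →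
      ∫ x in S, w i (e (i.insertNth (α := fun _ => ℝ) r x)) = 0 := by
    intro i r S hr
    refine integral_eq_zero_of_ae (Filter.Eventually.of_forall fun x => hz i _ i ?_)
    change R ≤ |(i.insertNth (α := fun _ => ℝ) r x : Fin (m + 1) → ℝ) i|
    rwa [Fin.insertNth_apply_same]
  have hRp : 0 < R := (abs_nonneg L).trans_lt hR0
  have hRR : R ≤ |R| := le_abs_self R
  have hRR' : R ≤ |-R| := by rw [abs_neg]; exact hRR
  have h0 : ∑ i : Fin m, ((∫ x in Icc (a ∘ i.succ.succAbove) (b ∘ i.succ.succAbove),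
      w i.succ (e (i.succ.insertNth (α := fun _ => ℝ) (b i.succ) x)))
      - ∫ x in Icc (a ∘ i.succ.succAbove) (b ∘ i.succ.succAbove),
        w i.succ (e (i.succ.insertNth (α := fun _ => ℝ) (a i.succ) x))) = 0 :=
    Finset.sum_eq_zero fun i _ => by
      rw [hside i.succ (b i.succ) _ hRR, hside i.succ (a i.succ) _ hRR', sub_zero]
  have hcons : ∀ z : Fin m → ℝ, (Fin.cons L z : Fin (m + 1) → ℝ)
      = (0 : Fin (m + 1)).insertNth (α := fun _ => ℝ) (b 0) z := fun z => by
    rw [Fin.insertNth_zero']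
    rfl
  rw [h0, hside 0 (a 0) _ hRR', sub_zero, add_zero]
  simp only [hcons]
  refine setIntegral_eq_integral_of_forall_compl_eq_zero fun x hx => ?_
  obtain ⟨j, hj⟩ : ∃ j, R ≤ |x j| := by
    by_contra! hlt
    exact hx ⟨fun i => (abs_lt.mp (hlt i)).1.le, fun i => (abs_lt.mp (hlt i)).2.le⟩
  refine hz 0 _ j.succ ?_
  change R ≤ |((0 : Fin (m + 1)).insertNth (α := fun _ => ℝ) (b 0) x : Fin (m + 1) → ℝ) j.succ|
  rw [← hcons]
  exact hj

end HalfSpace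

/-! ### Tensors on the manifold in arbitrary charts -/

section Charts

open Set

lemma isOpen_overlap {n : ℕ} {M : Type*} [TopologicalSpace M]
    (c c' : OpenPartialHomeomorph M (Coord n)) {S : Set M} (hS : IsOpen S) :
    IsOpen (c.target ∩ c.symm ⁻¹' (c'.source ∩ S)) :=
  c.symm.isOpen_inter_preimage (c'.open_source.inter hS)

variable {n : ℕ} {M : Type*} [TopologicalSpace M] [ChartedSpace (Coord n) M]
  {c c' : OpenPartialHomeomorph M (Coord n)} {y : Coord n}

lemma contMDiffAt_chart_symm (hc : c ∈ IsManifold.maximalAtlas (𝓡 n) ∞ M) (hy : y ∈ c.target) :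
    ContMDiffAt (𝓡 n) (𝓡 n) ∞ c.symm y :=
  (contMDiffOn_symm_of_mem_maximalAtlas hc).contMDiffAt (c.open_target.mem_nhds hy)

lemma contMDiffAt_chart (hc : c ∈ IsManifold.maximalAtlas (𝓡 n) ∞ M) {x : M} (hx : x ∈ c.source) :
    ContMDiffAt (𝓡 n) (𝓡 n) ∞ c x :=
  (contMDiffOn_of_mem_maximalAtlas hc).contMDiffAt (c.open_source.mem_nhds hx)

lemma contDiffOn_transition (hc : c ∈ IsManifold.maximalAtlas (𝓡 n) ∞ M)
    (hc' : c' ∈ IsManifold.maximalAtlas (𝓡 n) ∞ M) :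
    ContDiffOn ℝ ∞ (fun z => c' (c.symm z)) (c.target ∩ c.symm ⁻¹' c'.source) :=
  ((contMDiffOn_of_mem_maximalAtlas hc').comp ((contMDiffOn_symm_of_mem_maximalAtlas hc).mono
    inter_subset_left) fun _ hz => hz.2).contDiffOn

lemma contDiffOn_comp_chart_symm (hc : c ∈ IsManifold.maximalAtlas (𝓡 n) ∞ M) {u : M → ℝ}
    {S : Set M} (hu : ContMDiffOn (𝓡 n) 𝓘(ℝ, ℝ) ∞ u S) :
    ContDiffOn ℝ ∞ (fun z => u (c.symm z)) (c.target ∩ c.symm ⁻¹' S) :=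
  (hu.comp ((contMDiffOn_symm_of_mem_maximalAtlas hc).mono inter_subset_left)
    fun _ hz => hz.2).contDiffOn

lemma IsMetricOn.mono {G : Coord n → Matrix (Fin n) (Fin n) ℝ} {V W : Set (Coord n)}
    (h : IsMetricOn G V) (hW : IsOpen W) (hWV : W ⊆ V) : IsMetricOn G W :=
  ⟨hW, fun i j => (h.smooth i j).mono hWV, fun y hy => h.posDef y (hWV hy)⟩

lemma chartAt_mem_maximalAtlas' [IsManifold (𝓡 n) ∞ M] (x : M) :
    chartAt (Coord n) x ∈ IsManifold.maximalAtlas (𝓡 n) ∞ M :=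
  IsManifold.chart_mem_maximalAtlas x

lemma continuous_of_chart [IsManifold (𝓡 n) ∞ M] {F : M → ℝ}
    (h : ∀ c ∈ IsManifold.maximalAtlas (𝓡 n) ∞ M, ∃ f : Coord n → ℝ, ContinuousOn f c.target ∧
      ∀ x ∈ c.source, F x = f (c x)) : Continuous F := by
  rw [continuous_iff_continuousAt]
  intro x
  obtain ⟨f, hf, hFf⟩ := h _ (chartAt_mem_maximalAtlas' x)
  have h1 : ContinuousOn (fun z => f (chartAt (Coord n) x z)) (chartAt (Coord n) x).source :=
    hf.comp (chartAt (Coord n) x).continuousOn fun z hz => (chartAt (Coord n) x).map_source hz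
  exact ((h1.congr hFf).continuousAt ((chartAt (Coord n) x).open_source.mem_nhds
    (mem_chart_source _ x)))

lemma mfderiv_chart_symm_injective (hc : c ∈ IsManifold.maximalAtlas (𝓡 n) ∞ M)
    (hy : y ∈ c.target) : Function.Injective (mfderiv (𝓡 n) (𝓡 n) c.symm y) := by
  have h1 : MDifferentiableAt (𝓡 n) (𝓡 n) c.symm y :=
    (contMDiffAt_chart_symm hc hy).mdifferentiableAt (by simp)
  have h2 : MDifferentiableAt (𝓡 n) (𝓡 n) c (c.symm y) :=
    (contMDiffAt_chart hc (c.map_target hy)).mdifferentiableAt (by simp)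
  have h3 := mfderiv_comp y h2 h1
  have h4 : c ∘ c.symm =ᶠ[nhds y] id := by
    filter_upwards [c.open_target.mem_nhds hy] with z hz using c.right_inv hz
  rw [h4.mfderiv_eq, mfderiv_id] at h3
  intro u v huv
  have h5 : ∀ w, mfderiv (𝓡 n) (𝓡 n) c (c.symm y) (mfderiv (𝓡 n) (𝓡 n) c.symm y w) = w := fun w =>
    (congrArg (fun A : Coord n →L[ℝ] Coord n => A w) h3).symm
  rw [← h5 u, ← h5 v, huv]

variable [RiemannianBundle (fun x : M => TangentSpace (𝓡 n) x)]

/-- The inner product of the tangent space at `x`, as a function on the model space. -/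
def innerAt (x : M) (u v : Coord n) : ℝ :=
  @inner ℝ (TangentSpace (𝓡 n) x) _ u v

lemma ev2_chartMetric (u v : Coord n) : ev2 (fun i j => chartMetric c y i j) u v
    = innerAt (c.symm y) (mfderiv (𝓡 n) (𝓡 n) c.symm y u) (mfderiv (𝓡 n) (𝓡 n) c.symm y v) := by
  let A : Coord n →L[ℝ] TangentSpace (𝓡 n) (c.symm y) := mfderiv (𝓡 n) (𝓡 n) c.symm y
  change _ = inner ℝ (A u) (A v)
  conv_rhs => rw [← sum_smul_stdVec u, ← sum_smul_stdVec v]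
  rw [ev2_apply]
  simp only [map_sum, map_smul, sum_inner, inner_sum, real_inner_smul_left, real_inner_smul_right]
  rw [Finset.sum_comm]
  refine Finset.sum_congr rfl fun j _ => Finset.sum_congr rfl fun i _ => ?_
  change _ * _ * inner ℝ (A (stdVec _)) (A (stdVec _)) = _
  ring

lemma transition_metric (hc : c ∈ IsManifold.maximalAtlas (𝓡 n) ∞ M)
    (hc' : c' ∈ IsManifold.maximalAtlas (𝓡 n) ∞ M) (hy : y ∈ c.target) (hy' : c.symm y ∈ c'.source)
    (u v : Coord n) :
    ev2 (fun i j => chartMetric c y i j) u v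
      = ev2 (fun i j => chartMetric c' (c' (c.symm y)) i j)
        (fderiv ℝ (fun z => c' (c.symm z)) y u) (fderiv ℝ (fun z => c' (c.symm z)) y v) := by
  rw [ev2_chartMetric, ev2_chartMetric]
  have hd : MDifferentiableAt (𝓡 n) (𝓡 n) (fun z => c' (c.symm z)) y :=
    ((contMDiffAt_chart hc' hy').comp y (contMDiffAt_chart_symm hc hy)).mdifferentiableAt (by simp)
  have h1 : MDifferentiableAt (𝓡 n) (𝓡 n) c'.symm (c' (c.symm y)) :=
    (contMDiffAt_chart_symm hc' (c'.map_source hy')).mdifferentiableAt (by simp)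
  have h2 := mfderiv_comp y h1 hd
  have h3 : c'.symm ∘ (fun z => c' (c.symm z)) =ᶠ[nhds y] c.symm := by
    have h0 := isOpen_overlap c c' (isOpen_univ (X := M))
    filter_upwards [h0.mem_nhds ⟨hy, hy', mem_univ _⟩] with z hz using c'.left_inv hz.2.1
  rw [h3.mfderiv_eq, mfderiv_eq_fderiv] at h2
  have h4 : ∀ w : Coord n, (mfderiv (𝓡 n) (𝓡 n) c.symm y w : Coord n)
      = mfderiv (𝓡 n) (𝓡 n) c'.symm (c' (c.symm y)) (fderiv ℝ (fun z => c' (c.symm z)) y w) :=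
    fun w => congrArg (fun A : Coord n →L[ℝ] Coord n => A w) h2
  have h5 : c'.symm (c' (c.symm y)) = c.symm y := c'.left_inv hy'
  rw [h5]
  have h6 : ∀ w w' : Coord n, ∀ a b : Coord n, w = a → w' = b →
      innerAt (c.symm y) w w' = innerAt (c.symm y) a b := by
    rintro w w' a b rfl rfl; rfl
  exact h6 _ _ _ _ (h4 u) (h4 v)

variable [IsManifold (𝓡 n) ∞ M]

/-- The metric in a smooth chart is smooth and positive definite. -/
lemma isMetricOn_chartMetric [IsContMDiffRiemannianBundle (𝓡 n) ∞ (Coord n)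
      (fun x : M => TangentSpace (𝓡 n) x)]
    (hc : c ∈ IsManifold.maximalAtlas (𝓡 n) ∞ M) : IsMetricOn (chartMetric c) c.target := by
  have : IsManifold (𝓡 n) 1 M := IsManifold.of_le (n := ∞) (by simp)
  refine ⟨c.open_target, fun i j => ?_, fun y hy => ?_⟩
  · have h1 : ∀ i : Fin n, ContMDiffOn (𝓡 n) ((𝓡 n).prod 𝓘(ℝ, Coord n)) ∞
        (fun y => (⟨c.symm y, mfderiv (𝓡 n) (𝓡 n) c.symm y (EuclideanSpace.single i (1 : ℝ) : Coord n)⟩ :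
          TangentBundle (𝓡 n) M)) c.target := by
      intro i
      have h2 : ContMDiff (𝓡 n) ((𝓡 n).tangent) ∞ (fun y : Coord n =>
          (⟨y, (EuclideanSpace.single i (1 : ℝ) : Coord n)⟩ : TangentBundle (𝓡 n) (Coord n))) := by
        exact contMDiff_vectorSpace_iff_contDiff.mpr contDiff_const
      have h3 := (contMDiffOn_symm_of_mem_maximalAtlas hc).contMDiffOn_tangentMapWithin
        (m := ∞) (by simp) c.open_target.uniqueMDiffOn
      refine (h3.comp h2.contMDiffOn (fun y hy => hy)).congr fun y hy => ?_
      simp only [Function.comp, tangentMapWithin]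
      rw [mfderivWithin_of_isOpen c.open_target hy]
    have h2 := ContMDiffOn.inner_bundle (h1 i) (h1 j)
    exact h2.contDiffOn
  · refine Matrix.PosDef.of_dotProduct_mulVec_pos ?_ fun x hx => ?_
    · ext i j
      simp only [Matrix.conjTranspose_apply, chartMetric, Matrix.of_apply, star_trivial]
      exact real_inner_comm _ _
    · have h1 := ev2_eq_dotProduct (chartMetric c y) (WithLp.toLp 2 x) (WithLp.toLp 2 x)
      rw [ev2_chartMetric] at h1
      simp only [star_trivial]
      refine lt_of_lt_of_eq ?_ h1
      refine real_inner_self_pos.mpr fun h0 => hx ?_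
      have := mfderiv_chart_symm_injective hc hy (a₁ := (WithLp.toLp 2 x : Coord n)) (a₂ := 0)
        (h0.trans (map_zero _).symm)
      simpa using (WithLp.toLp_injective 2 (this.trans (WithLp.toLp_zero 2).symm))

variable [IsContMDiffRiemannianBundle (𝓡 n) ∞ (Coord n) (fun x : M => TangentSpace (𝓡 n) x)]

/-- Changes of charts are isometries. -/
lemma isIsometricMap_transition (hc : c ∈ IsManifold.maximalAtlas (𝓡 n) ∞ M)
    (hc' : c' ∈ IsManifold.maximalAtlas (𝓡 n) ∞ M) {S : Set M} :
    IsIsometricMap (fun z => c' (c.symm z)) (chartMetric c) (c.target ∩ c.symm ⁻¹' (c'.source ∩ S))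
      (chartMetric c') (c'.target ∩ c'.symm ⁻¹' S) := by
  refine ⟨(contDiffOn_transition hc hc').mono fun z hz => ⟨hz.1, hz.2.1⟩, fun z hz =>
    ⟨c'.map_source hz.2.1, ?_⟩, fun y hy => ?_,
    fun y hy => transition_metric hc hc' hy.1 hy.2.1⟩
  · simp only [mem_preimage, c'.left_inv hz.2.1]
    exact hz.2.2
  · have hinj : Function.Injective (fderiv ℝ (fun z => c' (c.symm z)) y) := by
      rw [injective_iff_map_eq_zero]
      intro u hu
      by_contra hne
      have h1 := (isMetricOn_chartMetric hc).ev2_pos hy.1 hne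
      rw [transition_metric hc hc' hy.1 hy.2.1, hu, map_zero] at h1
      exact lt_irrefl _ h1
    exact (LinearMap.injective_iff_surjective
      (f := (fderiv ℝ (fun z => c' (c.symm z)) y : Coord n →ₗ[ℝ] Coord n))).mp hinj

/-- The jet of the function `u` at the point with coordinates `y` in the chart `c`. -/
def chartJet (u : M → ℝ) (c : OpenPartialHomeomorph M (Coord n)) (y : Coord n) : Jet n :=
  coordJet (chartMetric c) (fun z => u (c.symm z)) y

/-- The jet of the function `u` at the point `x` in the preferred chart around `x`. -/
def jetAt (u : M → ℝ) (x : M) : Jet n := chartJet u (chartAt (Coord n) x) (chartAt (Coord n) x x)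

/-- The jets of a function on the manifold in two charts represent the same tensors. -/
lemma jetRel_chartJet (hc : c ∈ IsManifold.maximalAtlas (𝓡 n) ∞ M)
    (hc' : c' ∈ IsManifold.maximalAtlas (𝓡 n) ∞ M) {u : M → ℝ} {S : Set M} (hS : IsOpen S)
    (hu : ContMDiffOn (𝓡 n) 𝓘(ℝ, ℝ) ∞ u S) (hy : y ∈ c.target) (hy' : c.symm y ∈ c'.source)
    (hyS : c.symm y ∈ S) :
    JetRel (chartJet u c y) (chartJet u c' (c' (c.symm y)))
      (fderiv ℝ (fun z => c' (c.symm z)) y) := by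
  have hopen := isOpen_overlap c c' hS
  have hopen' : IsOpen (c'.target ∩ c'.symm ⁻¹' S) := c'.symm.isOpen_inter_preimage hS
  refine (isIsometricMap_transition hc hc' (S := S)).jetRel (y := y)
    ((isMetricOn_chartMetric hc).mono hopen inter_subset_left)
    ((isMetricOn_chartMetric hc').mono hopen' inter_subset_left)
    ((contDiffOn_comp_chart_symm hc hu).mono fun z hz => ⟨hz.1, hz.2.2⟩)
    (contDiffOn_comp_chart_symm hc' hu) (fun z hz => ?_) ⟨hy, hy', hyS⟩
  rw [c'.left_inv hz.2.1]

lemma jetRel_jetAt (hc : c ∈ IsManifold.maximalAtlas (𝓡 n) ∞ M) {u : M → ℝ} {S : Set M}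
    (hS : IsOpen S) (hu : ContMDiffOn (𝓡 n) 𝓘(ℝ, ℝ) ∞ u S) {x : M} (hx : x ∈ c.source)
    (hxS : x ∈ S) :
    JetRel (jetAt u x) (chartJet u c (c x))
      (fderiv ℝ (fun z => c ((chartAt (Coord n) x).symm z)) (chartAt (Coord n) x x)) := by
  have h0 : (chartAt (Coord n) x).symm (chartAt (Coord n) x x) = x :=
    (chartAt (Coord n) x).left_inv (mem_chart_source _ x)
  have h := jetRel_chartJet (chartAt_mem_maximalAtlas' x) hc hS hu
    (mem_chart_target (Coord n) x) (by rwa [h0]) (by rwa [h0])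
  rwa [h0] at h

/-- A function of jets is a scalar if it does not depend on the chart. -/
def IsScalar (F : Jet n → ℝ) : Prop := ∀ J J' L, JetRel J J' L → F J = F J'

lemma IsScalar.jetAt_eq {F : Jet n → ℝ} (hF : IsScalar F)
    (hc : c ∈ IsManifold.maximalAtlas (𝓡 n) ∞ M) {u : M → ℝ}
    (hu : ContMDiff (𝓡 n) 𝓘(ℝ, ℝ) ∞ u) {x : M} (hx : x ∈ c.source) :
    F (jetAt u x) = F (chartJet u c (c x)) :=
  hF _ _ _ (jetRel_jetAt hc isOpen_univ hu.contMDiffOn hx (mem_univ x))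

lemma contDiffOn_chartJet (hc : c ∈ IsManifold.maximalAtlas (𝓡 n) ∞ M) {u : M → ℝ}
    (hu : ContMDiff (𝓡 n) 𝓘(ℝ, ℝ) ∞ u) : ContDiffOn ℝ ∞ (chartJet u c) c.target :=
  contDiffOn_coordJet (isMetricOn_chartMetric hc)
    ((contDiffOn_comp_chart_symm hc hu.contMDiffOn (S := univ)).mono fun _ hz => ⟨hz, mem_univ _⟩)

/-- Scalars that depend continuously on the jet of a smooth function are continuous on the
manifold. -/
lemma IsScalar.continuous {F : Jet n → ℝ} (hF : IsScalar F) (hFc : Continuous F) {u : M → ℝ}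
    (hu : ContMDiff (𝓡 n) 𝓘(ℝ, ℝ) ∞ u) : Continuous fun x => F (jetAt u x) :=
  continuous_of_chart fun _ hc => ⟨_, hFc.comp_continuousOn (contDiffOn_chartJet hc hu).continuousOn,
    fun _ hx => hF.jetAt_eq hc hu hx⟩

lemma exists_isFrame_jetAt (u : M → ℝ) (x : M) : ∃ b, IsFrame (jetAt (n := n) u x).A b :=
  exists_isFrame (isMetricOn_chartMetric (chartAt_mem_maximalAtlas' x))
    (mem_chart_target (Coord n) x)

/-! ### Covector fields -/

variable (n M) in
/-- A smooth covector field, given by its components in all smooth charts. -/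
structure CovectorField where
  /-- The components in a chart. -/
  comp : OpenPartialHomeomorph M (Coord n) → Fin n → Coord n → ℝ
  smooth : ∀ c ∈ IsManifold.maximalAtlas (𝓡 n) ∞ M, ∀ l, ContDiffOn ℝ ∞ (comp c l) c.target
  compat : ∀ c ∈ IsManifold.maximalAtlas (𝓡 n) ∞ M, ∀ c' ∈ IsManifold.maximalAtlas (𝓡 n) ∞ M,
    ∀ y ∈ c.target, c.symm y ∈ c'.source → ∀ v, ev (fun l => comp c l y) v
      = ev (fun l => comp c' l (c' (c.symm y))) (fderiv ℝ (fun z => c' (c.symm z)) y v)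

namespace CovectorField

/-- The divergence of a covector field. -/
def div (α : CovectorField n M) (x : M) : ℝ :=
  coordDiv (chartMetric (chartAt (Coord n) x)) (α.comp (chartAt (Coord n) x)) (chartAt (Coord n) x x)

lemma div_eq (α : CovectorField n M) (hc : c ∈ IsManifold.maximalAtlas (𝓡 n) ∞ M) {x : M}
    (hx : x ∈ c.source) : α.div x = coordDiv (chartMetric c) (α.comp c) (c x) := by
  set d := chartAt (Coord n) x with hd
  have hdm : d ∈ IsManifold.maximalAtlas (𝓡 n) ∞ M := chartAt_mem_maximalAtlas' x
  have hopen := isOpen_overlap d c (isOpen_univ (X := M))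
  have hopen' : IsOpen (c.target ∩ c.symm ⁻¹' (univ : Set M)) :=
    c.symm.isOpen_inter_preimage isOpen_univ
  have hxd : d x ∈ d.target := mem_chart_target (Coord n) x
  have h0 : d.symm (d x) = x := d.left_inv (mem_chart_source _ x)
  have h := (isIsometricMap_transition hdm hc (S := univ)).coordDiv_eq (y := d x)
    ((isMetricOn_chartMetric hdm).mono hopen inter_subset_left)
    ((isMetricOn_chartMetric hc).mono hopen' inter_subset_left)
    ⟨hxd, by simpa [h0] using hx⟩ (α := α.comp d) (α' := α.comp c)
    (fun j => (α.smooth d hdm j).diffAt d.open_target hxd)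
    (fun j => (α.smooth c hc j).diffAt c.open_target (by rw [h0]; exact c.map_source hx))
    fun z hz v => α.compat d hdm c hc z hz.1 hz.2.1 v
  rw [h0] at h
  exact h

lemma continuous_div (α : CovectorField n M) : Continuous α.div := by
  refine continuous_of_chart fun c hc => ⟨coordDiv (chartMetric c) (α.comp c), ?_, fun x hx =>
    α.div_eq hc hx⟩
  have hG := isMetricOn_chartMetric hc
  have h1 : ContDiffOn ℝ ∞ (coordDiv (chartMetric c) (α.comp c)) c.target :=
    ContDiffOn.sum fun i _ => ContDiffOn.sum fun j _ =>
      (hG.smooth_inv i j).mul (hG.smooth_cov1 (α.smooth c hc) i j)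
  exact h1.continuousOn

/-- The covector field given by a covector-valued function of the jet of `u`. -/
def ofJet (X : Jet n → Fin n → ℝ)
    (hX : ∀ J J' L, JetRel J J' L → ∀ v, ev (X J) v = ev (X J') (L v)) (u : M → ℝ)
    (hu : ContMDiff (𝓡 n) 𝓘(ℝ, ℝ) ∞ u)
    (hs : ∀ c ∈ IsManifold.maximalAtlas (𝓡 n) ∞ M, ∀ l,
      ContDiffOn ℝ ∞ (fun y => X (chartJet u c y) l) c.target) : CovectorField n M where
  comp c l y := X (chartJet u c y) l
  smooth := hs
  compat _ hc _ hc' _ hy hy' := hX _ _ _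
    (jetRel_chartJet hc hc' isOpen_univ hu.contMDiffOn hy hy' (mem_univ _))

/-- The product of a covector field with a smooth function. -/
def smul (ψ : M → ℝ) (hψ : ContMDiff (𝓡 n) 𝓘(ℝ, ℝ) ∞ ψ) (α : CovectorField n M) :
    CovectorField n M where
  comp c l y := ψ (c.symm y) * α.comp c l y
  smooth c hc l := ((contDiffOn_comp_chart_symm hc hψ.contMDiffOn (S := univ)).mono
    fun _ hz => ⟨hz, mem_univ _⟩).mul (α.smooth c hc l)
  compat c hc c' hc' y hy hy' v := by
    have h := α.compat c hc c' hc' y hy hy' v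
    simp only [ev_apply'] at h ⊢
    simp only [mul_left_comm _ (ψ _) _, ← Finset.mul_sum]
    rw [h, c'.left_inv hy']

end CovectorField

end Charts

/-! ### Pointwise identities for harmonic functions -/

section Pointwise

open Set

variable {n : ℕ} {M : Type*} [TopologicalSpace M] [ChartedSpace (Coord n) M]
  [RiemannianBundle (fun x : M => TangentSpace (𝓡 n) x)] {u : M → ℝ} {x : M}

lemma normGrad_eq_sqrt : normGrad n u x = √(jetAt (n := n) u x).gradSq := rfl
lemma normHess_eq_sqrt : normHess n u x = √(jetAt (n := n) u x).hessSq := rfl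
lemma normThird_eq_sqrt : normThird n u x = √(jetAt (n := n) u x).thirdSq := rfl
lemma normRiem_eq_sqrt : normRiem n x = √(jetAt (n := n) u x).riemSq := rfl
lemma normRic_eq_sqrt : normRic n x = √(jetAt (n := n) u x).ricSq := rfl
lemma ricSqGradGrad_eq_jetAt : ricSqGradGrad n u x = (jetAt (n := n) u x).ricSqGradGrad := rfl
lemma ricHessHess_eq_jetAt : ricHessHess n u x = (jetAt (n := n) u x).ricHessHess := rfl
lemma riemThirdGrad_eq_jetAt : riemThirdGrad n u x = (jetAt (n := n) u x).riemThirdGrad := rfl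
lemma riemHessHess_eq_jetAt : riemHessHess n u x = (jetAt (n := n) u x).riemHessHess := rfl
variable [IsManifold (𝓡 n) ∞ M]
  [IsContMDiffRiemannianBundle (𝓡 n) ∞ (Coord n) (fun x : M => TangentSpace (𝓡 n) x)]

section Continuity

variable (hu : ContMDiff (𝓡 n) 𝓘(ℝ, ℝ) ∞ u)
include hu

lemma continuous_normGrad : Continuous (normGrad n u) :=
  (IsScalar.continuous (fun _ _ _ h => h.gradSq) Jet.contDiff_gradSq.continuous hu).sqrt

lemma continuous_normHess : Continuous (normHess n u) :=
  (IsScalar.continuous (fun _ _ _ h => h.hessSq) Jet.contDiff_hessSq.continuous hu).sqrt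

lemma continuous_normThird : Continuous (normThird n u) :=
  (IsScalar.continuous (fun _ _ _ h => h.thirdSq) Jet.contDiff_thirdSq.continuous hu).sqrt

lemma continuous_ricGradLapGrad : Continuous (ricGradLapGrad n u) :=
  IsScalar.continuous (fun _ _ _ h => h.ricGradLapGrad) Jet.contDiff_ricGradLapGrad.continuous hu

lemma continuous_ricSqGradGrad : Continuous (ricSqGradGrad n u) :=
  IsScalar.continuous (fun _ _ _ h => h.ricSqGradGrad) Jet.contDiff_ricSqGradGrad.continuous hu

lemma continuous_ricHessHess : Continuous (ricHessHess n u) :=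
  IsScalar.continuous (fun _ _ _ h => h.ricHessHess) Jet.contDiff_ricHessHess.continuous hu

lemma continuous_riemThirdGrad : Continuous (riemThirdGrad n u) :=
  IsScalar.continuous (fun _ _ _ h => h.riemThirdGrad) Jet.contDiff_riemThirdGrad.continuous hu

lemma continuous_riemHessHess : Continuous (riemHessHess n u) :=
  IsScalar.continuous (fun _ _ _ h => h.riemHessHess) Jet.contDiff_riemHessHess.continuous hu

end Continuity

lemma continuous_normRiem : Continuous (normRiem n (M := M)) :=
  (IsScalar.continuous (u := fun _ => 0) (fun _ _ _ h => h.riemSq) Jet.contDiff_riemSq.continuous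
    contMDiff_const).sqrt

lemma continuous_normRic : Continuous (normRic n (M := M)) :=
  (IsScalar.continuous (u := fun _ => 0) (fun _ _ _ h => h.ricSq) Jet.contDiff_ricSq.continuous
    contMDiff_const).sqrt

/-- The covector field `∇^p ∇^i u ∇_p ∇_i ∇_l u`. -/
def thirdHessField (u : M → ℝ) (hu : ContMDiff (𝓡 n) 𝓘(ℝ, ℝ) ∞ u) : CovectorField n M :=
  .ofJet Jet.thirdHess (fun _ _ _ h => h.thirdHess) u hu fun _ hc l =>
    (Jet.contDiff_thirdHess l).comp_contDiffOn (contDiffOn_chartJet hc hu)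

/-- The covector field `∇_i ∇_l u (Δ∇u)^i`. -/
def hessLapGradField (u : M → ℝ) (hu : ContMDiff (𝓡 n) 𝓘(ℝ, ℝ) ∞ u) : CovectorField n M :=
  .ofJet Jet.hessLapGrad (fun _ _ _ h => h.hessLapGrad) u hu fun _ hc l =>
    (Jet.contDiff_hessLapGrad l).comp_contDiffOn (contDiffOn_chartJet hc hu)

/-- The covector field `(|∇²u|² + ε²)^{1/2} ∇^i u ∇_i ∇_l u`. The parameter `ε` makes the first
factor smooth at the zeros of the Hessian. -/
def weightedHessGradField (u : M → ℝ) (hu : ContMDiff (𝓡 n) 𝓘(ℝ, ℝ) ∞ u) (ε : ℝ) (hε : 0 < ε) :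
    CovectorField n M :=
  .ofJet (fun J l => √(J.hessSq + ε ^ 2) * J.hessGrad l)
    (fun J J' L h v => by
      have h1 := h.hessGrad v
      simp only [ev_apply'] at h1 ⊢
      simp only [mul_left_comm _ (√_) _, ← Finset.mul_sum]
      rw [h1, h.hessSq]) u hu fun c hc l => by
    have h1 := contDiffOn_chartJet hc hu
    refine ContDiffOn.mul (((Jet.contDiff_hessSq.comp_contDiffOn h1).add contDiffOn_const).sqrt
      fun y hy => ?_) ((Jet.contDiff_hessGrad l).comp_contDiffOn h1)
    obtain ⟨b, hb⟩ := exists_isFrame (isMetricOn_chartMetric hc) hy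
    have h4 := Jet.hessSq_nonneg (J := chartJet u c y) hb
    simp only [Function.comp]
    positivity

section Harmonic

variable (hu : ContMDiff (𝓡 n) 𝓘(ℝ, ℝ) ∞ u)
include hu

/-- A function that is harmonic near `x` is harmonic in coordinates. -/
lemma exists_lap_eq_zero {Ω : Set M} (hΩ : IsOpen Ω) (hlap : ∀ x ∈ Ω, laplacian n u x = 0)
    (hx : x ∈ Ω) : ∃ V, IsMetricOn (chartMetric (chartAt (Coord n) x)) V ∧
      ContDiffOn ℝ ∞ (fun z => u ((chartAt (Coord n) x).symm z)) V ∧ chartAt (Coord n) x x ∈ V ∧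
      ∀ z ∈ V, (coordJet (chartMetric (chartAt (Coord n) x))
        (fun z => u ((chartAt (Coord n) x).symm z)) z).lap = 0 := by
  have hd := chartAt_mem_maximalAtlas' (n := n) x
  set d := chartAt (Coord n) x
  refine ⟨d.target ∩ d.symm ⁻¹' Ω, (isMetricOn_chartMetric hd).mono
    (d.symm.isOpen_inter_preimage hΩ) inter_subset_left,
    contDiffOn_comp_chart_symm hd hu.contMDiffOn, ⟨mem_chart_target (Coord n) x, ?_⟩, ?_⟩
  · rw [mem_preimage, d.left_inv (mem_chart_source _ x)]
    exact hx
  · rintro z ⟨hz, hzΩ⟩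
    have h := IsScalar.jetAt_eq (F := Jet.lap) (fun _ _ _ h => h.lap) hd hu (d.map_target hz)
    rw [d.right_inv hz] at h
    exact h.symm.trans (hlap _ hzΩ)

variable {Ω : Set M} (hΩ : IsOpen Ω) (hlap : ∀ x ∈ Ω, laplacian n u x = 0) (hx : x ∈ Ω)
include hΩ hlap hx

/-- The pointwise identity whose integral over `Ω` is the integral identity. -/
lemma normThird_sq_eq : normThird n u x ^ 2
    = (thirdHessField u hu).div x - (hessLapGradField u hu).div x
      + (2 * ricGradLapGrad n u x - ricSqGradGrad n u x - ricHessHess n u x)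
      + (riemThirdGrad n u x - riemHessHess n u x) := by
  obtain ⟨V, hG, hf, hy, hl⟩ := exists_lap_eq_zero hu hΩ hlap hx
  obtain ⟨b, hb⟩ := exists_isFrame_jetAt (n := n) u x
  rw [normThird_eq_sqrt, Real.sq_sqrt (Jet.thirdSq_nonneg hb)]
  exact thirdSq_identity hG hf hy hl

lemma ricGradLapGrad_eq_of_harmonic : ricGradLapGrad n u x = ricSqGradGrad n u x := by
  obtain ⟨V, hG, hf, hy, hl⟩ := exists_lap_eq_zero hu hΩ hlap hx
  exact ricGradLapGrad_eq_ricSqGradGrad hG hf hy hl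

/-- The pointwise inequality whose integral over `Ω` bounds `∫ |∇²u|³`. -/
lemma normHess_cube_le {ε : ℝ} (hε : 0 < ε) : normHess n u x ^ 3
    ≤ (weightedHessGradField u hu ε hε).div x
      + normThird n u x * normHess n u x * normGrad n u x
      + (normHess n u x + ε) * (normRic n x * normGrad n u x ^ 2) := by
  obtain ⟨V, hG, hf, hy, hl⟩ := exists_lap_eq_zero hu hΩ hlap hx
  obtain ⟨b, hb⟩ := exists_isFrame_jetAt (n := n) u x
  have h := hessSq_le_coordDiv hG hf hy hl hε
  have h0 := Jet.hessSq_nonneg hb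
  have h1 := Jet.gradSq_nonneg hb
  change √((jetAt (n := n) u x).hessSq + ε ^ 2) * (jetAt (n := n) u x).hessSq
    ≤ (weightedHessGradField u hu ε hε).div x
      + normThird n u x * normHess n u x * normGrad n u x
      + √((jetAt (n := n) u x).hessSq + ε ^ 2) * (normRic n x * (jetAt (n := n) u x).gradSq) at h
  have h2 : (jetAt (n := n) u x).hessSq = normHess n u x ^ 2 := (Real.sq_sqrt h0).symm
  have h3 : (jetAt (n := n) u x).gradSq = normGrad n u x ^ 2 := (Real.sq_sqrt h1).symm
  have hH : 0 ≤ normHess n u x := Real.sqrt_nonneg _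
  have hR : 0 ≤ normRic n x := Real.sqrt_nonneg _
  rw [h2, h3] at h
  have h4 : normHess n u x ≤ √(normHess n u x ^ 2 + ε ^ 2) :=
    Real.le_sqrt_of_sq_le (by linarith [sq_nonneg ε])
  have h5 : √(normHess n u x ^ 2 + ε ^ 2) ≤ normHess n u x + ε :=
    Real.sqrt_le_iff.mpr ⟨by positivity, by nlinarith⟩
  calc normHess n u x ^ 3 = normHess n u x * normHess n u x ^ 2 := by ring
    _ ≤ √(normHess n u x ^ 2 + ε ^ 2) * normHess n u x ^ 2 := by gcongr
    _ ≤ _ := h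
    _ ≤ _ := by gcongr

end Harmonic

lemma ricSqGradGrad_le_norm : ricSqGradGrad n u x ≤ normRic n x ^ 2 * normGrad n u x ^ 2 := by
  obtain ⟨b, hb⟩ := exists_isFrame_jetAt (n := n) u x
  rw [ricSqGradGrad_eq_jetAt, normRic_eq_sqrt (u := u), normGrad_eq_sqrt,
    Real.sq_sqrt (Jet.ricSq_nonneg hb),
    Real.sq_sqrt (Jet.gradSq_nonneg hb)]
  exact Jet.ricSqGradGrad_le hb

lemma abs_riemThirdGrad_le_norm :
    |riemThirdGrad n u x| ≤ normRiem n x * normThird n u x * normGrad n u x := by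
  obtain ⟨b, hb⟩ := exists_isFrame_jetAt (n := n) u x
  rw [riemThirdGrad_eq_jetAt, normRiem_eq_sqrt (u := u), normThird_eq_sqrt, normGrad_eq_sqrt]
  exact Jet.abs_riemThirdGrad_le hb

lemma abs_riemHessHess_le_norm : |riemHessHess n u x| ≤ normRiem n x * normHess n u x ^ 2 := by
  obtain ⟨b, hb⟩ := exists_isFrame_jetAt (n := n) u x
  rw [riemHessHess_eq_jetAt, normRiem_eq_sqrt (u := u), normHess_eq_sqrt,
    Real.sq_sqrt (Jet.hessSq_nonneg hb)]
  exact Jet.abs_riemHessHess_le hb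

lemma abs_ricHessHess_le_norm : |ricHessHess n u x| ≤ normRic n x * normHess n u x ^ 2 := by
  obtain ⟨b, hb⟩ := exists_isFrame_jetAt (n := n) u x
  rw [ricHessHess_eq_jetAt, normRic_eq_sqrt (u := u), normHess_eq_sqrt,
    Real.sq_sqrt (Jet.hessSq_nonneg hb)]
  exact Jet.abs_ricHessHess_le hb

end Pointwise

/-! ### Measures that are given in parametrizations -/

section ParamMeasure

open MeasureTheory Set

/-- Measures `μ i` on sets `U i` that agree on the overlaps are the restrictions of their
supremum. -/
lemma iSup_restrict_eq_of_compatible {X ι : Type*} [MeasurableSpace X] {μ : ι → Measure X}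
    {U : ι → Set X} (hU : ∀ i, MeasurableSet (U i)) (h0 : ∀ i, (μ i) (U i)ᶜ = 0)
    (hμ : ∀ i j, (μ i).restrict (U j) = (μ j).restrict (U i)) (j : ι) :
    (⨆ i, μ i).restrict (U j) = μ j := by
  have hr : ∀ i, (μ i).restrict (U i) = μ i := fun i =>
    Measure.restrict_eq_self_of_ae_mem (by rw [ae_iff]; exact h0 i)
  refine le_antisymm ?_ ?_
  · have h1 : ⨆ i, μ i ≤ μ j + (⨆ i, μ i).restrict (U j)ᶜ := by
      refine iSup_le fun i => ?_
      calc μ i = (μ i).restrict (U j) + (μ i).restrict (U j)ᶜ :=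
            (Measure.restrict_add_restrict_compl (hU j)).symm
        _ ≤ _ := by
            rw [hμ i j]
            exact add_le_add Measure.restrict_le_self
              (Measure.restrict_mono' le_rfl.eventuallyLE (le_iSup μ i))
    have h2 := Measure.restrict_mono' (s := U j) le_rfl.eventuallyLE h1
    rwa [Measure.restrict_add, hr, Measure.restrict_restrict (hU j), inter_compl_self,
      Measure.restrict_empty, add_zero] at h2
  · calc μ j = (μ j).restrict (U j) := (hr j).symm
      _ ≤ _ := Measure.restrict_mono' le_rfl.eventuallyLE (le_iSup μ j)

lemma iSup_compl_eq_zero {X ι : Type*} [MeasurableSpace X] {μ : ι → Measure X} {A : Set X}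
    (hA : MeasurableSet A) (h0 : ∀ i, (μ i) Aᶜ = 0) : (⨆ i, μ i) Aᶜ = 0 := by
  have h1 : ⨆ i, μ i ≤ (⨆ i, μ i).restrict A := by
    refine iSup_le fun i => ?_
    calc μ i = (μ i).restrict A :=
          (Measure.restrict_eq_self_of_ae_mem (by rw [ae_iff]; exact h0 i)).symm
      _ ≤ _ := Measure.restrict_mono' le_rfl.eventuallyLE (le_iSup μ i)
  refine le_antisymm ((h1 Aᶜ).trans ?_) zero_le
  rw [Measure.restrict_apply hA.compl, compl_inter_self, measure_empty]

variable {E : Type*} [MeasureSpace E] {X : Type*} [MeasurableSpace X]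

/-- The image under `σ` of the measure with density `ρ` on the parameter domain `D`. -/
def paramMeasure (D : Set E) (ρ : E → ℝ) (σ : E → X) : Measure X :=
  (((volume : Measure E).restrict D).withDensity fun y => ENNReal.ofReal (ρ y)).map σ

variable {D D' : Set E} {ρ ρ' : E → ℝ} {σ σ' : E → X}

lemma paramMeasure_apply [SFinite (volume : Measure E)] (hD : MeasurableSet D)
    (hσ : AEMeasurable σ (volume.restrict D))
    {s : Set X} (hs : MeasurableSet s) :
    paramMeasure D ρ σ s = ∫⁻ y in D ∩ σ ⁻¹' s, ENNReal.ofReal (ρ y) := by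
  rw [paramMeasure, Measure.map_apply_of_aemeasurable
    (hσ.mono_ac (withDensity_absolutelyContinuous _ _)) hs, withDensity_apply',
    Measure.restrict_restrict' hD, inter_comm]

lemma paramMeasure_compl [SFinite (volume : Measure E)] (hD : MeasurableSet D)
    (hσ : AEMeasurable σ (volume.restrict D))
    {s : Set X} (hs : MeasurableSet s) (h : ∀ y ∈ D, σ y ∈ s) : paramMeasure D ρ σ sᶜ = 0 := by
  rw [paramMeasure_apply hD hσ hs.compl]
  have : D ∩ σ ⁻¹' sᶜ = ∅ := by
    ext y
    simp only [mem_inter_iff, mem_preimage, mem_compl_iff, mem_empty_iff_false, iff_false, not_and,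
      not_not]
    exact h y
  rw [this, Measure.restrict_empty, lintegral_zero_measure]

lemma integral_paramMeasure [TopologicalSpace X] [BorelSpace X] [SecondCountableTopology X]
    (hD : MeasurableSet D) (hσ : AEMeasurable σ (volume.restrict D))
    (hρ : AEMeasurable ρ (volume.restrict D)) (hρ0 : ∀ y ∈ D, 0 ≤ ρ y) {f : X → ℝ}
    (hf : AEStronglyMeasurable f (paramMeasure D ρ σ)) :
    ∫ x, f x ∂(paramMeasure D ρ σ) = ∫ y in D, ρ y * f (σ y) := by
  rw [paramMeasure, integral_map (hσ.mono_ac (withDensity_absolutelyContinuous _ _)) hf,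
    integral_withDensity_eq_integral_toReal_smul₀ hρ.ennreal_ofReal (by simp)]
  refine setIntegral_congr_fun hD fun y hy => ?_
  simp [ENNReal.toReal_ofReal (hρ0 y hy)]

lemma measurableSet_inter_preimage [TopologicalSpace E] [OpensMeasurableSpace E]
    [TopologicalSpace X] [BorelSpace X]
    (hD : MeasurableSet D) (hσ : ContinuousOn σ D) {s : Set X} (hs : MeasurableSet s) :
    MeasurableSet (D ∩ σ ⁻¹' s) := by
  have h1 : Measurable (D.domRestrict σ) :=
    (continuousOn_iff_continuous_domRestrict.mp hσ).measurable
  have h2 := hD.subtype_image (h1 hs)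
  convert h2 using 1
  ext y
  simp [domRestrict, and_comm]

/-- Two parametrizations that are related by a change of parameters `τ`, for which the densities
transform with the Jacobian of `τ`, define the same measure on the common part of their images. -/
lemma paramMeasure_restrict_eq [NormedAddCommGroup E] [NormedSpace ℝ E] [FiniteDimensional ℝ E]
    [BorelSpace E] [(volume : Measure E).IsAddHaarMeasure] [TopologicalSpace X] [BorelSpace X]
    (hD : MeasurableSet D) (hD' : MeasurableSet D') (hσ : ContinuousOn σ D)
    (hσ' : ContinuousOn σ' D')
    {U U' : Set X} (hU : MeasurableSet U) (hU' : MeasurableSet U')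
    {τ : E → E} {τ' : E → E →L[ℝ] E} (hτ : ∀ y ∈ D ∩ σ ⁻¹' U', HasFDerivAt τ (τ' y) y)
    (hinj : InjOn τ (D ∩ σ ⁻¹' U')) (himg : τ '' (D ∩ σ ⁻¹' U') = D' ∩ σ' ⁻¹' U)
    (hστ : ∀ y ∈ D ∩ σ ⁻¹' U', σ' (τ y) = σ y)
    (hρ : ∀ y ∈ D ∩ σ ⁻¹' U', ρ y = |(τ' y).det| * ρ' (τ y)) :
    (paramMeasure D ρ σ).restrict U' = (paramMeasure D' ρ' σ').restrict U := by
  ext s hs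
  rw [Measure.restrict_apply hs, Measure.restrict_apply hs,
    paramMeasure_apply hD (hσ.aemeasurable hD) (hs.inter hU'),
    paramMeasure_apply hD' (hσ'.aemeasurable hD') (hs.inter hU)]
  have h1 : D' ∩ σ' ⁻¹' (s ∩ U) = τ '' (D ∩ σ ⁻¹' (s ∩ U')) := by
    ext y'
    constructor
    · rintro ⟨hy', hys, hyU⟩
      obtain ⟨y, hy, rfl⟩ : y' ∈ τ '' (D ∩ σ ⁻¹' U') := himg ▸ ⟨hy', hyU⟩
      refine ⟨y, ⟨hy.1, ?_, hy.2⟩, rfl⟩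
      exact (hστ y hy) ▸ hys
    · rintro ⟨y, ⟨hy, hys, hyU⟩, rfl⟩
      have h2 : τ y ∈ D' ∩ σ' ⁻¹' U := himg ▸ ⟨y, ⟨hy, hyU⟩, rfl⟩
      refine ⟨h2.1, ?_, h2.2⟩
      exact (hστ y ⟨hy, hyU⟩).symm ▸ hys
  have hm : MeasurableSet (D ∩ σ ⁻¹' (s ∩ U')) :=
    measurableSet_inter_preimage hD hσ (hs.inter hU')
  have hsub : D ∩ σ ⁻¹' (s ∩ U') ⊆ D ∩ σ ⁻¹' U' := fun y hy => ⟨hy.1, hy.2.2⟩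
  rw [h1, lintegral_image_eq_lintegral_abs_det_fderiv_mul volume hm
    (fun y hy => (hτ y (hsub hy)).hasFDerivWithinAt) (hinj.mono hsub)]
  refine setLIntegral_congr_fun hm fun y hy => ?_
  rw [hρ y (hsub hy), ENNReal.ofReal_mul (abs_nonneg _)]

end ParamMeasure

/-! ### Volume and area in charts -/

section Volume

open MeasureTheory Set

lemma det_eq_of_pullback {k : ℕ} {A B K : Matrix (Fin k) (Fin k) ℝ}
    (h : ∀ i j, A i j = ∑ a, ∑ b, K a i * K b j * B a b) : A.det = K.det ^ 2 * B.det := by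
  have h1 : A = Kᵀ * B * K := by
    ext i j
    rw [h, Matrix.mul_apply]
    simp only [Matrix.mul_apply, Matrix.transpose_apply, Finset.sum_mul]
    rw [Finset.sum_comm]
    exact Finset.sum_congr rfl fun _ _ => Finset.sum_congr rfl fun _ _ => by ring
  rw [h1, Matrix.det_mul, Matrix.det_mul, Matrix.det_transpose]
  ring

lemma sqrt_det_eq_of_pullback {k : ℕ} {A B K : Matrix (Fin k) (Fin k) ℝ}
    (h : ∀ i j, A i j = ∑ a, ∑ b, K a i * K b j * B a b) : √A.det = |K.det| * √B.det := by
  rw [det_eq_of_pullback h, Real.sqrt_mul (sq_nonneg _), Real.sqrt_sq_eq_abs]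

lemma det_coord_eq {n : ℕ} (L : Coord n →L[ℝ] Coord n) :
    L.det = (Matrix.of fun i j => L (stdVec j) i).det := by
  rw [ContinuousLinearMap.det, ← LinearMap.det_toMatrix (EuclideanSpace.basisFun (Fin n) ℝ).toBasis]
  congr 1

variable {n : ℕ} {M : Type*} [TopologicalSpace M] {c c' : OpenPartialHomeomorph M (Coord n)}

lemma transition_injOn : InjOn (fun z => c' (c.symm z)) (c.target ∩ c.symm ⁻¹' c'.source) :=
  fun _ hy _ hz hyz => c.symm.injOn hy.1 hz.1 (c'.injOn hy.2 hz.2 hyz)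

lemma transition_image : (fun z => c' (c.symm z)) '' (c.target ∩ c.symm ⁻¹' c'.source)
    = c'.target ∩ c'.symm ⁻¹' c.source := by
  ext y
  constructor
  · rintro ⟨z, hz, rfl⟩
    refine ⟨c'.map_source hz.2, ?_⟩
    rw [mem_preimage, c'.left_inv hz.2]
    exact c.map_target hz.1
  · rintro ⟨hy, hy'⟩
    have h1 : c.symm (c (c'.symm y)) = c'.symm y := c.left_inv hy'
    refine ⟨c (c'.symm y), ⟨c.map_source hy', ?_⟩, ?_⟩
    · rw [mem_preimage, h1]
      exact c'.map_target hy
    · beta_reduce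
      rw [h1, c'.right_inv hy]

variable [ChartedSpace (Coord n) M]

lemma differentiableAt_transition (hc : c ∈ IsManifold.maximalAtlas (𝓡 n) ∞ M)
    (hc' : c' ∈ IsManifold.maximalAtlas (𝓡 n) ∞ M) {y : Coord n}
    (hy : y ∈ c.target ∩ c.symm ⁻¹' c'.source) :
    DifferentiableAt ℝ (fun z => c' (c.symm z)) y :=
  ((contDiffOn_transition hc hc').contDiffAt
    ((c.symm.isOpen_inter_preimage c'.open_source).mem_nhds hy)).differentiableAt (by simp)

variable [RiemannianBundle (fun x : M => TangentSpace (𝓡 n) x)]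

lemma transition_metric_apply (hc : c ∈ IsManifold.maximalAtlas (𝓡 n) ∞ M)
    (hc' : c' ∈ IsManifold.maximalAtlas (𝓡 n) ∞ M) {y : Coord n} (hy : y ∈ c.target)
    (hy' : c.symm y ∈ c'.source) (i j : Fin n) :
    chartMetric c y i j = ∑ a, ∑ b, fderiv ℝ (fun z => c' (c.symm z)) y (stdVec i) a
      * fderiv ℝ (fun z => c' (c.symm z)) y (stdVec j) b * chartMetric c' (c' (c.symm y)) a b := by
  have h := transition_metric hc hc' hy hy' (stdVec i) (stdVec j)
  rw [ev2_apply _ (fderiv ℝ _ _ _)] at h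
  refine Eq.trans ?_ h
  rw [ev2_apply]
  simp [stdVec]

variable [MeasurableSpace M]

lemma chartVolume_eq_paramMeasure : chartVolume c
    = paramMeasure c.target (fun y => √((chartMetric c y).det)) c.symm := rfl

variable [BorelSpace M]

lemma chartVolume_compl : chartVolume c c.sourceᶜ = 0 :=
  paramMeasure_compl c.open_target.measurableSet
    (c.continuousOn_symm.aemeasurable c.open_target.measurableSet) c.open_source.measurableSet
    fun _ hy => c.map_target hy

/-- The chart volumes of two charts agree on the overlap of the charts. -/
lemma chartVolume_restrict (hc : c ∈ IsManifold.maximalAtlas (𝓡 n) ∞ M)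
    (hc' : c' ∈ IsManifold.maximalAtlas (𝓡 n) ∞ M) :
    (chartVolume c).restrict c'.source = (chartVolume c').restrict c.source := by
  refine paramMeasure_restrict_eq c.open_target.measurableSet c'.open_target.measurableSet
    c.continuousOn_symm c'.continuousOn_symm c.open_source.measurableSet
    c'.open_source.measurableSet (fun y hy => (differentiableAt_transition hc hc' hy).hasFDerivAt)
    transition_injOn transition_image (fun y hy => c'.left_inv hy.2) fun y hy => ?_
  rw [det_coord_eq]
  refine sqrt_det_eq_of_pullback fun i j => ?_
  simpa only [Matrix.of_apply] using transition_metric_apply hc hc' hy.1 hy.2 i j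

variable [IsManifold (𝓡 n) ∞ M]

/-- In every smooth chart, the Riemannian volume is the measure with density `√(det g)`. -/
theorem riemannianVolume_restrict [SecondCountableTopology M]
    (hc : c ∈ IsManifold.maximalAtlas (𝓡 n) ∞ M) :
    (riemannianVolume n M).restrict c.source = chartVolume c := by
  have h1 : ∀ x : M, (riemannianVolume n M).restrict (chartAt (Coord n) x).source
      = chartVolume (chartAt (Coord n) x) := fun x =>
    iSup_restrict_eq_of_compatible (μ := fun x : M => chartVolume (chartAt (Coord n) x))
      (U := fun x : M => (chartAt (Coord n) x).source)
      (fun i => (chartAt (Coord n) i).open_source.measurableSet) (fun i => chartVolume_compl)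
      (fun i j =>
        chartVolume_restrict (chartAt_mem_maximalAtlas' i) (chartAt_mem_maximalAtlas' j)) x
  obtain ⟨T, hT, hcov⟩ := TopologicalSpace.countable_cover_nhds fun x : M =>
    (chartAt (Coord n) x).open_source.mem_nhds (mem_chart_source _ x)
  have : Countable T := hT.to_subtype
  rw [Measure.ext_iff_of_iUnion_eq_univ (s := fun x : T => (chartAt (Coord n) x.1).source)
    (by rw [← hcov, biUnion_eq_iUnion])]
  intro x
  rw [Measure.restrict_comm (chartAt (Coord n) x.1).open_source.measurableSet, h1,
    chartVolume_restrict (chartAt_mem_maximalAtlas' x.1) hc]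

end Volume

/-! ### The boundary in charts -/

section Boundary

open MeasureTheory Set Filter Topology

variable {m : ℕ}

/-- The inclusion of the hyperplane `{y₀ = 0}`. -/
def hyperplaneCLM (m : ℕ) : (Fin m → ℝ) →L[ℝ] Coord (m + 1) :=
  LinearMap.toContinuousLinearMap
    { toFun := hyperplanePoint
      map_add' := fun x y => by
        ext i
        refine Fin.cases ?_ (fun j => ?_) i <;> simp [hyperplanePoint]
      map_smul' := fun r x => by
        ext i
        refine Fin.cases ?_ (fun j => ?_) i <;> simp [hyperplanePoint] }

/-- The projection to the coordinates `y₁, …, yₘ`. -/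
def tailCLM (m : ℕ) : Coord (m + 1) →L[ℝ] (Fin m → ℝ) :=
  LinearMap.toContinuousLinearMap
    { toFun := fun y i => y i.succ
      map_add' := fun _ _ => rfl
      map_smul' := fun _ _ => rfl }

lemma hyperplaneCLM_apply (z : Fin m → ℝ) : hyperplaneCLM m z = hyperplanePoint z := rfl

lemma tailCLM_apply (y : Coord (m + 1)) (i : Fin m) : tailCLM m y i = y i.succ := rfl

lemma hyperplanePoint_zero (z : Fin m → ℝ) : hyperplanePoint z 0 = 0 := rfl

lemma hyperplanePoint_succ (z : Fin m → ℝ) (i : Fin m) : hyperplanePoint z i.succ = z i := rfl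

lemma tailCLM_hyperplanePoint (z : Fin m → ℝ) : tailCLM m (hyperplanePoint z) = z := rfl

lemma hyperplanePoint_tail {y : Coord (m + 1)} (hy : y 0 = 0) :
    hyperplanePoint (tailCLM m y) = y := by
  ext i
  refine Fin.cases ?_ (fun j => ?_) i
  · exact hy.symm
  · rfl

lemma hyperplanePoint_single (j : Fin m) :
    hyperplanePoint (Pi.single j (1 : ℝ)) = stdVec j.succ := by
  ext i
  refine Fin.cases ?_ (fun k => ?_) i
  · simp [hyperplanePoint_zero, stdVec]
  · simp [hyperplanePoint_succ, stdVec, Pi.single_apply]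

lemma continuous_hyperplanePoint : Continuous (hyperplanePoint (m := m)) :=
  (hyperplaneCLM m).continuous

section Charts

variable {M : Type*} [TopologicalSpace M] [ChartedSpace (Coord (m + 1)) M] {Ω : Set M}
  {c c' : OpenPartialHomeomorph M (Coord (m + 1))}

/-- In a boundary chart the boundary is the hyperplane `{y₀ = 0}`. -/
lemma IsBoundaryChart.mem_frontier_iff (hc : IsBoundaryChart Ω c) (hΩ : IsOpen Ω) {x : M}
    (hx : x ∈ c.source) : x ∈ frontier Ω ↔ c x 0 = 0 := by
  have h0 : Continuous fun y : Coord (m + 1) => y 0 := (EuclideanSpace.proj (𝕜 := ℝ) 0).continuous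
  rw [hΩ.frontier_eq]
  constructor
  · rintro ⟨hcl, hn⟩
    refine le_antisymm ?_ (not_lt.mp fun h => hn ((hc.2 x hx).mpr h))
    by_contra! hpos
    have h1 : ∀ᶠ z in 𝓝 x, z ∈ c.source ∧ 0 < c z 0 :=
      Filter.Eventually.and (c.open_source.mem_nhds hx)
        ((h0.continuousAt.comp (c.continuousAt hx)).eventually (lt_mem_nhds hpos))
    obtain ⟨z, ⟨hz, hz'⟩, hzΩ⟩ := mem_closure_iff_nhds.mp hcl _ h1
    exact lt_asymm hz' ((hc.2 z hz).mp hzΩ)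
  · intro hx0
    refine ⟨?_, fun h => ((hc.2 x hx).mp h).ne hx0⟩
    have h1 : Tendsto (fun t : ℝ => c x - t • stdVec 0) (𝓝[>] 0) (𝓝 (c x)) := by
      have h2 : Continuous fun t : ℝ => c x - t • (stdVec 0 : Coord (m + 1)) := by fun_prop
      have h3 := h2.tendsto 0
      rw [zero_smul, sub_zero] at h3
      exact h3.mono_left nhdsWithin_le_nhds
    have h2 := (c.continuousAt_symm (c.map_source hx)).tendsto.comp h1
    rw [c.left_inv hx] at h2
    refine mem_closure_of_tendsto h2 ?_
    filter_upwards [h1 (c.open_target.mem_nhds (c.map_source hx)), self_mem_nhdsWithin]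
      with t ht ht0
    rw [Function.comp_apply, hc.2 _ (c.map_target ht), c.right_inv ht]
    have : (c x - t • (stdVec 0 : Coord (m + 1))) 0 = -t := by simp [stdVec, hx0]
    rw [this]
    exact neg_lt_zero.mpr ht0

lemma IsBoundaryChart.symm_mem_frontier (hc : IsBoundaryChart Ω c) (hΩ : IsOpen Ω) {z : Fin m → ℝ}
    (hz : hyperplanePoint z ∈ c.target) : c.symm (hyperplanePoint z) ∈ frontier Ω := by
  rw [hc.mem_frontier_iff hΩ (c.map_target hz), c.right_inv hz, hyperplanePoint_zero]

/-- A change of boundary charts maps the hyperplane `{y₀ = 0}` to itself. -/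
lemma IsBoundaryChart.transition_zero (hc : IsBoundaryChart Ω c) (hc' : IsBoundaryChart Ω c')
    (hΩ : IsOpen Ω) {z : Fin m → ℝ} (hz : hyperplanePoint z ∈ c.target)
    (hz' : c.symm (hyperplanePoint z) ∈ c'.source) : c' (c.symm (hyperplanePoint z)) 0 = 0 :=
  (hc'.mem_frontier_iff hΩ hz').mp (hc.symm_mem_frontier hΩ hz)

/-- The differential of a change of boundary charts maps the hyperplane `{y₀ = 0}` to itself. -/
lemma IsBoundaryChart.fderiv_transition_zero (hc : IsBoundaryChart Ω c)
    (hc' : IsBoundaryChart Ω c') (hΩ : IsOpen Ω) {z : Fin m → ℝ} (hz : hyperplanePoint z ∈ c.target)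
    (hz' : c.symm (hyperplanePoint z) ∈ c'.source) (v : Fin m → ℝ) :
    fderiv ℝ (fun y => c' (c.symm y)) (hyperplanePoint z) (hyperplanePoint v) 0 = 0 := by
  have hd := (differentiableAt_transition hc.1 hc'.1 ⟨hz, hz'⟩).hasFDerivAt
  have h1 : HasFDerivAt (fun w : Fin m → ℝ => c' (c.symm (hyperplanePoint w)) 0)
      ((EuclideanSpace.proj (𝕜 := ℝ) 0 : Coord (m + 1) →L[ℝ] ℝ).comp
        ((fderiv ℝ (fun y => c' (c.symm y)) (hyperplanePoint z)).comp (hyperplaneCLM m))) z :=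
    (EuclideanSpace.proj (𝕜 := ℝ) 0 : Coord (m + 1) →L[ℝ] ℝ).hasFDerivAt.comp z
      (HasFDerivAt.comp z hd (hyperplaneCLM m).hasFDerivAt)
  have h2 : (fun w : Fin m → ℝ => c' (c.symm (hyperplanePoint w)) 0) =ᶠ[𝓝 z] fun _ => 0 := by
    have hO := c.symm.isOpen_inter_preimage c'.open_source
    filter_upwards [(hO.preimage continuous_hyperplanePoint).mem_nhds ⟨hz, hz'⟩] with w hw
    exact hc.transition_zero hc' hΩ hw.1 hw.2
  have h3 := h1.unique ((hasFDerivAt_const (0 : ℝ) z).congr_of_eventuallyEq h2)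
  exact DFunLike.congr_fun h3 v

lemma isOpen_hyperplane_target : IsOpen {z : Fin m → ℝ | hyperplanePoint z ∈ c.target} :=
  c.open_target.preimage continuous_hyperplanePoint

lemma continuousOn_symm_hyperplane : ContinuousOn (fun z : Fin m → ℝ => c.symm (hyperplanePoint z))
    {z | hyperplanePoint z ∈ c.target} :=
  c.continuousOn_symm.comp continuous_hyperplanePoint.continuousOn fun _ hz => hz

variable [RiemannianBundle (fun x : M => TangentSpace (𝓡 (m + 1)) x)] [MeasurableSpace M]

lemma chartArea_eq_paramMeasure : chartArea c
    = paramMeasure {z | hyperplanePoint z ∈ c.target}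
      (fun z => √((chartMetric c (hyperplanePoint z)).submatrix Fin.succ Fin.succ).det)
      (fun z => c.symm (hyperplanePoint z)) := rfl

variable [BorelSpace M]

lemma chartArea_compl {s : Set M} (hs : MeasurableSet s)
    (h : ∀ z, hyperplanePoint z ∈ c.target → c.symm (hyperplanePoint z) ∈ s) :
    chartArea c sᶜ = 0 :=
  paramMeasure_compl isOpen_hyperplane_target.measurableSet
    (continuousOn_symm_hyperplane.aemeasurable isOpen_hyperplane_target.measurableSet) hs h

lemma det_pi_eq {k : ℕ} (L : (Fin k → ℝ) →L[ℝ] (Fin k → ℝ)) :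
    L.det = (Matrix.of fun i j => L (Pi.single j 1) i).det := by
  rw [ContinuousLinearMap.det, ← LinearMap.det_toMatrix']
  congr 1

/-- The chart areas of two boundary charts agree on the overlap of the charts. The change of
parameters is the change of charts, restricted to the hyperplane `{y₀ = 0}`. -/
lemma chartArea_restrict (hc : IsBoundaryChart Ω c) (hc' : IsBoundaryChart Ω c') (hΩ : IsOpen Ω) :
    (chartArea c).restrict c'.source = (chartArea c').restrict c.source := by
  have hz0 : ∀ {c c' : OpenPartialHomeomorph M (Coord (m + 1))}, IsBoundaryChart Ω c →
      IsBoundaryChart Ω c' → ∀ z, hyperplanePoint z ∈ c.target →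
      c.symm (hyperplanePoint z) ∈ c'.source →
      hyperplanePoint (tailCLM m (c' (c.symm (hyperplanePoint z))))
        = c' (c.symm (hyperplanePoint z)) := fun hc hc' z hz hz' =>
    hyperplanePoint_tail (hc.transition_zero hc' hΩ hz hz')
  refine paramMeasure_restrict_eq isOpen_hyperplane_target.measurableSet
    isOpen_hyperplane_target.measurableSet continuousOn_symm_hyperplane
    continuousOn_symm_hyperplane c.open_source.measurableSet c'.open_source.measurableSet
    (τ := fun z => tailCLM m (c' (c.symm (hyperplanePoint z))))
    (τ' := fun z => (tailCLM m).comp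
      ((fderiv ℝ (fun y => c' (c.symm y)) (hyperplanePoint z)).comp (hyperplaneCLM m)))
    (fun z hz => ?_) (fun z hz w hw hzw => ?_) ?_ (fun z hz => ?_) fun z hz => ?_
  · exact (tailCLM m).hasFDerivAt.comp z (HasFDerivAt.comp z
      (differentiableAt_transition hc.1 hc'.1 ⟨hz.1, hz.2⟩).hasFDerivAt
      (hyperplaneCLM m).hasFDerivAt)
  · have h1 := congrArg hyperplanePoint hzw
    beta_reduce at h1
    rw [hz0 hc hc' z hz.1 hz.2, hz0 hc hc' w hw.1 hw.2] at h1
    have h2 := transition_injOn (c := c) (c' := c') ⟨hz.1, hz.2⟩ ⟨hw.1, hw.2⟩ h1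
    exact congrArg (tailCLM m) h2
  · ext z'
    constructor
    · rintro ⟨z, hz, rfl⟩
      simp only [mem_inter_iff, mem_ofPred_eq, mem_preimage]
      rw [hz0 hc hc' z hz.1 hz.2, c'.left_inv hz.2]
      exact ⟨c'.map_source hz.2, c.map_target hz.1⟩
    · rintro ⟨hz, hz'⟩
      have h1 := hz0 hc' hc z' hz hz'
      have h2 : c.symm (c (c'.symm (hyperplanePoint z'))) = c'.symm (hyperplanePoint z') :=
        c.left_inv hz'
      refine ⟨tailCLM m (c (c'.symm (hyperplanePoint z'))), ⟨?_, ?_⟩, ?_⟩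
      · rw [mem_ofPred_eq, h1]
        exact c.map_source hz'
      · simp only [mem_preimage]
        rw [h1, h2]
        exact c'.map_target hz
      · beta_reduce
        rw [h1, h2, c'.right_inv hz, tailCLM_hyperplanePoint]
  · beta_reduce
    rw [hz0 hc hc' z hz.1 hz.2]
    exact c'.left_inv hz.2
  · beta_reduce
    rw [hz0 hc hc' z hz.1 hz.2, det_pi_eq]
    refine sqrt_det_eq_of_pullback fun i j => ?_
    rw [Matrix.submatrix_apply, transition_metric_apply hc.1 hc'.1 hz.1 hz.2, Fin.sum_univ_succ]
    have h3 : ∀ j : Fin m,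
        fderiv ℝ (fun y => c' (c.symm y)) (hyperplanePoint z) (stdVec j.succ) 0 = 0 := fun j => by
      rw [← hyperplanePoint_single]
      exact hc.fderiv_transition_zero hc' hΩ hz.1 hz.2 _
    simp only [h3, zero_mul, Finset.sum_const_zero, zero_add]
    refine Finset.sum_congr rfl fun a _ => ?_
    rw [Fin.sum_univ_succ, h3]
    simp only [mul_zero, zero_mul, zero_add, Matrix.of_apply, ContinuousLinearMap.comp_apply,
      hyperplaneCLM_apply, hyperplanePoint_single, tailCLM_apply, Matrix.submatrix_apply]

/-- In every boundary chart, the area of the boundary is the measure with density `√(det h)`. -/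
theorem boundaryArea_restrict (hc : IsBoundaryChart Ω c) (hΩ : IsOpen Ω) :
    (boundaryArea m Ω).restrict c.source = chartArea c :=
  iSup_restrict_eq_of_compatible
    (μ := fun c : {c : OpenPartialHomeomorph M (Coord (m + 1)) // IsBoundaryChart Ω c} =>
      chartArea c.1)
    (U := fun c => c.1.source) (fun i => i.1.open_source.measurableSet)
    (fun i => chartArea_compl i.1.open_source.measurableSet fun _ hz => i.1.map_target hz)
    (fun i j => chartArea_restrict i.2 j.2 hΩ) ⟨c, hc⟩

lemma boundaryArea_compl_frontier (hΩ : IsOpen Ω) : boundaryArea m Ω (frontier Ω)ᶜ = 0 :=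
  iSup_compl_eq_zero isClosed_frontier.measurableSet fun i =>
    chartArea_compl isClosed_frontier.measurableSet fun _ hz => i.2.symm_mem_frontier hΩ hz

end Charts

end Boundary

/-! ### The outward unit normal -/

section Normal

open MeasureTheory Set Filter Topology

lemma pairing_frame {n : ℕ} {J : Jet n} {b : Fin n → Coord n} (hb : IsFrame J.A b)
    (β : Fin n → ℝ) : ∑ l, β l * J.gradUp l = ∑ a, ev β (b a) * ev J.D (b a) := by
  have h1 : ∑ l, β l * J.gradUp l = ∑ i, ∑ j, J.A i j * (β i * J.D j) := by
    simp only [Jet.gradUp, Finset.mul_sum]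
    exact Finset.sum_congr rfl fun _ _ => Finset.sum_congr rfl fun _ _ => by ring
  rw [h1, contract_frame hb]
  refine Finset.sum_congr rfl fun a _ => ?_
  simp only [ev2_apply, ev_apply', Finset.sum_mul_sum]
  exact Finset.sum_congr rfl fun _ _ => Finset.sum_congr rfl fun _ _ => by ring

/-- Cramer's rule for the first diagonal entry of the inverse: the determinant of the metric that is
induced on the hyperplane `{y₀ = 0}` is `det g · g^00`. -/
lemma det_submatrix_succ {m : ℕ} {A : Matrix (Fin (m + 1)) (Fin (m + 1)) ℝ} (hA : IsUnit A.det) :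
    (A.submatrix Fin.succ Fin.succ).det = A.det * A⁻¹ 0 0 := by
  rw [Matrix.inv_def, Matrix.smul_apply, Matrix.adjugate_fin_succ_eq_det_submatrix,
    Ring.inverse_eq_inv', smul_eq_mul, mul_inv_cancel_left₀ hA.ne_zero]
  simp [Fin.succAbove_zero]

variable {m : ℕ} {M : Type*} [TopologicalSpace M] [ChartedSpace (Coord (m + 1)) M] {Ω : Set M}
  {c c' : OpenPartialHomeomorph M (Coord (m + 1))}

lemma contMDiffOn_chart_coord (hc : c ∈ IsManifold.maximalAtlas (𝓡 (m + 1)) ∞ M) :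
    ContMDiffOn (𝓡 (m + 1)) 𝓘(ℝ, ℝ) ∞ (fun x => c x 0) c.source :=
  ((EuclideanSpace.proj (𝕜 := ℝ) 0 : Coord (m + 1) →L[ℝ] ℝ).contMDiff).comp_contMDiffOn
    (contMDiffOn_of_mem_maximalAtlas hc)

/-- A change of boundary charts has a positive derivative in the transversal direction. -/
lemma IsBoundaryChart.fderiv_transition_pos
    [RiemannianBundle (fun x : M => TangentSpace (𝓡 (m + 1)) x)]
    [IsManifold (𝓡 (m + 1)) ∞ M]
    [IsContMDiffRiemannianBundle (𝓡 (m + 1)) ∞ (Coord (m + 1))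
      (fun x : M => TangentSpace (𝓡 (m + 1)) x)]
    (hc : IsBoundaryChart Ω c) (hc' : IsBoundaryChart Ω c')
    (hΩ : IsOpen Ω) {z : Fin m → ℝ} (hz : hyperplanePoint z ∈ c.target)
    (hz' : c.symm (hyperplanePoint z) ∈ c'.source) :
    0 < fderiv ℝ (fun y => c' (c.symm y)) (hyperplanePoint z) (stdVec 0) 0 := by
  set y := hyperplanePoint z with hy
  set L := fderiv ℝ (fun y => c' (c.symm y)) y with hL
  have hne : L (stdVec 0) 0 ≠ 0 := by
    intro h0
    obtain ⟨v, hv⟩ := (isIsometricMap_transition hc.1 hc'.1 (S := univ)).surj y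
      ⟨hz, hz', mem_univ _⟩ (stdVec 0)
    have h1 : L v 0 = 1 := by
      rw [hL, hv]
      simp [stdVec]
    rw [← sum_smul_stdVec v, map_sum, Fin.sum_univ_succ] at h1
    have h2 : ∀ j : Fin m, L (stdVec j.succ) 0 = 0 := fun j => by
      rw [← hyperplanePoint_single]
      exact hc.fderiv_transition_zero hc' hΩ hz hz' _
    simp [h0, h2] at h1
  refine lt_of_le_of_ne ?_ hne.symm
  -- on the ray `t < 0` the function `c' · 0` is negative, so its difference quotients are positive
  have hd := (differentiableAt_transition hc.1 hc'.1 ⟨hz, hz'⟩).hasFDerivAt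
  have hline : HasDerivAt (fun t : ℝ => y + t • (stdVec 0 : Coord (m + 1))) (stdVec 0) 0 := by
    simpa using ((hasDerivAt_id (0 : ℝ)).smul_const (stdVec 0 : Coord (m + 1))).const_add y
  have hd' : HasFDerivAt (fun y => c' (c.symm y)) L (y + (0 : ℝ) • (stdVec 0 : Coord (m + 1))) := by
    rw [zero_smul, add_zero]
    exact hd
  have h1 : HasDerivAt (fun t : ℝ => c' (c.symm (y + t • (stdVec 0 : Coord (m + 1)))) 0)
      (L (stdVec 0) 0) 0 := by
    have h0 : HasDerivAt (fun t : ℝ => c' (c.symm (y + t • (stdVec 0 : Coord (m + 1)))))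
      (L (stdVec 0)) 0 :=
      HasFDerivAt.comp_hasDerivAt (f := fun t : ℝ => y + t • (stdVec 0 : Coord (m + 1))) 0 hd' hline
    exact (EuclideanSpace.proj (𝕜 := ℝ) 0 : Coord (m + 1) →L[ℝ] ℝ).hasFDerivAt.comp_hasDerivAt 0 h0
  have h2 := (hasDerivAt_iff_tendsto_slope.mp h1).mono_left
    (nhdsWithin_mono 0 fun t (ht : t ∈ Iio (0 : ℝ)) => ne_of_lt ht)
  refine ge_of_tendsto h2 ?_
  have hO := c.symm.isOpen_inter_preimage c'.open_source
  have h3 : ∀ᶠ t : ℝ in 𝓝 0,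
      y + t • (stdVec 0 : Coord (m + 1)) ∈ c.target ∩ c.symm ⁻¹' c'.source := by
    refine hline.continuousAt.eventually (hO.mem_nhds ?_)
    beta_reduce
    rw [zero_smul, add_zero]
    exact ⟨hz, hz'⟩
  filter_upwards [nhdsWithin_le_nhds h3, self_mem_nhdsWithin] with t ht ht0
  have h4 : c' (c.symm (y + t • (stdVec 0 : Coord (m + 1)))) 0 < 0 := by
    rw [← hc'.2 _ ht.2, hc.2 _ (c.map_target ht.1), c.right_inv ht.1]
    have : (y + t • (stdVec 0 : Coord (m + 1))) 0 = t := by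
      simp [stdVec, hy, hyperplanePoint_zero]
    rw [this]
    exact ht0
  have h5 : c' (c.symm (y + (0 : ℝ) • (stdVec 0 : Coord (m + 1)))) 0 = 0 := by
    rw [zero_smul, add_zero]
    exact hc.transition_zero hc' hΩ hz hz'
  rw [slope_def_field, h5, sub_zero, sub_zero]
  exact (div_pos_of_neg_of_neg h4 ht0).le

variable [RiemannianBundle (fun x : M => TangentSpace (𝓡 (m + 1)) x)]
  [IsManifold (𝓡 (m + 1)) ∞ M]
  [IsContMDiffRiemannianBundle (𝓡 (m + 1)) ∞ (Coord (m + 1))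
    (fun x : M => TangentSpace (𝓡 (m + 1)) x)]

namespace CovectorField

/-- The value `α(ν)` of a covector field on the outward unit normal. -/
def flux (α : CovectorField (m + 1) M) (Ω : Set M) (x : M) : ℝ :=
  ∑ l, α.comp (chartAt (Coord (m + 1)) x) l (chartAt (Coord (m + 1)) x x) * outwardNormal Ω x l

/-- In a boundary chart, `α(ν) = g^0j α_j / (g^00)^{1/2}`. -/
lemma flux_eq (α : CovectorField (m + 1) M) (hΩ : IsOpen Ω) (hc : IsBoundaryChart Ω c) {x : M}
    (hx : x ∈ c.source) (hx0 : c x 0 = 0) : α.flux Ω x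
      = (∑ j, (chartMetric c (c x))⁻¹ 0 j * α.comp c j (c x)) / √((chartMetric c (c x))⁻¹ 0 0) := by
  have h : ∃ c : OpenPartialHomeomorph M (Coord (m + 1)), IsBoundaryChart Ω c ∧ x ∈ c.source :=
    ⟨c, hc, hx⟩
  set c₀ := h.choose with hc₀
  have h₀ : IsBoundaryChart Ω c₀ ∧ x ∈ c₀.source := h.choose_spec
  set d := chartAt (Coord (m + 1)) x with hd
  have hdm : d ∈ IsManifold.maximalAtlas (𝓡 (m + 1)) ∞ M := chartAt_mem_maximalAtlas' x
  set J : Jet (m + 1) := jetAt (fun z => c₀ z 0) x with hJ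
  set J' : Jet (m + 1) := chartJet (fun z => c₀ z 0) c (c x) with hJ'
  have rel := jetRel_jetAt hc.1 c₀.open_source (contMDiffOn_chart_coord h₀.1.1) hx h₀.2
  rw [← hJ, ← hJ'] at rel
  have hν : ∀ l, outwardNormal Ω x l = J.gradUp l / √J.gradSq := fun l => by
    rw [outwardNormal, dif_pos h]
    rfl
  obtain ⟨b, hb⟩ := rel.exists_frame
  have hxd : d.symm (d x) = x := d.left_inv (mem_chart_source _ x)
  have h1 : ∑ l, α.comp d l (d x) * J.gradUp l = ∑ l, α.comp c l (c x) * J'.gradUp l := by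
    rw [pairing_frame hb, pairing_frame (rel.frame b hb)]
    refine Finset.sum_congr rfl fun a _ => ?_
    rw [rel.D, α.compat d hdm c hc.1 (d x) (mem_chart_target _ x) (by rwa [hxd]), hxd]
  -- the defining function in the chart `c`
  set z := tailCLM m (c x) with hz
  have hzx : hyperplanePoint z = c x := hyperplanePoint_tail hx0
  have hzt : hyperplanePoint z ∈ c.target := by
    rw [hzx]
    exact c.map_source hx
  have hzs : c.symm (hyperplanePoint z) ∈ c₀.source := by
    rw [hzx, c.left_inv hx]
    exact h₀.2
  have hD : ∀ i, J'.D i = fderiv ℝ (fun y => c₀ (c.symm y)) (c x) (stdVec i) 0 := fun i => by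
    have h2 : DifferentiableAt ℝ (fun y => c₀ (c.symm y)) (c x) := by
      rw [← hzx]
      exact differentiableAt_transition hc.1 h₀.1.1 ⟨hzt, hzs⟩
    have h3 : HasFDerivAt (fun y => c₀ (c.symm y) 0)
        ((EuclideanSpace.proj (𝕜 := ℝ) 0 : Coord (m + 1) →L[ℝ] ℝ).comp
          (fderiv ℝ (fun y => c₀ (c.symm y)) (c x))) (c x) :=
      (EuclideanSpace.proj (𝕜 := ℝ) 0 : Coord (m + 1) →L[ℝ] ℝ).hasFDerivAt.comp (c x) h2.hasFDerivAt
    exact DFunLike.congr_fun h3.fderiv (stdVec i)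
  set k := J'.D 0 with hk
  have hk0 : 0 < k := by
    rw [hk, hD, ← hzx]
    exact hc.fderiv_transition_pos h₀.1 hΩ hzt hzs
  have hDs : ∀ j : Fin m, J'.D j.succ = 0 := fun j => by
    rw [hD, ← hzx, ← hyperplanePoint_single]
    exact hc.fderiv_transition_zero h₀.1 hΩ hzt hzs _
  have hgrad : ∀ l, J'.gradUp l = (chartMetric c (c x))⁻¹ 0 l * k := fun l => by
    rw [Jet.gradUp, Fin.sum_univ_succ]
    simp only [hDs, mul_zero, Finset.sum_const_zero, add_zero]
    rw [(isMetricOn_chartMetric hc.1).inv_symm (c.map_source hx)]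
    rfl
  have hsq : J'.gradSq = (chartMetric c (c x))⁻¹ 0 0 * k ^ 2 := by
    rw [Jet.gradSq_frame (rel.frame b hb)]
    have h4 := pairing_frame (rel.frame b hb) J'.D
    rw [Fin.sum_univ_succ] at h4
    simp only [hDs, zero_mul, Finset.sum_const_zero, add_zero, hgrad] at h4
    simp only [sq (ev _ _), ← h4]
    ring
  change ∑ l, α.comp d l (d x) * outwardNormal Ω x l = _
  simp only [hν, ← mul_div_assoc]
  rw [← Finset.sum_div, h1, rel.gradSq, hsq, Real.sqrt_mul' _ (sq_nonneg k), Real.sqrt_sq hk0.le]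
  simp only [hgrad, ← mul_assoc]
  rw [← Finset.sum_mul, mul_div_mul_right _ _ hk0.ne']
  simp only [mul_comm]

/-- The density of the boundary area cancels the normalization of the normal. -/
lemma sqrt_det_mul_flux (α : CovectorField (m + 1) M) (hΩ : IsOpen Ω) (hc : IsBoundaryChart Ω c)
    {z : Fin m → ℝ} (hz : hyperplanePoint z ∈ c.target) :
    √((chartMetric c (hyperplanePoint z)).submatrix Fin.succ Fin.succ).det
      * α.flux Ω (c.symm (hyperplanePoint z))
      = √(chartMetric c (hyperplanePoint z)).det
        * ∑ j, (chartMetric c (hyperplanePoint z))⁻¹ 0 j * α.comp c j (hyperplanePoint z) := by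
  have hG := isMetricOn_chartMetric hc.1
  have h0 : 0 < (chartMetric c (hyperplanePoint z))⁻¹ 0 0 := (hG.posDef _ hz).inv.diag_pos
  rw [α.flux_eq hΩ hc (c.map_target hz) (by rw [c.right_inv hz, hyperplanePoint_zero]),
    c.right_inv hz, det_submatrix_succ (hG.isUnit_det hz), Real.sqrt_mul' _ h0.le, mul_assoc,
    mul_div_cancel₀ _ (Real.sqrt_pos.mpr h0).ne']

lemma continuousOn_flux (α : CovectorField (m + 1) M) (hΩ : IsOpen Ω) (hb : HasSmoothBoundary m Ω) :
    ContinuousOn (α.flux Ω) (frontier Ω) := by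
  intro x hx
  obtain ⟨c, hc, hxc⟩ := hb x hx
  have hG := isMetricOn_chartMetric hc.1
  have h1 : ContinuousAt (fun x => (∑ j, (chartMetric c (c x))⁻¹ 0 j * α.comp c j (c x))
      / √((chartMetric c (c x))⁻¹ 0 0)) x := by
    have hy := c.map_source hxc
    have h2 : ContinuousAt (fun y => (∑ j, (chartMetric c y)⁻¹ 0 j * α.comp c j y)
        / √((chartMetric c y)⁻¹ 0 0)) (c x) := by
      have hn := c.open_target.mem_nhds hy
      have h3 : 0 < (chartMetric c (c x))⁻¹ 0 0 := (hG.posDef _ hy).inv.diag_pos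
      refine ContinuousAt.div ?_ (((hG.smooth_inv 0 0).continuousOn.continuousAt hn).sqrt)
        (Real.sqrt_pos.mpr h3).ne'
      exact tendsto_finsetSum _ fun j _ => ((hG.smooth_inv 0 j).continuousOn.continuousAt hn).mul
        ((α.smooth c hc.1 j).continuousOn.continuousAt hn)
    exact ContinuousAt.comp (f := c) h2 (c.continuousAt hxc)
  refine h1.continuousWithinAt.congr_of_eventuallyEq ?_
    (α.flux_eq hΩ hc hxc ((hc.mem_frontier_iff hΩ hxc).mp hx))
  filter_upwards [nhdsWithin_le_nhds (c.open_source.mem_nhds hxc), self_mem_nhdsWithin]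
    with w hw hwf
  exact α.flux_eq hΩ hc hw ((hc.mem_frontier_iff hΩ hw).mp hwf)

/-- `|α(ν)| ≤ |α|`, also at points without a boundary chart, where the normal is zero. -/
lemma abs_flux_le (α : CovectorField (m + 1) M) {x : M} {b : Fin (m + 1) → Coord (m + 1)}
    (hb : IsFrame (fun i j => gInv (n := m + 1) x i j) b) : |α.flux Ω x| ≤ √(∑ a, ev (fun l =>
      α.comp (chartAt (Coord (m + 1)) x) l (chartAt (Coord (m + 1)) x x)) (b a) ^ 2) := by
  by_cases h : ∃ c : OpenPartialHomeomorph M (Coord (m + 1)), IsBoundaryChart Ω c ∧ x ∈ c.source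
  · set J : Jet (m + 1) := jetAt (fun z => h.choose z 0) x with hJ
    have hbJ : IsFrame J.A b := hb
    have hν : ∀ l, outwardNormal Ω x l = J.gradUp l / √J.gradSq := fun l => by
      rw [outwardNormal, dif_pos h]
      rfl
    simp only [flux, hν, ← mul_div_assoc]
    rw [← Finset.sum_div, pairing_frame hbJ, abs_div, abs_of_nonneg (Real.sqrt_nonneg _),
      Jet.gradSq_frame hbJ]
    refine div_le_of_le_mul₀ (Real.sqrt_nonneg _) (Real.sqrt_nonneg _) ?_
    rw [← Real.sqrt_mul (Finset.sum_nonneg fun _ _ => sq_nonneg _)]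
    exact Real.abs_le_sqrt (Finset.sum_mul_sq_le_sq_mul_sq _ _ _)
  · have : (outwardNormal Ω x : Fin (m + 1) → ℝ) = 0 := by rw [outwardNormal, dif_neg h]
    simp only [flux, this, Pi.zero_apply, mul_zero, Finset.sum_const_zero, abs_zero]
    exact Real.sqrt_nonneg _

end CovectorField

variable {u : M → ℝ} (hu : ContMDiff (𝓡 (m + 1)) 𝓘(ℝ, ℝ) ∞ u) {x : M}

lemma flux_thirdHessField : (thirdHessField u hu).flux Ω x
    = thirdHessNormal (m + 1) u x (outwardNormal Ω x) := by
  change ∑ l : Fin (m + 1), (∑ p : Fin (m + 1), ∑ i : Fin (m + 1), hessUp u x p i * third u x p i l)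
      * outwardNormal Ω x l
    = thirdHessNormal (m + 1) u x (outwardNormal Ω x)
  simp only [HarmonicEstimates.thirdHessNormal, Finset.sum_mul]
  rw [Finset.sum_comm_cycle, Finset.sum_comm_cycle]

lemma flux_hessLapGradField : (hessLapGradField u hu).flux Ω x
    = hessLapGradNormal (m + 1) u x (outwardNormal Ω x) := by
  change ∑ l : Fin (m + 1), (∑ i : Fin (m + 1), hess u x i l * lapGradUp u x i)
      * outwardNormal Ω x l
    = hessLapGradNormal (m + 1) u x (outwardNormal Ω x)
  simp only [hessLapGradNormal, Finset.sum_mul]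
  rw [Finset.sum_comm]

/-- The boundary integrand that bounds `∫ |∇²u|³`, from `|∇∇u(∇u, ν)| ≤ |∇²u| |∇u|`. -/
lemma flux_weightedHessGradField_le {ε : ℝ} (hε : 0 < ε) :
    (weightedHessGradField u hu ε hε).flux Ω x
      ≤ (normHess (m + 1) u x + ε) * (normHess (m + 1) u x * normGrad (m + 1) u x) := by
  obtain ⟨b, hb⟩ := exists_isFrame_jetAt (n := m + 1) u x
  refine (le_abs_self _).trans (((weightedHessGradField u hu ε hε).abs_flux_le hb).trans ?_)
  set J : Jet (m + 1) := jetAt u x with hJ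
  have h1 : ∀ a, ev (fun l => √(J.hessSq + ε ^ 2) * J.hessGrad l) (b a)
      = √(J.hessSq + ε ^ 2) * ev J.hessGrad (b a) := fun a => by
    simp only [ev_apply', Finset.mul_sum]
    exact Finset.sum_congr rfl fun _ _ => by ring
  change √(∑ a, ev (fun l => √(J.hessSq + ε ^ 2) * J.hessGrad l) (b a) ^ 2) ≤ _
  simp only [h1, mul_pow, ← Finset.mul_sum]
  have h0 := Jet.hessSq_nonneg hb
  have h2 : J.hessSq = normHess (m + 1) u x ^ 2 := (Real.sq_sqrt h0).symm
  have h3 : J.gradSq = normGrad (m + 1) u x ^ 2 := (Real.sq_sqrt (Jet.gradSq_nonneg hb)).symm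
  have hH : 0 ≤ normHess (m + 1) u x := Real.sqrt_nonneg _
  have hD : 0 ≤ normGrad (m + 1) u x := Real.sqrt_nonneg _
  rw [Real.sqrt_mul (sq_nonneg _), Real.sqrt_sq (Real.sqrt_nonneg _), h2]
  have h5 : √(normHess (m + 1) u x ^ 2 + ε ^ 2) ≤ normHess (m + 1) u x + ε :=
    Real.sqrt_le_iff.mpr ⟨by positivity, by nlinarith⟩
  have h6 : √(∑ a, ev J.hessGrad (b a) ^ 2) ≤ normHess (m + 1) u x * normGrad (m + 1) u x := by
    refine Real.sqrt_le_iff.mpr ⟨by positivity, (Jet.sum_sq_hessGrad_le hb).trans ?_⟩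
    rw [h2, h3, mul_pow]
  gcongr

end Normal

/-! ### The divergence theorem -/

section Finiteness

open MeasureTheory Set Filter Topology

lemma paramMeasure_lt_top {E : Type*} [MeasureSpace E] [TopologicalSpace E] [T2Space E]
    [OpensMeasurableSpace E] [SFinite (volume : Measure E)]
    [IsFiniteMeasureOnCompacts (volume : Measure E)] {X : Type*} [MeasurableSpace X]
    {D K : Set E} {ρ : E → ℝ} {σ : E → X} (hD : MeasurableSet D)
    (hσ : AEMeasurable σ (volume.restrict D)) (hK : IsCompact K) (hρ : ContinuousOn ρ K)
    {s : Set X} (hs : MeasurableSet s) (hsK : D ∩ σ ⁻¹' s ⊆ K) : paramMeasure D ρ σ s < ⊤ := by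
  rw [paramMeasure_apply hD hσ hs]
  exact (lintegral_mono_set hsK).trans_lt
    (hρ.integrableOn_compact' hK hK.measurableSet).lintegral_lt_top

lemma isLocallyFiniteMeasure_riemannianVolume {n : ℕ} {M : Type*} [TopologicalSpace M]
    [SecondCountableTopology M] [ChartedSpace (Coord n) M] [IsManifold (𝓡 n) ∞ M]
    [RiemannianBundle (fun x : M => TangentSpace (𝓡 n) x)]
    [IsContMDiffRiemannianBundle (𝓡 n) ∞ (Coord n) (fun x : M => TangentSpace (𝓡 n) x)]
    [MeasurableSpace M] [BorelSpace M] : IsLocallyFiniteMeasure (riemannianVolume n M) := by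
  refine ⟨fun x => ?_⟩
  have hcm := chartAt_mem_maximalAtlas' (n := n) x
  have hx := mem_chart_source (Coord n) x
  set c := chartAt (Coord n) x
  obtain ⟨K, hK, hxK, hKt⟩ := exists_compact_subset c.open_target (c.map_source hx)
  have hs : IsOpen (c.source ∩ c ⁻¹' interior K) := c.isOpen_inter_preimage isOpen_interior
  refine ⟨_, hs.mem_nhds ⟨hx, hxK⟩, ?_⟩
  have h1 : riemannianVolume n M (c.source ∩ c ⁻¹' interior K)
      = chartVolume c (c.source ∩ c ⁻¹' interior K) := by
    rw [← riemannianVolume_restrict hcm, Measure.restrict_apply hs.measurableSet,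
      inter_eq_left.mpr inter_subset_left]
  rw [h1]
  refine paramMeasure_lt_top c.open_target.measurableSet
    (c.continuousOn_symm.aemeasurable c.open_target.measurableSet) hK
    (((isMetricOn_chartMetric hcm).smooth_det.continuousOn.sqrt).mono hKt) hs.measurableSet ?_
  rintro y ⟨hy, _, hy'⟩
  rw [mem_preimage, c.right_inv hy] at hy'
  exact interior_subset hy'

variable {m : ℕ} {M : Type*} [TopologicalSpace M] [ChartedSpace (Coord (m + 1)) M]
  [IsManifold (𝓡 (m + 1)) ∞ M] [RiemannianBundle (fun x : M => TangentSpace (𝓡 (m + 1)) x)]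
  [IsContMDiffRiemannianBundle (𝓡 (m + 1)) ∞ (Coord (m + 1))
    (fun x : M => TangentSpace (𝓡 (m + 1)) x)]
  [MeasurableSpace M] [BorelSpace M] {Ω : Set M}

lemma isFiniteMeasure_boundaryArea (hΩ : IsOpen Ω) (hb : HasSmoothBoundary m Ω)
    (hcpt : IsCompact (frontier Ω)) : IsFiniteMeasure (boundaryArea m Ω) := by
  have h1 : boundaryArea m Ω (frontier Ω) < ⊤ := by
    refine hcpt.measure_lt_top_of_nhdsWithin fun x hxf => ?_
    obtain ⟨c, hc, hx⟩ := hb x hxf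
    have hx0 := hyperplanePoint_tail ((hc.mem_frontier_iff hΩ hx).mp hxf)
    obtain ⟨K, hK, hxK, hKt⟩ := exists_compact_subset (isOpen_hyperplane_target (c := c))
      (x := tailCLM m (c x)) (by rw [mem_ofPred_eq, hx0]; exact c.map_source hx)
    have hs : IsOpen (c.source ∩ c ⁻¹' (tailCLM m ⁻¹' interior K)) :=
      c.isOpen_inter_preimage (isOpen_interior.preimage (tailCLM m).continuous)
    refine ⟨_, mem_nhdsWithin_of_mem_nhds (hs.mem_nhds ⟨hx, hxK⟩), ?_⟩
    have h1 : boundaryArea m Ω (c.source ∩ c ⁻¹' (tailCLM m ⁻¹' interior K))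
        = chartArea c (c.source ∩ c ⁻¹' (tailCLM m ⁻¹' interior K)) := by
      rw [← boundaryArea_restrict hc hΩ, Measure.restrict_apply hs.measurableSet,
        inter_eq_left.mpr inter_subset_left]
    rw [h1]
    have hG := isMetricOn_chartMetric hc.1
    refine paramMeasure_lt_top isOpen_hyperplane_target.measurableSet
      (continuousOn_symm_hyperplane.aemeasurable isOpen_hyperplane_target.measurableSet) hK ?_
      hs.measurableSet ?_
    · have h2 : ContinuousOn (fun z : Fin m → ℝ => fun i j : Fin m =>
          chartMetric c (hyperplanePoint z) i.succ j.succ) K :=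
        continuousOn_pi.mpr fun i => continuousOn_pi.mpr fun j =>
          (hG.smooth i.succ j.succ).continuousOn.comp continuous_hyperplanePoint.continuousOn
            fun z hz => hKt hz
      exact (Continuous.comp_continuousOn (g := fun A : Matrix (Fin m) (Fin m) ℝ => A.det)
        (continuous_id.matrix_det) h2).sqrt
    · rintro z ⟨hz, _, hz'⟩
      rw [mem_preimage, c.right_inv hz] at hz'
      exact interior_subset hz'
  refine ⟨?_⟩
  rw [← measure_add_measure_compl isClosed_frontier.measurableSet, boundaryArea_compl_frontier hΩ,
    add_zero]
  exact h1

end Finiteness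

section Divergence

open MeasureTheory Set Filter Topology

namespace CovectorField

section

variable {n : ℕ} {M : Type*} [TopologicalSpace M] [ChartedSpace (Coord n) M]
  [IsManifold (𝓡 n) ∞ M] [RiemannianBundle (fun x : M => TangentSpace (𝓡 n) x)]
  [IsContMDiffRiemannianBundle (𝓡 n) ∞ (Coord n) (fun x : M => TangentSpace (𝓡 n) x)]

lemma coordDiv_congr {G : Coord n → Matrix (Fin n) (Fin n) ℝ} {V : Set (Coord n)} (hV : IsOpen V)
    {α β : Fin n → Coord n → ℝ} (h : ∀ j, EqOn (α j) (β j) V) {y : Coord n} (hy : y ∈ V) :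
    coordDiv G α y = coordDiv G β y := by
  refine Finset.sum_congr rfl fun i _ => Finset.sum_congr rfl fun j _ => ?_
  simp only [cov1, pd_congr_of_eqOn hV (h j) hy, fun k => h k hy]

lemma coordDiv_sum {G : Coord n → Matrix (Fin n) (Fin n) ℝ} {ι : Type*} (s : Finset ι)
    {α : ι → Fin n → Coord n → ℝ} {y : Coord n}
    (hα : ∀ a ∈ s, ∀ j, DifferentiableAt ℝ (α a j) y) :
    coordDiv G (fun j z => ∑ a ∈ s, α a j z) y = ∑ a ∈ s, coordDiv G (α a) y := by
  classical
  have h1 : ∀ i j, cov1 G (fun j z => ∑ a ∈ s, α a j z) i j y = ∑ a ∈ s, cov1 G (α a) i j y := by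
    intro i j
    have h2 : pd (fun z => ∑ a ∈ s, α a j z) i y = ∑ a ∈ s, pd (α a j) i y := by
      unfold pd
      rw [fderiv_fun_sum fun a ha => hα a ha j, sum_apply]
    simp only [cov1, h2, Finset.mul_sum, Finset.sum_sub_distrib]
    rw [Finset.sum_comm]
  simp only [coordDiv, h1, Finset.mul_sum]
  rw [Finset.sum_comm_cycle]

lemma coordDiv_zero {G : Coord n → Matrix (Fin n) (Fin n) ℝ} {y : Coord n} :
    coordDiv G (fun _ _ => 0) y = 0 := by
  simpa using coordDiv_sum (G := G) (∅ : Finset ℕ) (α := fun _ _ _ => 0) (y := y) (by simp)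

variable {ψ : M → ℝ} {hψ : ContMDiff (𝓡 n) 𝓘(ℝ, ℝ) ∞ ψ} (α : CovectorField n M)

lemma div_smul_eq_zero {x : M} (hx : x ∉ tsupport ψ) : (α.smul ψ hψ).div x = 0 := by
  set c := chartAt (Coord n) x
  have hO : IsOpen (c.target ∩ c.symm ⁻¹' (tsupport ψ)ᶜ) :=
    c.symm.isOpen_inter_preimage (isClosed_tsupport ψ).isOpen_compl
  refine (coordDiv_congr (β := fun _ _ => 0) hO (fun j y hy => ?_)
    ⟨mem_chart_target (Coord n) x, ?_⟩).trans coordDiv_zero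
  · change ψ (c.symm y) * _ = 0
    rw [image_eq_zero_of_notMem_tsupport hy.2, zero_mul]
  · rw [mem_preimage, c.left_inv (mem_chart_source _ x)]
    exact hx

/-- The divergence is the sum of the divergences over a partition of unity. -/
lemma sum_div_smul {ι : Type*} (s : Finset ι) {ψ : ι → M → ℝ}
    (hψ : ∀ i, ContMDiff (𝓡 n) 𝓘(ℝ, ℝ) ∞ (ψ i)) {W : Set M} (hW : IsOpen W)
    (h1 : ∀ x ∈ W, ∑ i ∈ s, ψ i x = 1) {x : M} (hx : x ∈ W) :
    ∑ i ∈ s, (α.smul (ψ i) (hψ i)).div x = α.div x := by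
  have hcm := chartAt_mem_maximalAtlas' (n := n) x
  have hxt := mem_chart_target (Coord n) x
  have hxs := mem_chart_source (Coord n) x
  simp only [div]
  set c := chartAt (Coord n) x
  rw [← coordDiv_sum s fun i _ j => ((α.smul (ψ i) (hψ i)).smooth c hcm j).diffAt c.open_target hxt]
  have hO : IsOpen (c.target ∩ c.symm ⁻¹' W) := c.symm.isOpen_inter_preimage hW
  refine coordDiv_congr hO (fun j y hy => ?_) ⟨hxt, by rwa [mem_preimage, c.left_inv hxs]⟩
  change ∑ i ∈ s, ψ i (c.symm y) * α.comp c j y = α.comp c j y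
  rw [← Finset.sum_mul, h1 _ hy.2, one_mul]

end

variable {m : ℕ} {M : Type*} [TopologicalSpace M] [ChartedSpace (Coord (m + 1)) M]
  [IsManifold (𝓡 (m + 1)) ∞ M] [RiemannianBundle (fun x : M => TangentSpace (𝓡 (m + 1)) x)]
  [IsContMDiffRiemannianBundle (𝓡 (m + 1)) ∞ (Coord (m + 1))
    (fun x : M => TangentSpace (𝓡 (m + 1)) x)] {Ω : Set M}
  {c : OpenPartialHomeomorph M (Coord (m + 1))}
  {ψ : M → ℝ} {hψ : ContMDiff (𝓡 (m + 1)) 𝓘(ℝ, ℝ) ∞ ψ} (α : CovectorField (m + 1) M)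

lemma flux_smul {x : M} : (α.smul ψ hψ).flux Ω x = ψ x * α.flux Ω x := by
  simp only [flux, smul, Finset.mul_sum,
    (chartAt (Coord (m + 1)) x).left_inv (mem_chart_source _ x), mul_assoc]

/-- The components `√(det g) g^la α_a` of the vector density that belongs to a covector field, in a
chart; they are extended by zero. -/
def density (c : OpenPartialHomeomorph M (Coord (m + 1))) (l : Fin (m + 1))
    (y : Coord (m + 1)) : ℝ :=
  c.target.indicator
    (fun y => √(chartMetric c y).det * ∑ a, (chartMetric c y)⁻¹ l a * α.comp c a y) y

lemma density_eq_zero (l : Fin (m + 1)) {y : Coord (m + 1)}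
    (hy : y ∉ c '' tsupport ψ) : (α.smul ψ hψ).density c l y = 0 := by
  by_cases hyt : y ∈ c.target
  · have h1 : ψ (c.symm y) = 0 := image_eq_zero_of_notMem_tsupport fun h =>
      hy ⟨_, h, c.right_inv hyt⟩
    simp [density, indicator_of_mem hyt, smul, h1]
  · simp [density, indicator_of_notMem hyt]

lemma isCompact_image_tsupport (hψc : IsCompact (tsupport ψ)) (hK : tsupport ψ ⊆ c.source) :
    IsCompact (c '' tsupport ψ) :=
  hψc.image_of_continuousOn (c.continuousOn.mono hK)

lemma hasCompactSupport_density (hψc : IsCompact (tsupport ψ)) (hK : tsupport ψ ⊆ c.source)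
    (l : Fin (m + 1)) : HasCompactSupport ((α.smul ψ hψ).density c l) :=
  HasCompactSupport.intro (isCompact_image_tsupport hψc hK) fun _ hy => α.density_eq_zero l hy

lemma contDiff_density (hc : c ∈ IsManifold.maximalAtlas (𝓡 (m + 1)) ∞ M)
    (hψc : IsCompact (tsupport ψ)) (hK : tsupport ψ ⊆ c.source) (l : Fin (m + 1)) :
    ContDiff ℝ 1 ((α.smul ψ hψ).density c l) := by
  have hG := isMetricOn_chartMetric hc
  rw [contDiff_iff_contDiffAt]
  intro y
  by_cases hyt : y ∈ c.target
  · have h1 : ContDiffOn ℝ ∞ (fun y => √(chartMetric c y).det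
        * ∑ a, (chartMetric c y)⁻¹ l a * (α.smul ψ hψ).comp c a y) c.target :=
      (hG.smooth_det.sqrt fun y hy => (hG.posDef y hy).det_pos.ne').mul
        (ContDiffOn.sum fun a _ => (hG.smooth_inv l a).mul ((α.smul ψ hψ).smooth c hc a))
    have h2 := (h1.contDiffAt (c.open_target.mem_nhds hyt)).of_le (m := 1) (by simp)
    refine h2.congr_of_eventuallyEq ?_
    filter_upwards [c.open_target.mem_nhds hyt] with z hz
    simp [density, indicator_of_mem hz]
  · have hyK : y ∉ c '' tsupport ψ := fun ⟨x, hx, hxy⟩ => hyt (hxy ▸ c.map_source (hK hx))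
    refine contDiffAt_const.congr_of_eventuallyEq (f := fun _ => (0 : ℝ)) ?_
    filter_upwards [(isCompact_image_tsupport hψc hK).isClosed.isOpen_compl.mem_nhds hyK] with z hz
      using α.density_eq_zero l hz

lemma sum_pd_density_of_mem (hc : c ∈ IsManifold.maximalAtlas (𝓡 (m + 1)) ∞ M)
    {y : Coord (m + 1)} (hy : y ∈ c.target) :
    ∑ l, pd (α.density c l) l y = √(chartMetric c y).det * α.div (c.symm y) := by
  rw [α.div_eq hc (c.map_target hy), c.right_inv hy,
    ← (isMetricOn_chartMetric hc).sum_pd_density hy fun j =>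
      (α.smooth c hc j).diffAt c.open_target hy]
  refine Finset.sum_congr rfl fun l _ => pd_congr_of_eqOn c.open_target (fun z hz => ?_) hy l
  simp [density, indicator_of_mem hz]

variable [SecondCountableTopology M] [MeasurableSpace M] [BorelSpace M]

/-- The divergence theorem for a covector field with support in the domain of a chart, on a set that
corresponds to a half-space `{y₀ < L}` in this chart. -/
lemma setIntegral_div_smul (hc : c ∈ IsManifold.maximalAtlas (𝓡 (m + 1)) ∞ M)
    (hψc : IsCompact (tsupport ψ)) (hK : tsupport ψ ⊆ c.source) {S : Set M} (hS : MeasurableSet S)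
    {L : ℝ} (hSL : ∀ x ∈ tsupport ψ, x ∈ S ↔ c x 0 < L) :
    ∫ x in S, (α.smul ψ hψ).div x ∂(riemannianVolume (m + 1) M)
      = ∫ z : Fin m → ℝ, (α.smul ψ hψ).density c 0
          (WithLp.toLp 2 (Fin.cons L z : Fin (m + 1) → ℝ)) := by
  have hG := isMetricOn_chartMetric hc
  rw [← integral_divergence_halfSpace (α.contDiff_density hc hψc hK)
    (α.hasCompactSupport_density hψc hK) L]
  have h1 : ∫ x in S, (α.smul ψ hψ).div x ∂(riemannianVolume (m + 1) M)
      = ∫ x in S ∩ c.source, (α.smul ψ hψ).div x ∂(riemannianVolume (m + 1) M) := by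
    refine setIntegral_eq_of_subset_of_forall_sdiff_eq_zero hS inter_subset_left fun x hx => ?_
    exact α.div_smul_eq_zero fun h => hx.2 ⟨hx.1, hK h⟩
  rw [h1, ← Measure.restrict_restrict hS, riemannianVolume_restrict hc, ← integral_indicator hS,
    chartVolume_eq_paramMeasure, integral_paramMeasure c.open_target.measurableSet
      (c.continuousOn_symm.aemeasurable c.open_target.measurableSet)
      (hG.smooth_det.continuousOn.sqrt.aemeasurable c.open_target.measurableSet)
      (fun _ _ => Real.sqrt_nonneg _)
      ((α.smul ψ hψ).continuous_div.measurable.indicator hS).aestronglyMeasurable,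
    ← integral_indicator c.open_target.measurableSet,
    ← integral_indicator (measurableSet_lt (by fun_prop) measurable_const)]
  congr 1
  ext y
  by_cases hyt : y ∈ c.target
  · rw [indicator_of_mem hyt]
    by_cases hyK : c.symm y ∈ tsupport ψ
    · have h2 := hSL _ hyK
      rw [c.right_inv hyt] at h2
      by_cases hyS : c.symm y ∈ S
      · rw [indicator_of_mem hyS,
          indicator_of_mem (show y ∈ {y : Coord (m + 1) | y 0 < L} from h2.mp hyS),
          sum_pd_density_of_mem _ hc hyt]
      · rw [indicator_of_notMem hyS, mul_zero,
          indicator_of_notMem (show y ∉ {y : Coord (m + 1) | y 0 < L} from fun h => hyS (h2.mpr h))]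
    · have h2 := α.div_smul_eq_zero (hψ := hψ) hyK
      have h3 : ∑ l, pd ((α.smul ψ hψ).density c l) l y = 0 := by
        rw [sum_pd_density_of_mem _ hc hyt, h2, mul_zero]
      have h4 : S.indicator (α.smul ψ hψ).div (c.symm y) = 0 :=
        indicator_apply_eq_zero.mpr fun _ => h2
      rw [h4, mul_zero, indicator_apply, h3, ite_self]
  · have hyK : y ∉ c '' tsupport ψ := fun ⟨x, hx, hxy⟩ => hyt (hxy ▸ c.map_source (hK hx))
    have h3 : ∀ l, pd ((α.smul ψ hψ).density c l) l y = 0 := fun l => by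
      rw [pd_congr_of_eqOn (isCompact_image_tsupport hψc hK).isClosed.isOpen_compl
        (g := fun _ => 0) (fun z hz => α.density_eq_zero l hz) hyK, pd_const]
    simp only [indicator_of_notMem hyt, indicator_apply, h3, Finset.sum_const_zero, ite_self]

lemma aestronglyMeasurable_flux (hΩ : IsOpen Ω) (hb : HasSmoothBoundary m Ω) :
    AEStronglyMeasurable (α.flux Ω) (boundaryArea m Ω) := by
  have h1 := (α.continuousOn_flux hΩ hb).aestronglyMeasurable
    (μ := boundaryArea m Ω) isClosed_frontier.measurableSet
  rwa [Measure.restrict_eq_self_of_ae_mem] at h1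
  rw [ae_iff]
  exact boundaryArea_compl_frontier hΩ

/-- The boundary integral of a covector field with support in the domain of a boundary chart. -/
lemma integral_flux_smul (hΩ : IsOpen Ω) (hb : HasSmoothBoundary m Ω) (hc : IsBoundaryChart Ω c)
    (hK : tsupport ψ ⊆ c.source) :
    ∫ x, (α.smul ψ hψ).flux Ω x ∂(boundaryArea m Ω)
      = ∫ z : Fin m → ℝ, (α.smul ψ hψ).density c 0 (hyperplanePoint z) := by
  have hG := isMetricOn_chartMetric hc.1
  have h1 : ∫ x, (α.smul ψ hψ).flux Ω x ∂(boundaryArea m Ω)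
      = ∫ x, (α.smul ψ hψ).flux Ω x ∂(chartArea c) := by
    rw [← boundaryArea_restrict hc hΩ, setIntegral_eq_integral_of_forall_compl_eq_zero]
    intro x hx
    rw [flux_smul, image_eq_zero_of_notMem_tsupport fun h => hx (hK h), zero_mul]
  have h2 : AEStronglyMeasurable ((α.smul ψ hψ).flux Ω) (chartArea c) := by
    rw [← boundaryArea_restrict hc hΩ]
    exact ((α.smul ψ hψ).aestronglyMeasurable_flux hΩ hb).restrict
  rw [h1, chartArea_eq_paramMeasure, integral_paramMeasure isOpen_hyperplane_target.measurableSet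
    (continuousOn_symm_hyperplane.aemeasurable isOpen_hyperplane_target.measurableSet) ?_
    (fun _ _ => Real.sqrt_nonneg _) h2, ← integral_indicator isOpen_hyperplane_target.measurableSet]
  · congr 1
    ext z
    by_cases hz : hyperplanePoint z ∈ c.target
    · rw [indicator_of_mem (show z ∈ {z | hyperplanePoint z ∈ c.target} from hz),
        sqrt_det_mul_flux _ hΩ hc hz, density, indicator_of_mem hz]
    · rw [indicator_of_notMem (show z ∉ {z | hyperplanePoint z ∈ c.target} from hz), density,
        indicator_of_notMem hz]
  · refine ContinuousOn.aemeasurable (ContinuousOn.sqrt ?_) isOpen_hyperplane_target.measurableSet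
    have h2 : ContinuousOn (fun z : Fin m → ℝ => fun i j : Fin m =>
        chartMetric c (hyperplanePoint z) i.succ j.succ) {z | hyperplanePoint z ∈ c.target} :=
      continuousOn_pi.mpr fun i => continuousOn_pi.mpr fun j =>
        (hG.smooth i.succ j.succ).continuousOn.comp continuous_hyperplanePoint.continuousOn
          fun z hz => hz
    exact Continuous.comp_continuousOn (g := fun A : Matrix (Fin m) (Fin m) ℝ => A.det)
      (continuous_id.matrix_det) h2

end CovectorField

end Divergence

section DivergenceTheorem

open MeasureTheory Set Filter Topology

variable {m : ℕ} {M : Type*} [TopologicalSpace M] [T2Space M] [SecondCountableTopology M]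
  [ChartedSpace (Coord (m + 1)) M]
  [IsManifold (𝓡 (m + 1)) ∞ M] [RiemannianBundle (fun x : M => TangentSpace (𝓡 (m + 1)) x)]
  [IsContMDiffRiemannianBundle (𝓡 (m + 1)) ∞ (Coord (m + 1))
    (fun x : M => TangentSpace (𝓡 (m + 1)) x)]
  [MeasurableSpace M] [BorelSpace M] {Ω : Set M}

lemma integrableOn_of_continuous {f : M → ℝ} (hf : Continuous f) (hcl : IsCompact (closure Ω)) :
    IntegrableOn f Ω (riemannianVolume (m + 1) M) := by
  have := isLocallyFiniteMeasure_riemannianVolume (n := m + 1) (M := M)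
  exact (hf.continuousOn.integrableOn_compact hcl).mono_set subset_closure

lemma boundaryArea_restrict_frontier (hΩ : IsOpen Ω) :
    (boundaryArea m Ω).restrict (frontier Ω) = boundaryArea m Ω :=
  Measure.restrict_eq_self_of_ae_mem (by rw [ae_iff]; exact boundaryArea_compl_frontier hΩ)

lemma integrable_boundaryArea (hΩ : IsOpen Ω) (hcl : IsCompact (closure Ω))
    (hb : HasSmoothBoundary m Ω) {f : M → ℝ} (hf : ContinuousOn f (frontier Ω)) :
    Integrable f (boundaryArea m Ω) := by
  have hcpt : IsCompact (frontier Ω) :=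
    hcl.of_isClosed_subset isClosed_frontier frontier_subset_closure
  have := isFiniteMeasure_boundaryArea hΩ hb hcpt
  have h1 : IntegrableOn f (frontier Ω) (boundaryArea m Ω) := hf.integrableOn_compact hcpt
  rwa [IntegrableOn, boundaryArea_restrict_frontier hΩ] at h1

namespace CovectorField

variable (α : CovectorField (m + 1) M)

/-- The divergence theorem for the localization of a covector field to a chart domain: either a
boundary chart, or a chart domain inside `Ω`, where both sides vanish. -/
lemma setIntegral_div_smul_eq_flux (hΩ : IsOpen Ω) (hb : HasSmoothBoundary m Ω) {ψ : M → ℝ}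
    (hψ : ContMDiff (𝓡 (m + 1)) 𝓘(ℝ, ℝ) ∞ ψ) (hψc : IsCompact (tsupport ψ))
    (h : (∃ c : OpenPartialHomeomorph M (Coord (m + 1)),
        IsBoundaryChart Ω c ∧ tsupport ψ ⊆ c.source) ∨
      ∃ c ∈ IsManifold.maximalAtlas (𝓡 (m + 1)) ∞ M, tsupport ψ ⊆ c.source ∧ tsupport ψ ⊆ Ω) :
    ∫ x in Ω, (α.smul ψ hψ).div x ∂(riemannianVolume (m + 1) M)
      = ∫ x, (α.smul ψ hψ).flux Ω x ∂(boundaryArea m Ω) := by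
  obtain ⟨c, hc, hK⟩ | ⟨c, hc, hK, hKΩ⟩ := h
  · rw [α.integral_flux_smul hΩ hb hc hK, α.setIntegral_div_smul hc.1 hψc hK hΩ.measurableSet
      (L := 0) fun x hx => hc.2 x (hK hx)]
    rfl
  · obtain ⟨R, hR⟩ := (isCompact_image_tsupport hψc hK).isBounded.exists_norm_le
    -- the support of `ψ` lies in a half-space whose boundary it does not meet
    have hR' : ∀ x ∈ tsupport ψ, c x 0 < R + 1 := fun x hx => by
      have h1 := (le_abs_self _).trans (PiLp.norm_apply_le (c x) 0)
      linarith [hR _ (mem_image_of_mem c hx)]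
    rw [α.setIntegral_div_smul hc hψc hK hΩ.measurableSet (L := R + 1) fun x hx =>
      iff_of_true (hKΩ hx) (hR' x hx), integral_eq_zero_of_ae, integral_eq_zero_of_ae]
    · have h1 : ∀ᵐ x ∂(boundaryArea m Ω), x ∈ frontier Ω := by
        rw [ae_iff]
        exact boundaryArea_compl_frontier hΩ
      filter_upwards [h1] with x hx
      rw [hΩ.frontier_eq] at hx
      have h3 : ψ x = 0 := image_eq_zero_of_notMem_tsupport fun h2 => hx.2 (hKΩ h2)
      rw [flux_smul, h3, zero_mul, Pi.zero_apply]
    · refine Eventually.of_forall fun z => α.density_eq_zero 0 ?_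
      rintro ⟨x, hx, hxz⟩
      have h1 := hR' x hx
      rw [hxz] at h1
      exact lt_irrefl _ h1

/-- The divergence theorem `∫_Ω div α dV = ∫_∂Ω α(ν) dA`. -/
theorem setIntegral_div_eq (hΩ : IsOpen Ω) (hcl : IsCompact (closure Ω))
    (hb : HasSmoothBoundary m Ω) :
    ∫ x in Ω, α.div x ∂(riemannianVolume (m + 1) M) = ∫ x, α.flux Ω x ∂(boundaryArea m Ω) := by
  have hlc : LocallyCompactSpace M := ChartedSpace.locallyCompactSpace (Coord (m + 1)) M
  -- every point of the closure has a relatively compact neighbourhood in a boundary chart, or in an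
  -- interior chart whose domain lies in `Ω`
  have hloc : ∀ x : closure Ω, ∃ U : Set M, IsOpen U ∧ x.1 ∈ U ∧ (∃ K, IsCompact K ∧ U ⊆ K) ∧
      ((∃ c : OpenPartialHomeomorph M (Coord (m + 1)), IsBoundaryChart Ω c ∧ U ⊆ c.source) ∨
        ∃ c ∈ IsManifold.maximalAtlas (𝓡 (m + 1)) ∞ M, U ⊆ c.source ∧ U ⊆ Ω) := by
    rintro ⟨x, hx⟩
    obtain ⟨K, hK, hxK⟩ := exists_compact_mem_nhds x
    by_cases hxΩ : x ∈ Ω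
    · refine ⟨interior K ∩ ((chartAt (Coord (m + 1)) x).source ∩ Ω), isOpen_interior.inter
        ((chartAt (Coord (m + 1)) x).open_source.inter hΩ), ⟨mem_interior_iff_mem_nhds.mpr hxK,
          mem_chart_source _ x, hxΩ⟩, ⟨K, hK, fun y hy => interior_subset hy.1⟩,
          Or.inr ⟨_, chartAt_mem_maximalAtlas' x, fun y hy => hy.2.1, fun y hy => hy.2.2⟩⟩
    · obtain ⟨c, hc, hxc⟩ := hb x (by rw [hΩ.frontier_eq]; exact ⟨hx, hxΩ⟩)
      exact ⟨interior K ∩ c.source, isOpen_interior.inter c.open_source,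
        ⟨mem_interior_iff_mem_nhds.mpr hxK, hxc⟩, ⟨K, hK, fun y hy => interior_subset hy.1⟩,
          Or.inl ⟨c, hc, fun y hy => hy.2⟩⟩
  choose U hUo hxU hUK hUc using hloc
  obtain ⟨t, ht⟩ := hcl.elim_finite_subcover U hUo fun x hx => mem_iUnion.mpr ⟨⟨x, hx⟩, hxU _⟩
  obtain ⟨f, hf⟩ := SmoothPartitionOfUnity.exists_isSubordinate (𝓡 (m + 1)) isClosed_closure
    (fun i : t => U i.1) (fun i => hUo i.1) (by rwa [iUnion_subtype])
  have hψ : ∀ i, ContMDiff (𝓡 (m + 1)) 𝓘(ℝ, ℝ) ∞ (f i) := fun i => (f i).contMDiff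
  have hcpt : ∀ i, IsCompact (tsupport (f i)) := fun i => by
    obtain ⟨K, hK, hUK⟩ := hUK i.1
    exact hK.of_isClosed_subset (isClosed_tsupport _) ((hf i).trans hUK)
  have hone : ∀ x ∈ closure Ω, ∑ i, f i x = 1 := fun x hx => by
    rw [← finsum_eq_sum_of_fintype]
    exact f.sum_eq_one hx
  have hi : ∀ i, ∫ x in Ω, (α.smul (f i) (hψ i)).div x ∂(riemannianVolume (m + 1) M)
      = ∫ x, (α.smul (f i) (hψ i)).flux Ω x ∂(boundaryArea m Ω) := fun i =>
    α.setIntegral_div_smul_eq_flux hΩ hb (hψ i) (hcpt i) <| by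
      obtain ⟨c, hc, hU⟩ | ⟨c, hc, hU, hUΩ⟩ := hUc i.1
      · exact Or.inl ⟨c, hc, (hf i).trans hU⟩
      · exact Or.inr ⟨c, hc, (hf i).trans hU, (hf i).trans hUΩ⟩
  calc ∫ x in Ω, α.div x ∂(riemannianVolume (m + 1) M)
      = ∫ x in Ω, ∑ i, (α.smul (f i) (hψ i)).div x ∂(riemannianVolume (m + 1) M) :=
        setIntegral_congr_fun hΩ.measurableSet fun x hx =>
          (α.sum_div_smul Finset.univ hψ hΩ (fun y hy => hone y (subset_closure hy)) hx).symm
    _ = ∑ i, ∫ x in Ω, (α.smul (f i) (hψ i)).div x ∂(riemannianVolume (m + 1) M) :=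
        integral_finsetSum _ fun i _ =>
          integrableOn_of_continuous (α.smul (f i) (hψ i)).continuous_div hcl
    _ = ∑ i, ∫ x, (α.smul (f i) (hψ i)).flux Ω x ∂(boundaryArea m Ω) :=
        Finset.sum_congr rfl fun i _ => hi i
    _ = ∫ x, ∑ i, (α.smul (f i) (hψ i)).flux Ω x ∂(boundaryArea m Ω) :=
        (integral_finsetSum _ fun i _ => integrable_boundaryArea hΩ hcl hb
          ((α.smul (f i) (hψ i)).continuousOn_flux hΩ hb)).symm
    _ = ∫ x in frontier Ω, ∑ i, (α.smul (f i) (hψ i)).flux Ω x ∂(boundaryArea m Ω) := by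
        rw [boundaryArea_restrict_frontier hΩ]
    _ = ∫ x in frontier Ω, α.flux Ω x ∂(boundaryArea m Ω) := by
        refine setIntegral_congr_fun isClosed_frontier.measurableSet fun x hx => ?_
        simp only [flux_smul]
        rw [← Finset.sum_mul, hone x (frontier_subset_closure hx), one_mul]
    _ = ∫ x, α.flux Ω x ∂(boundaryArea m Ω) := by rw [boundaryArea_restrict_frontier hΩ]

end CovectorField

end DivergenceTheorem

/-! ### Complete Riemannian manifolds are proper -/

section HopfRinow

open Set Filter Topology Metric Manifold

/-- The Hopf–Rinow theorem for length spaces: if any two points are joined by paths whose length is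
almost their distance, then completeness and local compactness imply that closed balls are
compact. -/
theorem properSpace_of_length_space {X : Type*} [MetricSpace X] [CompleteSpace X]
    [LocallyCompactSpace X]
    (h : ∀ (x y : X) (r s : ℝ), 0 ≤ r → 0 < s → dist x y < r + s →
      ∃ z, dist x z ≤ r ∧ dist z y < s) :
    ProperSpace X := by
  refine ⟨fun x r₀ => ?_⟩
  by_contra hr₀
  set S : Set ℝ := {r | 0 ≤ r ∧ IsCompact (closedBall x r)} with hS
  have hS0 : (0 : ℝ) ∈ S := ⟨le_rfl, by rw [closedBall_zero]; exact isCompact_singleton⟩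
  have hmono : ∀ r s, r ≤ s → IsCompact (closedBall x s) → IsCompact (closedBall x r) :=
    fun r s hrs hs => hs.of_isClosed_subset isClosed_closedBall (closedBall_subset_closedBall hrs)
  have hbdd : BddAbove S := ⟨r₀, fun r hr => by
    by_contra! hlt
    exact hr₀ (hmono _ _ hlt.le hr.2)⟩
  set R := sSup S with hR
  have hR0 : 0 ≤ R := le_csSup hbdd hS0
  have hlt : ∀ r, r < R → IsCompact (closedBall x r) := fun r hr => by
    obtain ⟨s, hs, hrs⟩ := exists_lt_of_lt_csSup ⟨0, hS0⟩ hr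
    exact hmono _ _ hrs.le hs.2
  -- the supremum is attained, since the ball of radius `R` is totally bounded
  have hRc : IsCompact (closedBall x R) := by
    refine isCompact_iff_totallyBounded_isComplete.mpr
      ⟨totallyBounded_iff.mpr ?_, isClosed_closedBall.isComplete⟩
    intro ε hε
    obtain hR' | hR' := lt_or_ge R (ε / 2)
    · refine ⟨{x}, finite_singleton x, fun y hy => ?_⟩
      simp only [mem_singleton_iff, iUnion_iUnion_eq_left, mem_ball]
      rw [mem_closedBall] at hy
      linarith
    · obtain ⟨t, ht, htc⟩ := totallyBounded_iff.mp
        (hlt (R - ε / 4) (by linarith)).totallyBounded (ε / 2) (by linarith)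
      refine ⟨t, ht, fun y hy => ?_⟩
      obtain ⟨z, hxz, hzy⟩ := h x y (R - ε / 4) (ε / 2) (by linarith) (by linarith) (by
        rw [mem_closedBall, dist_comm] at hy
        linarith)
      obtain ⟨w, hw, hzw⟩ := mem_iUnion₂.mp (htc (show z ∈ closedBall x (R - ε / 4) by
        rwa [mem_closedBall, dist_comm]))
      refine mem_iUnion₂.mpr ⟨w, hw, ?_⟩
      rw [mem_ball] at hzw ⊢
      linarith [dist_triangle y z w, dist_comm y z]
  -- a slightly larger ball is still compact
  obtain ⟨K, hK, hRK⟩ := exists_compact_superset hRc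
  obtain ⟨δ, hδ, hδK⟩ := hRc.exists_thickening_subset_open isOpen_interior hRK
  have h1 : R + δ / 2 ∈ S := by
    refine ⟨by linarith, hK.of_isClosed_subset isClosed_closedBall fun y hy => ?_⟩
    obtain ⟨z, hxz, hzy⟩ := h x y R δ hR0 hδ (by
      rw [mem_closedBall, dist_comm] at hy
      linarith)
    refine interior_subset (hδK (mem_thickening_iff.mpr ⟨z, ?_, by rwa [dist_comm]⟩))
    rwa [mem_closedBall, dist_comm]
  linarith [le_csSup hbdd h1]

/-- A Riemannian manifold is a length space: on an almost shortest path from `x` to `y` there is a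
point at distance `r` from `x`, and the rest of the path is shorter than `s`. -/
lemma exists_dist_le_of_dist_lt_add {n : ℕ} {M : Type*} [MetricSpace M] [ChartedSpace (Coord n) M]
    [IsManifold (𝓡 n) ∞ M] [RiemannianBundle (fun x : M => TangentSpace (𝓡 n) x)]
    [IsContMDiffRiemannianBundle (𝓡 n) ∞ (Coord n) (fun x : M => TangentSpace (𝓡 n) x)]
    [IsRiemannianManifold (𝓡 n) M]
    (x y : M) {r s : ℝ} (hr : 0 ≤ r) (hs : 0 < s)
    (h : dist x y < r + s) : ∃ z, dist x z ≤ r ∧ dist z y < s := by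
  have h1 : riemannianEDist (𝓡 n) x y < ENNReal.ofReal (r + s) := by
    rw [← IsRiemannianManifold.out x y, edist_lt_ofReal]
    exact h
  obtain ⟨γ, hγ0, hγ1, hγ, hlen⟩ := exists_lt_of_riemannianEDist_lt h1
  obtain hxy | hxy := le_or_gt (dist x y) r
  · exact ⟨y, hxy, by rwa [dist_self]⟩
  have hcont : ContinuousOn (fun t => dist x (γ t)) (Icc 0 1) :=
    (continuous_const.dist continuous_id).comp_continuousOn hγ.continuousOn
  obtain ⟨t, ht, htr⟩ := intermediate_value_Icc zero_le_one hcont (show r ∈ Icc _ _ by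
    rw [hγ0, hγ1, dist_self]
    exact ⟨hr, hxy.le⟩)
  refine ⟨γ t, htr.le, ?_⟩
  have h2 : edist x (γ t) ≤ pathELength (𝓡 n) γ 0 t := by
    rw [IsRiemannianManifold.out (I := 𝓡 n) x (γ t)]
    exact riemannianEDist_le_pathELength (hγ.mono (Icc_subset_Icc le_rfl ht.2)) hγ0 rfl ht.1
  have h3 : edist (γ t) y ≤ pathELength (𝓡 n) γ t 1 := by
    rw [IsRiemannianManifold.out (I := 𝓡 n) (γ t) y]
    exact riemannianEDist_le_pathELength (hγ.mono (Icc_subset_Icc ht.1 le_rfl)) rfl hγ1 ht.2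
  have h4 : edist x (γ t) + edist (γ t) y < ENNReal.ofReal (r + s) :=
    (add_le_add h2 h3).trans_lt (by rwa [pathELength_add ht.1 ht.2])
  rw [edist_dist, edist_dist, ← ENNReal.ofReal_add dist_nonneg dist_nonneg,
    ENNReal.ofReal_lt_ofReal_iff (by linarith)] at h4
  beta_reduce at htr
  linarith

/-- A complete Riemannian manifold is proper. -/
theorem properSpace_of_complete (n : ℕ) (M : Type*) [MetricSpace M] [ChartedSpace (Coord n) M]
    [IsManifold (𝓡 n) ∞ M] [RiemannianBundle (fun x : M => TangentSpace (𝓡 n) x)]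
    [IsContMDiffRiemannianBundle (𝓡 n) ∞ (Coord n) (fun x : M => TangentSpace (𝓡 n) x)]
    [IsRiemannianManifold (𝓡 n) M]
    [CompleteSpace M] : ProperSpace M := by
  have : LocallyCompactSpace M := ChartedSpace.locallyCompactSpace (Coord n) M
  exact properSpace_of_length_space fun x y r s => exists_dist_le_of_dist_lt_add (n := n) x y

end HopfRinow

/-! ### The interpolation estimate -/

section Interpolation

open MeasureTheory

/-- The bound for `a²` that follows from a cubic inequality for `a`. -/
lemma sq_le_of_cube_le {a b k : ℝ} (ha : 0 ≤ a) (hk : 0 ≤ k) (h : a ^ 3 ≤ b + a * k) :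
    a ^ 2 ≤ 2 * max 1 b + 2 * k := by
  by_contra! hlt
  have h1 : (1 : ℝ) ≤ max 1 b := le_max_left _ _
  have h2 : b ≤ max 1 b := le_max_right _ _
  have h3 : 1 < a := by nlinarith
  nlinarith

/-- The elementary part of the absorption argument. -/
lemma absorption {I Q P K N a b B η : ℝ} (hI0 : 0 ≤ I) (hQ0 : 0 ≤ Q) (hK0 : 0 ≤ K)
    (hη : 0 < η) (h6 : Q ≤ 2 * P) (h4 : a ^ 2 ≤ 2 * max 1 b + 2 * (N * (√I + √Q)))
    (hsq : I ≤ Q + 2 * K * a ^ 2 + √I * √Q + B) :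
    I ≤ 40 * (1 + η) ^ 2 / η * P + 40 * (1 + η) ^ 2 / η * (K * N) ^ 2
        + 40 * (1 + η) ^ 2 / η * (K * max 1 b) + (1 + η) * B := by
  have hI2 := Real.sq_sqrt hI0
  have hQ2 := Real.sq_sqrt hQ0
  -- absorb `√I` with the weight `ε = η / (1 + η)`, so that `1 / (1 - ε) = 1 + η`
  set ε := η / (1 + η) with hε
  have hε0 : 0 < ε := by positivity
  have hε1 : (1 + η) * (1 - ε) = 1 := by rw [hε]; field_simp; ring
  have hεlt : ε ≤ 1 := by rw [hε]; exact (div_le_one (by positivity)).mpr (by linarith)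
  have hεinv : (1 + η) / η = 1 / ε := by rw [hε, one_div_div]
  have hmul : ∀ s t : ℝ, s * t ≤ ε / 4 * s ^ 2 + 1 / ε * t ^ 2 := fun s t => by
    have h7 : 0 ≤ (1 / ε) * (ε / 2 * s - t) ^ 2 := by positivity
    have h8 : (1 / ε) * (ε / 2 * s - t) ^ 2 = ε / 4 * s ^ 2 - s * t + 1 / ε * t ^ 2 := by
      field_simp
      ring
    linarith
  have h7 := hmul (√I) (√Q)
  have h8 := hmul (√I) (4 * (K * N))
  have h9 : 4 * (K * N) * √Q ≤ Q + 4 * (K * N) ^ 2 := by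
    have e1 : (√Q - 2 * (K * N)) ^ 2 = √Q ^ 2 - 4 * (K * N) * √Q + 4 * (K * N) ^ 2 := by ring
    linarith [sq_nonneg (√Q - 2 * (K * N))]
  have hε1' : 1 ≤ 1 / ε := by rw [one_le_div hε0]; exact hεlt
  have hP0 : 0 ≤ P := by linarith
  have hKa : 2 * K * a ^ 2 ≤ 4 * K * max 1 b + √I * (4 * (K * N)) + 4 * (K * N) * √Q := by
    have := mul_le_mul_of_nonneg_left h4 (show 0 ≤ 2 * K by positivity)
    linarith
  have hm0 : 0 ≤ max 1 b := zero_le_one.trans (le_max_left _ _)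
  have hX0 : 0 ≤ K * max 1 b := by positivity
  have hY0 : 0 ≤ (K * N) ^ 2 := sq_nonneg _
  have hmain : (1 - ε) * I ≤ 40 / ε * P + 40 / ε * (K * N) ^ 2 + 40 / ε * (K * max 1 b) + B := by
    have e1 : P ≤ 1 / ε * P := le_mul_of_one_le_left hP0 hε1'
    have e2 : (K * N) ^ 2 ≤ 1 / ε * (K * N) ^ 2 := le_mul_of_one_le_left hY0 hε1'
    have e3 : K * max 1 b ≤ 1 / ε * (K * max 1 b) := le_mul_of_one_le_left hX0 hε1'
    have e4 : 1 / ε * Q ≤ 1 / ε * (2 * P) := mul_le_mul_of_nonneg_left h6 (by positivity)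
    have e5 : 0 ≤ ε * I := by positivity
    have e6 : 40 / ε * P = 40 * (1 / ε * P) := by ring
    have e7 : 40 / ε * (K * N) ^ 2 = 40 * (1 / ε * (K * N) ^ 2) := by ring
    have e8 : 40 / ε * (K * max 1 b) = 40 * (1 / ε * (K * max 1 b)) := by ring
    rw [e6, e7, e8]
    rw [hI2] at h7 h8
    rw [hQ2] at h7
    have e9 : 1 / ε * (4 * (K * N)) ^ 2 = 16 * (1 / ε * (K * N) ^ 2) := by ring
    rw [e9] at h8
    linarith
  have hfin := mul_le_mul_of_nonneg_left hmain (show 0 ≤ 1 + η by positivity)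
  rw [← mul_assoc, hε1, one_mul] at hfin
  have hC : (1 + η) * (40 / ε) = 40 * (1 + η) ^ 2 / η := by
    rw [hε]
    field_simp
  refine hfin.trans_eq ?_
  rw [← hC]
  ring

variable {X : Type*} [TopologicalSpace X] [MeasurableSpace X] {ν : Measure X}
  (hν : ∀ f : X → ℝ, Continuous f → Integrable f ν)
include hν

lemma memLp_of_continuous {f : X → ℝ} (hf : Continuous f) {p : ℝ} (hp : 0 < p) :
    MemLp f (ENNReal.ofReal p) ν := by
  refine (integrable_norm_rpow_iff (hν f hf).aestronglyMeasurable (by simpa using hp)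
    ENNReal.ofReal_ne_top).mp (hν _ ?_)
  rw [ENNReal.toReal_ofReal hp.le]
  exact hf.norm.rpow_const fun x => Or.inr hp.le

lemma integral_mul_le_of_continuous {f g : X → ℝ} (hf : Continuous f) (hg : Continuous g)
    (hf0 : ∀ x, 0 ≤ f x) (hg0 : ∀ x, 0 ≤ g x) {p q : ℝ} (hpq : p.HolderConjugate q) :
    ∫ x, f x * g x ∂ν ≤ (∫ x, f x ^ p ∂ν) ^ (1 / p) * (∫ x, g x ^ q ∂ν) ^ (1 / q) :=
  integral_mul_le_Lp_mul_Lq_of_nonneg hpq (Filter.Eventually.of_forall hf0)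
    (Filter.Eventually.of_forall hg0) (memLp_of_continuous hν hf hpq.pos)
    (memLp_of_continuous hν hg hpq.symm.pos)

lemma integral_mul_le_sqrt {f g : X → ℝ} (hf : Continuous f) (hg : Continuous g)
    (hf0 : ∀ x, 0 ≤ f x) (hg0 : ∀ x, 0 ≤ g x) :
    ∫ x, f x * g x ∂ν ≤ √(∫ x, f x ^ 2 ∂ν) * √(∫ x, g x ^ 2 ∂ν) := by
  have h := integral_mul_le_of_continuous hν hf hg hf0 hg0 Real.HolderConjugate.two_two
  simpa only [Real.sqrt_eq_rpow, Real.rpow_two] using h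

lemma integral_mul_sq_le {f g : X → ℝ} (hf : Continuous f) (hg : Continuous g)
    (hf0 : ∀ x, 0 ≤ f x) (hg0 : ∀ x, 0 ≤ g x) :
    ∫ x, f x * g x ^ 2 ∂ν
      ≤ (∫ x, f x ^ 3 ∂ν) ^ (1 / 3 : ℝ) * ((∫ x, g x ^ 3 ∂ν) ^ (1 / 3 : ℝ)) ^ 2 := by
  have hpq : (3 : ℝ).HolderConjugate (3 / 2) := by
    rw [Real.holderConjugate_iff]
    norm_num
  have h := integral_mul_le_of_continuous hν hf (g := fun x => g x ^ 2) (hg.pow 2) hf0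
    (fun x => sq_nonneg (g x)) hpq
  have h1 : ∀ x, (g x ^ 2) ^ (3 / 2 : ℝ) = g x ^ 3 := fun x => by
    rw [← Real.rpow_natCast, ← Real.rpow_mul (hg0 x), ← Real.rpow_natCast]
    norm_num
  have h2 : ∀ x, f x ^ (3 : ℝ) = f x ^ 3 := fun x => by
    rw [← Real.rpow_natCast]
    norm_num
  have h3 : (0 : ℝ) ≤ ∫ x, g x ^ 3 ∂ν := integral_nonneg fun x => pow_nonneg (hg0 x) 3
  simp only [h1, h2] at h
  refine h.trans_eq ?_
  rw [← Real.rpow_natCast (_ ^ (1 / 3 : ℝ)), ← Real.rpow_mul h3]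
  norm_num

lemma sqrt_integral_mul_sq_le {f g : X → ℝ} (hf : Continuous f) (hg : Continuous g)
    (hf0 : ∀ x, 0 ≤ f x) (hg0 : ∀ x, 0 ≤ g x) :
    √(∫ x, (f x * g x) ^ 2 ∂ν)
      ≤ (∫ x, f x ^ 3 ∂ν) ^ (1 / 3 : ℝ) * (∫ x, g x ^ 6 ∂ν) ^ (1 / 6 : ℝ) := by
  have h := integral_mul_sq_le hν (f := fun x => g x ^ 2) (hg.pow 2) hf
    (fun x => sq_nonneg (g x)) hf0
  have h1 : ∀ x, (g x ^ 2) ^ 3 = g x ^ 6 := fun x => by ring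
  have h3 : (0 : ℝ) ≤ ∫ x, g x ^ 6 ∂ν := integral_nonneg fun x => pow_nonneg (hg0 x) 6
  have h4 : (0 : ℝ) ≤ ∫ x, f x ^ 3 ∂ν := integral_nonneg fun x => pow_nonneg (hf0 x) 3
  have h2 : (∫ x, g x ^ 6 ∂ν) ^ (1 / 3 : ℝ) = ((∫ x, g x ^ 6 ∂ν) ^ (1 / 6 : ℝ)) ^ 2 := by
    rw [← Real.rpow_natCast, ← Real.rpow_mul h3]
    norm_num
  simp only [h1, h2] at h
  refine Real.sqrt_le_iff.mpr ⟨by positivity, ?_⟩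
  calc ∫ x, (f x * g x) ^ 2 ∂ν = ∫ x, g x ^ 2 * f x ^ 2 ∂ν := by
        congr 1
        ext x
        ring
    _ ≤ _ := h
    _ = _ := by ring

lemma rpow_integral_add_le {f g : X → ℝ} (hf : Continuous f) (hg : Continuous g)
    (hf0 : ∀ x, 0 ≤ f x) (hg0 : ∀ x, 0 ≤ g x) {p : ℝ} (hp : 1 ≤ p) :
    (∫ x, (f x + g x) ^ p ∂ν) ^ (1 / p) ≤ 2 * (∫ x, (f x ^ p + g x ^ p) ∂ν) ^ (1 / p) := by
  have hp0 : 0 < p := by linarith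
  have hfp : Continuous fun x => f x ^ p := hf.rpow_const fun _ => Or.inr hp0.le
  have hgp : Continuous fun x => g x ^ p := hg.rpow_const fun _ => Or.inr hp0.le
  have h1 : ∫ x, (f x + g x) ^ p ∂ν ≤ ∫ x, 2 ^ p * (f x ^ p + g x ^ p) ∂ν := by
    refine integral_mono (hν _ ((hf.add hg).rpow_const fun _ => Or.inr hp0.le))
      (hν _ (continuous_const.mul (hfp.add hgp))) fun x => ?_
    have h2 : f x + g x ≤ 2 * max (f x) (g x) := by
      linarith [le_max_left (f x) (g x), le_max_right (f x) (g x)]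
    have h3 : (max (f x) (g x)) ^ p ≤ f x ^ p + g x ^ p := by
      obtain h | h := max_cases (f x) (g x)
      · rw [h.1]; linarith [Real.rpow_nonneg (hg0 x) p]
      · rw [h.1]; linarith [Real.rpow_nonneg (hf0 x) p]
    calc (f x + g x) ^ p ≤ (2 * max (f x) (g x)) ^ p :=
          Real.rpow_le_rpow (add_nonneg (hf0 x) (hg0 x)) h2 hp0.le
      _ = 2 ^ p * (max (f x) (g x)) ^ p :=
          Real.mul_rpow zero_le_two ((hf0 x).trans (le_max_left _ _))
      _ ≤ _ := by gcongr
  have h0 : 0 ≤ ∫ x, (f x ^ p + g x ^ p) ∂ν := integral_nonneg fun x =>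
    add_nonneg (Real.rpow_nonneg (hf0 x) p) (Real.rpow_nonneg (hg0 x) p)
  rw [integral_const_mul] at h1
  calc (∫ x, (f x + g x) ^ p ∂ν) ^ (1 / p) ≤ (2 ^ p * ∫ x, (f x ^ p + g x ^ p) ∂ν) ^ (1 / p) :=
        Real.rpow_le_rpow (integral_nonneg fun x => Real.rpow_nonneg (add_nonneg (hf0 x) (hg0 x)) p)
          h1 (by positivity)
    _ = _ := by
        rw [Real.mul_rpow (by positivity) h0, ← Real.rpow_mul zero_le_two,
          mul_one_div_cancel hp0.ne', Real.rpow_one]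

/-- The absorption argument: `T`, `H`, `D` play the roles of `|∇³u|`, `|∇²u|`, `|∇u|`. -/
theorem integral_sq_le_of_interpolation {T H D Rm Rc : X → ℝ} (hT : Continuous T)
    (hH : Continuous H) (hD : Continuous D) (hRm : Continuous Rm) (hRc : Continuous Rc)
    (hT0 : ∀ x, 0 ≤ T x) (hH0 : ∀ x, 0 ≤ H x) (hD0 : ∀ x, 0 ≤ D x) (hRm0 : ∀ x, 0 ≤ Rm x)
    (hRc0 : ∀ x, 0 ≤ Rc x) {b B : ℝ}
    (hcube : ∫ x, H x ^ 3 ∂ν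
      ≤ b + ∫ x, T x * (H x * D x) ∂ν + ∫ x, (Rc x * D x) * (H x * D x) ∂ν)
    (hsq : ∫ x, T x ^ 2 ∂ν ≤ ∫ x, (Rc x * D x) ^ 2 ∂ν + ∫ x, (Rm x + Rc x) * H x ^ 2 ∂ν
      + ∫ x, T x * (Rm x * D x) ∂ν + B) {η : ℝ} (hη : 0 < η) {p : ℝ} (hp : 1 < p) :
    ∫ x, T x ^ 2 ∂ν
      ≤ 40 * (1 + η) ^ 2 / η * (∫ x, (Rm x ^ (2 * p) + Rc x ^ (2 * p)) ∂ν) ^ (1 / p)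
          * (∫ x, D x ^ (2 * p / (p - 1)) ∂ν) ^ ((p - 1) / p)
        + 40 * (1 + η) ^ 2 / η * max (2 * (∫ x, (Rm x ^ 3 + Rc x ^ 3) ∂ν) ^ (1 / 3 : ℝ))
          ((∫ x, (Rm x ^ 3 + Rc x ^ 3) ∂ν) ^ (2 / 3 : ℝ) * ((∫ x, D x ^ 6 ∂ν) ^ (1 / 6 : ℝ)) ^ 2)
        + 40 * (1 + η) ^ 2 / η * (∫ x, (Rm x ^ 3 + Rc x ^ 3) ∂ν) ^ (1 / 3 : ℝ) * max 1 b
        + (1 + η) * B := by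
  have hp0 : 0 < p := by linarith
  have hK0 : 0 ≤ ∫ x, (Rm x ^ 3 + Rc x ^ 3) ∂ν := integral_nonneg fun x =>
    add_nonneg (pow_nonneg (hRm0 x) 3) (pow_nonneg (hRc0 x) 3)
  set I := ∫ x, T x ^ 2 ∂ν with hI
  set a := (∫ x, H x ^ 3 ∂ν) ^ (1 / 3 : ℝ) with ha
  set N := (∫ x, D x ^ 6 ∂ν) ^ (1 / 6 : ℝ) with hN
  set K := (∫ x, (Rm x ^ 3 + Rc x ^ 3) ∂ν) ^ (1 / 3 : ℝ) with hK
  set Q := ∫ x, (Rm x ^ 2 + Rc x ^ 2) * D x ^ 2 ∂ν with hQ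
  set P := (∫ x, (Rm x ^ (2 * p) + Rc x ^ (2 * p)) ∂ν) ^ (1 / p)
    * (∫ x, D x ^ (2 * p / (p - 1)) ∂ν) ^ ((p - 1) / p) with hP
  have hI0 : 0 ≤ I := integral_nonneg fun x => sq_nonneg _
  have hH30 : 0 ≤ ∫ x, H x ^ 3 ∂ν := integral_nonneg fun x => pow_nonneg (hH0 x) 3
  have hD60 : 0 ≤ ∫ x, D x ^ 6 ∂ν := integral_nonneg fun x => pow_nonneg (hD0 x) 6
  have ha0 : 0 ≤ a := Real.rpow_nonneg hH30 _
  have hN0 : 0 ≤ N := Real.rpow_nonneg hD60 _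
  have hKK : 0 ≤ K := Real.rpow_nonneg hK0 _
  have hQ0 : 0 ≤ Q := integral_nonneg fun x => mul_nonneg
    (add_nonneg (sq_nonneg _) (sq_nonneg _)) (sq_nonneg _)
  have hK2 : (∫ x, (Rm x ^ 3 + Rc x ^ 3) ∂ν) ^ (2 / 3 : ℝ) = K ^ 2 := by
    rw [hK, ← Real.rpow_natCast, ← Real.rpow_mul hK0]
    norm_num
  have ha3 : a ^ 3 = ∫ x, H x ^ 3 ∂ν := by
    rw [ha, ← Real.rpow_natCast, ← Real.rpow_mul hH30]
    norm_num
  -- the part of `Q` with the Ricci tensor, and the part with the Riemann tensor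
  have hQc : ∫ x, (Rc x * D x) ^ 2 ∂ν ≤ Q := by
    refine integral_mono (hν _ ((hRc.mul hD).pow 2))
      (hν _ (((hRm.pow 2).add (hRc.pow 2)).mul (hD.pow 2))) fun x => ?_
    have : 0 ≤ Rm x ^ 2 * D x ^ 2 := by positivity
    simp only
    nlinarith
  have hQm : ∫ x, (Rm x * D x) ^ 2 ∂ν ≤ Q := by
    refine integral_mono (hν _ ((hRm.mul hD).pow 2))
      (hν _ (((hRm.pow 2).add (hRc.pow 2)).mul (hD.pow 2))) fun x => ?_
    have : 0 ≤ Rc x ^ 2 * D x ^ 2 := by positivity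
    simp only
    nlinarith
  have hHD := sqrt_integral_mul_sq_le hν hH hD hH0 hD0
  have h1 : ∫ x, T x * (H x * D x) ∂ν ≤ √I * (a * N) :=
    (integral_mul_le_sqrt hν hT (hH.mul hD) hT0 fun x => mul_nonneg (hH0 x) (hD0 x)).trans
      (mul_le_mul_of_nonneg_left hHD (Real.sqrt_nonneg _))
  have h2 : ∫ x, (Rc x * D x) * (H x * D x) ∂ν ≤ √Q * (a * N) :=
    (integral_mul_le_sqrt hν (hRc.mul hD) (hH.mul hD) (fun x => mul_nonneg (hRc0 x) (hD0 x))
      fun x => mul_nonneg (hH0 x) (hD0 x)).trans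
      (mul_le_mul (Real.sqrt_le_sqrt hQc) hHD (Real.sqrt_nonneg _) (Real.sqrt_nonneg _))
  have h3 : ∫ x, T x * (Rm x * D x) ∂ν ≤ √I * √Q :=
    (integral_mul_le_sqrt hν hT (hRm.mul hD) hT0 fun x => mul_nonneg (hRm0 x) (hD0 x)).trans
      (mul_le_mul_of_nonneg_left (Real.sqrt_le_sqrt hQm) (Real.sqrt_nonneg _))
  have hsI := Real.sqrt_nonneg I
  have hsQ := Real.sqrt_nonneg Q
  have hI2 := Real.sq_sqrt hI0
  have hQ2 := Real.sq_sqrt hQ0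
  have h4 : a ^ 2 ≤ 2 * max 1 b + 2 * (N * (√I + √Q)) := by
    refine sq_le_of_cube_le ha0 (by positivity) ?_
    rw [ha3]
    linarith
  have h5 : ∫ x, (Rm x + Rc x) * H x ^ 2 ∂ν ≤ 2 * K * a ^ 2 := by
    refine (integral_mul_sq_le hν (hRm.add hRc) hH (fun x => add_nonneg (hRm0 x) (hRc0 x))
      hH0).trans ?_
    have h6 := rpow_integral_add_le hν hRm hRc hRm0 hRc0 (p := 3) (by norm_num)
    have h7 : ∀ t : ℝ, t ^ (3 : ℝ) = t ^ 3 := fun t => by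
      rw [← Real.rpow_natCast]
      norm_num
    simp only [h7] at h6
    exact mul_le_mul_of_nonneg_right h6 (sq_nonneg a)
  have h6 : Q ≤ 2 * P := by
    have hpq := Real.HolderConjugate.conjExponent hp
    have h7 := integral_mul_le_of_continuous hν (f := fun x => Rm x ^ 2 + Rc x ^ 2)
      (g := fun x => D x ^ 2) ((hRm.pow 2).add (hRc.pow 2)) (hD.pow 2)
      (fun x => add_nonneg (sq_nonneg _) (sq_nonneg _)) (fun x => sq_nonneg _) hpq
    have h8 := rpow_integral_add_le hν (f := fun x => Rm x ^ 2) (g := fun x => Rc x ^ 2)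
      (hRm.pow 2) (hRc.pow 2) (fun x => sq_nonneg _)
      (fun x => sq_nonneg _) hp.le
    have h9 : ∀ t : ℝ, 0 ≤ t → ∀ q : ℝ, (t ^ 2) ^ q = t ^ (2 * q) := fun t ht q => by
      rw [← Real.rpow_natCast, ← Real.rpow_mul ht]
      norm_num
    have h10 : 1 / p.conjExponent = (p - 1) / p := by
      rw [Real.conjExponent, one_div_div]
    have h11 : 2 * p.conjExponent = 2 * p / (p - 1) := by
      rw [Real.conjExponent, mul_div_assoc]
    simp only [fun x => h9 (Rm x) (hRm0 x), fun x => h9 (Rc x) (hRc0 x)] at h8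
    simp only [fun x => h9 (D x) (hD0 x), h10, h11] at h7
    calc Q ≤ _ := h7
      _ ≤ (2 * (∫ x, (Rm x ^ (2 * p) + Rc x ^ (2 * p)) ∂ν) ^ (1 / p))
          * (∫ x, D x ^ (2 * p / (p - 1)) ∂ν) ^ ((p - 1) / p) :=
        mul_le_mul_of_nonneg_right h8 (Real.rpow_nonneg (integral_nonneg fun x =>
          Real.rpow_nonneg (hD0 x) _) _)
      _ = 2 * P := by rw [hP, mul_assoc]
  have hP0 : 0 ≤ P := by linarith
  have hfin := absorption hI0 hQ0 hKK hη h6 h4 (hsq.trans (by gcongr))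
  have hC0 : 0 ≤ 40 * (1 + η) ^ 2 / η := by positivity
  have hmax : (K * N) ^ 2 ≤ max (2 * K) (K ^ 2 * N ^ 2) := by
    rw [mul_pow]
    exact le_max_right _ _
  rw [hK2]
  have hle := mul_le_mul_of_nonneg_left hmax hC0
  calc I ≤ _ := hfin
    _ ≤ 40 * (1 + η) ^ 2 / η * P + 40 * (1 + η) ^ 2 / η * max (2 * K) (K ^ 2 * N ^ 2)
        + 40 * (1 + η) ^ 2 / η * (K * max 1 b) + (1 + η) * B := by linarith
    _ = _ := by rw [hP]; ring

end Interpolation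

/-! ### The integral identity and the cubic inequality -/

section Integrals

open MeasureTheory Set

variable {m : ℕ} {M : Type*} [TopologicalSpace M] [T2Space M] [SecondCountableTopology M]
  [ChartedSpace (Coord (m + 1)) M]
  [IsManifold (𝓡 (m + 1)) ∞ M] [RiemannianBundle (fun x : M => TangentSpace (𝓡 (m + 1)) x)]
  [IsContMDiffRiemannianBundle (𝓡 (m + 1)) ∞ (Coord (m + 1))
    (fun x : M => TangentSpace (𝓡 (m + 1)) x)]
  [MeasurableSpace M] [BorelSpace M] {Ω : Set M} {u : M → ℝ}
  (hΩ : IsOpen Ω) (hcl : IsCompact (closure Ω)) (hb : HasSmoothBoundary m Ω)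
  (hu : ContMDiff (𝓡 (m + 1)) 𝓘(ℝ, ℝ) ∞ u) (hlap : ∀ x ∈ Ω, laplacian (m + 1) u x = 0)
include hΩ hcl hb hu hlap

/-- The integral identity. -/
theorem setIntegral_normThird_sq :
    ∫ x in Ω, normThird (m + 1) u x ^ 2 ∂(riemannianVolume (m + 1) M)
      = (∫ x in Ω, (2 * ricGradLapGrad (m + 1) u x - ricSqGradGrad (m + 1) u x
            - ricHessHess (m + 1) u x) ∂(riemannianVolume (m + 1) M))
        + (∫ x in Ω, (riemThirdGrad (m + 1) u x - riemHessHess (m + 1) u x)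
            ∂(riemannianVolume (m + 1) M))
        + ∫ x, (thirdHessNormal (m + 1) u x (outwardNormal Ω x)
            - hessLapGradNormal (m + 1) u x (outwardNormal Ω x)) ∂(boundaryArea m Ω) := by
  have hint : ∀ {f : M → ℝ}, Continuous f → IntegrableOn f Ω (riemannianVolume (m + 1) M) :=
    fun hf => integrableOn_of_continuous hf hcl
  have hX := (thirdHessField u hu).continuous_div
  have hY := (hessLapGradField u hu).continuous_div
  have hR1 : Continuous fun x => 2 * ricGradLapGrad (m + 1) u x - ricSqGradGrad (m + 1) u x
      - ricHessHess (m + 1) u x := ((continuous_const.mul (continuous_ricGradLapGrad hu)).sub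
    (continuous_ricSqGradGrad hu)).sub (continuous_ricHessHess hu)
  have hR2 : Continuous fun x => riemThirdGrad (m + 1) u x - riemHessHess (m + 1) u x :=
    (continuous_riemThirdGrad hu).sub (continuous_riemHessHess hu)
  have hXY : Continuous fun x =>
      (thirdHessField u hu).div x - (hessLapGradField u hu).div x := hX.sub hY
  have hXY1 : Continuous fun x => (thirdHessField u hu).div x - (hessLapGradField u hu).div x
      + (2 * ricGradLapGrad (m + 1) u x - ricSqGradGrad (m + 1) u x - ricHessHess (m + 1) u x) :=
    hXY.add hR1
  have hfX := integrable_boundaryArea hΩ hcl hb ((thirdHessField u hu).continuousOn_flux hΩ hb)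
  have hfY := integrable_boundaryArea hΩ hcl hb ((hessLapGradField u hu).continuousOn_flux hΩ hb)
  simp only [← flux_thirdHessField hu, ← flux_hessLapGradField hu]
  rw [integral_sub hfX hfY, ← CovectorField.setIntegral_div_eq _ hΩ hcl hb,
    ← CovectorField.setIntegral_div_eq _ hΩ hcl hb,
    setIntegral_congr_fun hΩ.measurableSet fun x hx => normThird_sq_eq hu hΩ hlap hx,
    integral_add (hint hXY1) (hint hR2), integral_add (hint hXY) (hint hR1),
    integral_sub (hint hX) (hint hY)]
  ring

/-- The bound for `∫ |∇²u|³` by integration by parts. -/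
theorem setIntegral_normHess_cube_le :
    ∫ x in Ω, normHess (m + 1) u x ^ 3 ∂(riemannianVolume (m + 1) M)
      ≤ (∫ x, normHess (m + 1) u x ^ 2 * normGrad (m + 1) u x ∂(boundaryArea m Ω))
        + (∫ x in Ω, normThird (m + 1) u x * (normHess (m + 1) u x * normGrad (m + 1) u x)
            ∂(riemannianVolume (m + 1) M))
        + ∫ x in Ω, (normRic (m + 1) x * normGrad (m + 1) u x)
            * (normHess (m + 1) u x * normGrad (m + 1) u x) ∂(riemannianVolume (m + 1) M) := by
  have hint : ∀ {f : M → ℝ}, Continuous f → IntegrableOn f Ω (riemannianVolume (m + 1) M) :=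
    fun hf => integrableOn_of_continuous hf hcl
  have hbint : ∀ {f : M → ℝ}, Continuous f → Integrable f (boundaryArea m Ω) :=
    fun hf => integrable_boundaryArea hΩ hcl hb hf.continuousOn
  have hH := continuous_normHess hu
  have hD := continuous_normGrad hu
  have hT := continuous_normThird hu
  have hR := continuous_normRic (n := m + 1) (M := M)
  set μ := (riemannianVolume (m + 1) M).restrict Ω
  set κ := (∫ x, normHess (m + 1) u x * normGrad (m + 1) u x ∂(boundaryArea m Ω))
    + ∫ x, normRic (m + 1) x * normGrad (m + 1) u x ^ 2 ∂μ
  have hκ : 0 ≤ κ := add_nonneg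
    (integral_nonneg fun x => mul_nonneg (Real.sqrt_nonneg _) (Real.sqrt_nonneg _))
    (integral_nonneg fun x => mul_nonneg (Real.sqrt_nonneg _) (sq_nonneg _))
  refine le_of_forall_pos_le_add fun δ hδ => ?_
  -- the weight `ε` is chosen such that the error `ε * κ` is at most `δ`
  set ε := δ / (κ + 1)
  have hε : 0 < ε := by positivity
  have hεκ : ε * κ ≤ δ := by
    rw [div_mul_eq_mul_div, div_le_iff₀ (by positivity)]
    nlinarith
  set α := weightedHessGradField u hu ε hε
  have hTHD : Continuous fun x =>
    normThird (m + 1) u x * normHess (m + 1) u x * normGrad (m + 1) u x := (hT.mul hH).mul hD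
  have hRD : Continuous fun x => normRic (m + 1) x * normGrad (m + 1) u x ^ 2 :=
    hR.mul (hD.pow 2)
  have hHRD : Continuous fun x => (normHess (m + 1) u x + ε)
    * (normRic (m + 1) x * normGrad (m + 1) u x ^ 2) := (hH.add continuous_const).mul hRD
  have hαT : Continuous fun x => α.div x
      + normThird (m + 1) u x * normHess (m + 1) u x * normGrad (m + 1) u x :=
    α.continuous_div.add hTHD
  have hHD : Continuous fun x => normHess (m + 1) u x * normGrad (m + 1) u x := hH.mul hD
  have hHHD : Continuous fun x => normHess (m + 1) u x ^ 2 * normGrad (m + 1) u x :=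
    (hH.pow 2).mul hD
  have hεHD : Continuous fun x => ε * (normHess (m + 1) u x * normGrad (m + 1) u x) :=
    continuous_const.mul hHD
  have hRDHD : Continuous fun x => normRic (m + 1) x * normGrad (m + 1) u x
    * (normHess (m + 1) u x * normGrad (m + 1) u x) := (hR.mul hD).mul hHD
  have hεRD : Continuous fun x => ε * (normRic (m + 1) x * normGrad (m + 1) u x ^ 2) :=
    continuous_const.mul hRD
  have h1 : ∫ x, normHess (m + 1) u x ^ 3 ∂μ ≤ ∫ x, (α.div x
      + normThird (m + 1) u x * normHess (m + 1) u x * normGrad (m + 1) u x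
      + (normHess (m + 1) u x + ε) * (normRic (m + 1) x * normGrad (m + 1) u x ^ 2)) ∂μ :=
    setIntegral_mono_on (hint (hH.pow 3)) (hint (hαT.add hHRD)) hΩ.measurableSet
      fun x hx => normHess_cube_le hu hΩ hlap hx hε
  have h2 : ∫ x, α.flux Ω x ∂(boundaryArea m Ω)
      ≤ ∫ x, (normHess (m + 1) u x + ε) * (normHess (m + 1) u x * normGrad (m + 1) u x)
        ∂(boundaryArea m Ω) :=
    integral_mono (integrable_boundaryArea hΩ hcl hb (α.continuousOn_flux hΩ hb))
      (hbint ((hH.add continuous_const).mul hHD))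
      fun x => flux_weightedHessGradField_le hu hε
  rw [integral_add (hint hαT) (hint hHRD), integral_add (hint α.continuous_div) (hint hTHD),
    α.setIntegral_div_eq hΩ hcl hb] at h1
  have h3 : ∫ x, (normHess (m + 1) u x + ε) * (normHess (m + 1) u x * normGrad (m + 1) u x)
      ∂(boundaryArea m Ω)
      = (∫ x, normHess (m + 1) u x ^ 2 * normGrad (m + 1) u x ∂(boundaryArea m Ω))
        + ε * ∫ x, normHess (m + 1) u x * normGrad (m + 1) u x ∂(boundaryArea m Ω) := by
    rw [← integral_const_mul, ← integral_add (hbint hHHD) (hbint hεHD)]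
    congr 1
    ext x
    ring
  have h4 : ∫ x, (normHess (m + 1) u x + ε) * (normRic (m + 1) x * normGrad (m + 1) u x ^ 2) ∂μ
      = (∫ x, (normRic (m + 1) x * normGrad (m + 1) u x)
            * (normHess (m + 1) u x * normGrad (m + 1) u x) ∂μ)
        + ε * ∫ x, normRic (m + 1) x * normGrad (m + 1) u x ^ 2 ∂μ := by
    rw [← integral_const_mul, ← integral_add (hint hRDHD) (hint hεRD)]
    congr 1
    ext x
    ring
  have h5 : ε * κ = ε * (∫ x, normHess (m + 1) u x * normGrad (m + 1) u x ∂(boundaryArea m Ω))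
      + ε * ∫ x, normRic (m + 1) x * normGrad (m + 1) u x ^ 2 ∂μ := mul_add _ _ _
  simp only [mul_assoc (normThird (m + 1) u _)] at h1
  linarith

/-- The bound for `∫ |∇³u|²` by the integral identity, where `Rc(∇u, Δ∇u) = Rc²(∇u, ∇u)` and all
contractions are estimated by the Cauchy–Schwarz inequality. -/
theorem setIntegral_normThird_sq_le :
    ∫ x in Ω, normThird (m + 1) u x ^ 2 ∂(riemannianVolume (m + 1) M)
      ≤ (∫ x in Ω, (normRic (m + 1) x * normGrad (m + 1) u x) ^ 2 ∂(riemannianVolume (m + 1) M))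
        + (∫ x in Ω, (normRiem (m + 1) x + normRic (m + 1) x) * normHess (m + 1) u x ^ 2
            ∂(riemannianVolume (m + 1) M))
        + (∫ x in Ω, normThird (m + 1) u x * (normRiem (m + 1) x * normGrad (m + 1) u x)
            ∂(riemannianVolume (m + 1) M))
        + ∫ x, (thirdHessNormal (m + 1) u x (outwardNormal Ω x)
            - hessLapGradNormal (m + 1) u x (outwardNormal Ω x)) ∂(boundaryArea m Ω) := by
  have hint : ∀ {f : M → ℝ}, Continuous f → IntegrableOn f Ω (riemannianVolume (m + 1) M) :=
    fun hf => integrableOn_of_continuous hf hcl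
  have hH := continuous_normHess hu
  have hD := continuous_normGrad hu
  have hT := continuous_normThird hu
  have hR := continuous_normRic (n := m + 1) (M := M)
  have hRm := continuous_normRiem (n := m + 1) (M := M)
  have hR1 : Continuous fun x => 2 * ricGradLapGrad (m + 1) u x - ricSqGradGrad (m + 1) u x
      - ricHessHess (m + 1) u x := ((continuous_const.mul (continuous_ricGradLapGrad hu)).sub
    (continuous_ricSqGradGrad hu)).sub (continuous_ricHessHess hu)
  have hR2 : Continuous fun x => riemThirdGrad (m + 1) u x - riemHessHess (m + 1) u x :=
    (continuous_riemThirdGrad hu).sub (continuous_riemHessHess hu)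
  have hA : Continuous fun x => (normRic (m + 1) x * normGrad (m + 1) u x) ^ 2 :=
    (hR.mul hD).pow 2
  have hB : Continuous fun x =>
    (normRiem (m + 1) x + normRic (m + 1) x) * normHess (m + 1) u x ^ 2 :=
    (hRm.add hR).mul (hH.pow 2)
  have hAB : Continuous fun x => (normRic (m + 1) x * normGrad (m + 1) u x) ^ 2
    + (normRiem (m + 1) x + normRic (m + 1) x) * normHess (m + 1) u x ^ 2 := hA.add hB
  have hE : Continuous fun x =>
      normThird (m + 1) u x * (normRiem (m + 1) x * normGrad (m + 1) u x) :=
    hT.mul (hRm.mul hD)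
  rw [setIntegral_normThird_sq hΩ hcl hb hu hlap, ← integral_add (hint hR1) (hint hR2),
    ← integral_add (hint hA) (hint hB),
    ← integral_add (hint hAB) (hint hE)]
  gcongr ?_ + _
  refine setIntegral_mono_on (hint (hR1.add hR2)) (hint (hAB.add hE))
    hΩ.measurableSet fun x hx => ?_
  have h1 := ricGradLapGrad_eq_of_harmonic hu hΩ hlap hx
  have h2 := ricSqGradGrad_le_norm (n := m + 1) (u := u) (x := x)
  have h3 := (abs_le.mp (abs_ricHessHess_le_norm (n := m + 1) (u := u) (x := x))).1
  have h4 := (abs_le.mp (abs_riemThirdGrad_le_norm (n := m + 1) (u := u) (x := x))).2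
  have h5 := (abs_le.mp (abs_riemHessHess_le_norm (n := m + 1) (u := u) (x := x))).1
  rw [h1]
  linarith

end Integrals

end HarmonicEstimates

end

theorem mainTheorem5 (η : ℝ) (hη : 0 < η) :
    ∃ C : ℝ, 0 < C ∧
      ∀ (m : ℕ) (M : Type*) [MetricSpace M] [ChartedSpace (Coord (m + 1)) M]
        [IsManifold (𝓡 (m + 1)) ∞ M]
        [RiemannianBundle (fun x : M => TangentSpace (𝓡 (m + 1)) x)]
        [IsContMDiffRiemannianBundle (𝓡 (m + 1)) ∞ (Coord (m + 1))
          (fun x : M => TangentSpace (𝓡 (m + 1)) x)]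
        [IsRiemannianManifold (𝓡 (m + 1)) M] [CompleteSpace M]
        [MeasurableSpace M] [BorelSpace M]
        (Ω : Set M) (u : M → ℝ),
        IsOpen Ω → Bornology.IsBounded Ω → HasSmoothBoundary m Ω →
        ContMDiff (𝓡 (m + 1)) 𝓘(ℝ, ℝ) ∞ u →
        (∀ x ∈ Ω, laplacian (m + 1) u x = 0) →
        (∫ x in Ω, normThird (m + 1) u x ^ 2 ∂(riemannianVolume (m + 1) M)
          = (∫ x in Ω, (2 * ricGradLapGrad (m + 1) u x - ricSqGradGrad (m + 1) u x
                - ricHessHess (m + 1) u x) ∂(riemannianVolume (m + 1) M))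
            + (∫ x in Ω, (riemThirdGrad (m + 1) u x - riemHessHess (m + 1) u x)
                ∂(riemannianVolume (m + 1) M))
            + ∫ x, (thirdHessNormal (m + 1) u x (outwardNormal Ω x)
                - hessLapGradNormal (m + 1) u x (outwardNormal Ω x)) ∂(boundaryArea m Ω)) ∧
        ∀ p : ℝ, 1 < p →
          ∫ x in Ω, normThird (m + 1) u x ^ 2 ∂(riemannianVolume (m + 1) M)
            ≤ C * (∫ x in Ω, (normRiem (m + 1) x ^ (2 * p) + normRic (m + 1) x ^ (2 * p))
                    ∂(riemannianVolume (m + 1) M)) ^ (1 / p)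
                * (∫ x in Ω, normGrad (m + 1) u x ^ (2 * p / (p - 1))
                    ∂(riemannianVolume (m + 1) M)) ^ ((p - 1) / p)
              + C * max
                  (2 * (∫ x in Ω, (normRiem (m + 1) x ^ 3 + normRic (m + 1) x ^ 3)
                    ∂(riemannianVolume (m + 1) M)) ^ (1 / 3 : ℝ))
                  ((∫ x in Ω, (normRiem (m + 1) x ^ 3 + normRic (m + 1) x ^ 3)
                    ∂(riemannianVolume (m + 1) M)) ^ (2 / 3 : ℝ)
                    * ((∫ x in Ω, normGrad (m + 1) u x ^ 6
                        ∂(riemannianVolume (m + 1) M)) ^ (1 / 6 : ℝ)) ^ 2)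
              + C * (∫ x in Ω, (normRiem (m + 1) x ^ 3 + normRic (m + 1) x ^ 3)
                    ∂(riemannianVolume (m + 1) M)) ^ (1 / 3 : ℝ)
                  * max 1 (∫ x, normHess (m + 1) u x ^ 2 * normGrad (m + 1) u x
                      ∂(boundaryArea m Ω))
              + (1 + η) * ∫ x, (thirdHessNormal (m + 1) u x (outwardNormal Ω x)
                  - hessLapGradNormal (m + 1) u x (outwardNormal Ω x)) ∂(boundaryArea m Ω) := by
  refine ⟨40 * (1 + η) ^ 2 / η, by positivity, ?_⟩
  intro m M _ _ _ _ _ _ _ _ _ Ω u hΩ hbd hb hu hlap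
  have hproper : ProperSpace M := properSpace_of_complete (m + 1) M
  have hcl : IsCompact (closure Ω) := hbd.isCompact_closure
  exact ⟨setIntegral_normThird_sq hΩ hcl hb hu hlap, fun p hp =>
    integral_sq_le_of_interpolation (fun f hf => integrableOn_of_continuous hf hcl)
      (continuous_normThird hu) (continuous_normHess hu) (continuous_normGrad hu)
      continuous_normRiem continuous_normRic (fun _ => Real.sqrt_nonneg _)
      (fun _ => Real.sqrt_nonneg _) (fun _ => Real.sqrt_nonneg _) (fun _ => Real.sqrt_nonneg _)
      (fun _ => Real.sqrt_nonneg _) (setIntegral_normHess_cube_le hΩ hcl hb hu hlap)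
      (setIntegral_normThird_sq_le hΩ hcl hb hu hlap) hη hp⟩
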